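/- There are constants $C\in\mathbb R$ and $\alpha^*\in(0,1/2)$ such that the following holds. **Model.** Let $\alpha\in[0,1/2)$ and $\mu\in\mathbb R$ be fixed, and let $a=a_n>0$, $b=b_n>0$ satisfy, as $n\to\infty$, $a/b=\Theta(1)$, $a=n^{o(1)}$, $a\to\infty$ and $(a-b)/\sqrt b\to\mu$. On the vertex set $[n]$ let the labels $\sigma_i\in\{+,-\}$ be independent and uniform; given $\sigma$, each pair $i,j$ is joined in the graph $G=G_n$ independently with probability $a/n$ if $\sigma_i=\sigma_j$ and $b/n$ otherwise (these are probabilities for all large $n$); and, independently for each $i$, the observed noisy label $\tilde\sigma_i$ equals $\sigma_i$ with probability $1-\alpha$ and $-\sigma_i$ with probability $\alpha$. The accuracy of an estimator $\hat\sigma=\hat\sigma(G,\tilde\sigma)$ is $p_{G_n}(\hat\sigma)=\frac1n\sum_{i=1}^n P(\sigma_i=\hat\sigma_i)$, and $p^*_{G_n}$ is the maximum of the accuracy over all estimators. **Local belief propagation.** Let $\gamma=\frac12\log\frac{1-\alpha}{\alpha}$ ($=+\infty$ if $\alpha=0$), $h_i=\tilde\sigma_i\gamma$, $\beta=\frac12\log\frac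 ab$, and $F(x)=\tanh^{-1}(\tanh\beta\,\tanh x)$ for $x\in[-\infty,\infty]$. The messages are $$R^{t}_{i\to j}=h_i+\sum_{\ell\in\partial i\setminus\{j\}}F(R^{t-1}_{\ell\to i})\quad(t\ge1),$$ where $\partial i$ is the set of neighbours of $i$, with the initial condition $R^0_{i\to j}=h_i$ for all $i,j$, or alternatively $R^0_{i\to j}=0$ for all $i,j$ (the claims below hold for each of the two). For $t\ge1$ let $R^t_i=h_i+\sum_{\ell\in\partial i}F(R^{t-1}_{\ell\to i})$, and let $\hat\sigma^t_{\rm BP}(i)=+$ if $R^t_i\ge0$ and $-$ otherwise. **Result.** Let $Z\sim\mathcal N(0,1)$ and let $U$ be independent of $Z$, with $U=\gamma$ with probability $1-\alpha$ and $U=-\gamma$ with probability $\alpha$. Let $h(v)=E[\tanh(v+\sqrt v\,Z+U)]$ for $v\ge0$ and $Q(x)=\int_x^\infty\frac1{\sqrt{2\pi}}e^{-y^2/2}\,dy$. For $v=0$ read $(v+U)/\sqrt v$ as its limit for $v\downarrow0$, that is, $+\infty$ if $U>0$ and $-\infty$ if $U<0$. Then the equation $v=\frac{\mu^2}4h(v)$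 has a smallest solution $\underline v$ and a largest solution $\overline v$ in $[0,\infty)$; the limit $\lim_{n\to\infty}p_{G_n}(\hat\sigma^t_{\rm BP})$ exists for every $t\ge1$; and $$\lim_{t\to\infty}\lim_{n\to\infty}p_{G_n}(\hat\sigma^t_{\rm BP})=1-E\left[Q\left(\frac{\underline v+U}{\sqrt{\underline v}}\right)\right],\qquad \limsup_{n\to\infty}p^*_{G_n}\le1-E\left[Q\left(\frac{\overline v+U}{\sqrt{\overline v}}\right)\right].$$ Moreover, if $|\mu|<2$, or $|\mu|>C$, or $\alpha\le\alpha^*$, then $\underline v=\overline v$ and $\lim_{t\to\infty}\lim_{n\to\infty}p_{G_n}(\hat\sigma^t_{\rm BP})=\limsup_{n\to\infty}p^*_{G_n}$. -/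

import Mathlib

open Filter Topology MeasureTheory ProbabilityTheory Asymptotics
open scoped BigOperators

noncomputable section

namespace SBM

/-! A vertex label is a `Bool`, where `true` is the label `+` and `false` is the label `-`. -/

/-- The joint probability of the true labels `σ`, the graph `G` and the noisy labels `τ` on `n`
vertices: the labels are independent and uniform, each pair is joined with probability `a / n` if
the labels agree and `b / n` otherwise, and each noisy label is wrong with probability `α`. -/
def weight {n : ℕ} (a b α : ℝ) (σ : Fin n → Bool) (G : SimpleGraph (Fin n))
    (τ : Fin n → Bool) : ℝ :=
  open Classical in
  (1 / 2) ^ n *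
    (∏ i : Fin n, ∏ j ∈ Finset.Ioi i,
      if G.Adj i j then (if σ i = σ j then a / n else b / n)
      else 1 - (if σ i = σ j then a / n else b / n)) *
    ∏ i : Fin n, if τ i = σ i then 1 - α else α

/-- The probability of the event `E` under the law `weight`. -/
def prob (n : ℕ) (a b α : ℝ)
    (E : (Fin n → Bool) → SimpleGraph (Fin n) → (Fin n → Bool) → Prop) : ℝ :=
  open Classical in
  ∑ σ : Fin n → Bool, ∑ G : SimpleGraph (Fin n), ∑ τ : Fin n → Bool,
    if E σ G τ then weight a b α σ G τ else 0

/-- An estimator of the labels from the graph and the noisy labels. -/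
abbrev Estimator (n : ℕ) : Type := SimpleGraph (Fin n) → (Fin n → Bool) → Fin n → Bool

/-- The estimation accuracy: the expected fraction of correctly labelled vertices. -/
def accuracy {n : ℕ} (a b α : ℝ) (s : Estimator n) : ℝ :=
  (1 / n) * ∑ i : Fin n, prob n a b α (fun σ G τ => σ i = s G τ i)

/-- The optimal estimation accuracy over all estimators. -/
def optAccuracy (n : ℕ) (a b α : ℝ) : ℝ := ⨆ s : Estimator n, accuracy a b α s

/-- `γ = (1/2) log ((1 - α) / α)`, which is `+∞` for `α = 0`. -/
def gam (α : ℝ) : EReal :=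
  open Classical in
  if α = 0 then ⊤ else ((1 / 2 * Real.log ((1 - α) / α) : ℝ) : EReal)

/-- `tanh` on the extended reals. -/
def etanh (x : EReal) : ℝ :=
  open Classical in
  if x = ⊤ then 1 else if x = ⊥ then -1 else Real.tanh x.toReal

/-- The external field of a vertex with noisy label `s`. -/
def field (α : ℝ) (s : Bool) : EReal := if s then gam α else -gam α

/-- `F(x) = artanh (tanh β * tanh x)` with `β = (1/2) log (a / b)`. -/
def F (a b : ℝ) (x : EReal) : ℝ :=
  Real.artanh (Real.tanh (1 / 2 * Real.log (a / b)) * etanh x)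

/-- The two initializations of the messages: all zero, or `γ` / `-γ` according to the noisy label
of the sender. -/
inductive Init where
  | zero : Init
  | noisy : Init

/-- The initial message sent by a vertex with noisy label `s`. -/
def Init.message (α : ℝ) (s : Bool) : Init → EReal
  | .zero => 0
  | .noisy => field α s

/-- The message `R^t_{i → j}` of belief propagation (meaningful for adjacent `i`, `j`). -/
def message {n : ℕ} (I : Init) (a b α : ℝ) (G : SimpleGraph (Fin n)) (τ : Fin n → Bool) :
    ℕ → Fin n → Fin n → EReal
  | 0, i, _ => I.message α (τ i)
  | t + 1, i, j =>
    open Classical in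
    field α (τ i) +
      ((∑ l : Fin n with G.Adj l i ∧ l ≠ j, F a b (message I a b α G τ t l i) : ℝ) : EReal)

/-- The belief `R^t_i` (for `t ≥ 1`), computed from the messages of time `t - 1`. -/
def belief {n : ℕ} (I : Init) (a b α : ℝ) (G : SimpleGraph (Fin n)) (τ : Fin n → Bool)
    (t : ℕ) (i : Fin n) : EReal :=
  open Classical in
  field α (τ i) +
    ((∑ l : Fin n with G.Adj l i, F a b (message I a b α G τ (t - 1) l i) : ℝ) : EReal)

/-- The belief propagation estimator for `t ≥ 1` iterations: `+` if and only if `R^t_i ≥ 0`. -/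
def bp {n : ℕ} (I : Init) (a b α : ℝ) (t : ℕ) : Estimator n :=
  open Classical in
  fun G τ i => decide (0 ≤ belief I a b α G τ t i)

/-- `E[f(U)]`, where `U = γ` with probability `1 - α` and `U = -γ` with probability `α`. -/
def expU (α : ℝ) (f : EReal → ℝ) : ℝ := (1 - α) * f (gam α) + α * f (-gam α)

/-- `h(v) = E[tanh (v + √v Z + U)]` with `Z` standard normal and independent of `U`. -/
def h (α v : ℝ) : ℝ :=
  expU α fun u => ∫ z, etanh (((v + √v * z : ℝ) : EReal) + u) ∂(gaussianReal 0 1)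

/-- The Gaussian tail function on the extended reals, `Q(+∞) = 0` and `Q(-∞) = 1`. -/
def Q (x : EReal) : ℝ :=
  ∫ y in {y : ℝ | x < (y : EReal)}, 1 / √(2 * Real.pi) * Real.exp (-y ^ 2 / 2)

/-- `(v + u) / √v`, which for `v = 0` is read as its limit for `v ↓ 0`, namely
`+∞` for `u > 0` and `-∞` for `u < 0`. -/
def ratio (v : ℝ) (u : EReal) : EReal :=
  open Classical in
  if v = 0 then u * ⊤ else ((v : EReal) + u) / ((√v : ℝ) : EReal)

/-- `1 - E[Q((v + U) / √v)]`. -/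
def gaussAccuracy (α v : ℝ) : ℝ := 1 - expU α fun u => Q (ratio v u)

/-- The nonnegative fixed points of `v = (μ² / 4) h(v)`. -/
def fixedPoints (α μ : ℝ) : Set ℝ := {v | 0 ≤ v ∧ v = μ ^ 2 / 4 * h α v}

end SBM

end

/-! Put λ = μ²/4 and θ = tanh β = (a - b)/(a + b). Degrees are n^{o(1)}, so a ball of fixed radius
is a tree with high probability (`pr_not_treeLike_le`). There belief propagation coincides with a
recursion along self-avoiding walks (`belief_eq`), and this recursion computes marginals of an Ising
model exactly (`exists_marg_treeWeight`).

State evolution. Let T be the hyperbolic tangent of a message and σ the label of its sender, and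
suppose that E[σT] and E[T²] tend to the same number m. A vertex receives a sum of many terms
artanh(θT) with θ → 0, and messages from distinct vertices are almost uncorrelated (`abs_cov_le`).
Multiplied by the label of the receiver, the sum therefore has drift and variance both close to λm,
and its law tends to N(λm, λm) (`norm_charFun_sub_le`). Adding the field and applying tanh gives
h(λm) as the next limit of E[σT]. The limit of E[T²] is the same by the Nishimori identity
(`mix_odd`, `mix_tanh_eq_sq`). So v = λm evolves by v ↦ λ h(v) (`unifTendsto_moments`), and the
accuracy at time t is a Gaussian probability at the current v.

Lower end. The two initializations correspond to m = 0 and m = (1 - 2α)² = h(0), that is, to the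
same orbit of 0 up to a shift. By monotonicity of h this orbit increases to the least fixed point.

Upper end. An estimator of the label of i can only gain if the labels far from i are revealed. The
best decision is then, up to a vanishing error, the sign of the same recursion started from the true
labels (`sum_correct_le`, `prob_correct_le`), for which m = 1. The error comes from the weak
interaction along nonadjacent pairs, which is negligible because the labels are nearly balanced. The
orbit of λ decreases to the greatest fixed point.

Uniqueness. The Gaussian family N(v, v) is a convolution semigroup compatible with the Nishimori
identity, which gives h(w) - h(v) ≤ (1 - h(v))(w - v) for v ≤ w (`mix_tanh_increment`). Two fixed
points then coincide as soon as λ(1 - h(v)) < 1 at the lower one (`eq_of_contraction`). This holds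
for λ < 1, for large λ because 1 - h(v) ≤ exp(-v/2), and for small α because 1 - h(0) is small.

For α = 0 the field is infinite, belief propagation repeats the exact noisy labels, and everything
is equal to 1; this case is treated apart. -/

namespace SBM

/-! ### The Gaussian laws N(v, v), their Nishimori identities, and bounds for the mean of tanh. -/

section Gaussian

/-- With u = tanh y and g = tanh x, the addition formula turns the left side into the gain from
averaging tanh(y ± x) with weights (1 ± g)/2. The right side shows that this gain is nonnegative. -/
lemma mixture_rational_identity (u g : ℝ) (h1 : 1 + u * g ≠ 0) (h2 : 1 - u * g ≠ 0) :
    (1 + g) / 2 * ((u + g) / (1 + u * g)) + (1 - g) / 2 * ((u - g) / (1 - u * g)) - u =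
      (1 - u) * g ^ 2 * (1 - u ^ 2) / ((1 + u * g) * (1 - u * g)) := by
  rw [eq_div_iff (mul_ne_zero h1 h2)]
  have e1 : (u + g) / (1 + u * g) * (1 + u * g) = u + g := div_mul_cancel₀ _ h1
  have e2 : (u - g) / (1 - u * g) * (1 - u * g) = u - g := div_mul_cancel₀ _ h2
  linear_combination (1 + g) / 2 * (1 - u * g) * e1 + (1 - g) / 2 * (1 + u * g) * e2

/-- The same average with the sign of y also randomized, with weights (1 ± u)/2. What is added to g²
is nonnegative and of order u², which yields both bounds of `tanh_sq_le_mix_tanh`. -/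
lemma symmetrized_rational_identity (u g : ℝ) (h1 : 1 + u * g ≠ 0) (h2 : 1 - u * g ≠ 0) :
    (1 + u) / 2 * ((1 + g) / 2 * ((u + g) / (1 + u * g)) +
      (1 - g) / 2 * ((u - g) / (1 - u * g))) + (1 - u) / 2 *
      ((1 + g) / 2 * -((u - g) / (1 - u * g)) + (1 - g) / 2 * -((u + g) / (1 + u * g))) =
      g ^ 2 + u ^ 2 * (1 - g ^ 2) ^ 2 / (1 - g ^ 2 * u ^ 2) := by
  have h3 : 1 - g ^ 2 * u ^ 2 = (1 + u * g) * (1 - u * g) := by ring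
  rw [h3]
  have e3 : u ^ 2 * (1 - g ^ 2) ^ 2 / ((1 + u * g) * (1 - u * g)) * ((1 + u * g) * (1 - u * g)) =
    u ^ 2 * (1 - g ^ 2) ^ 2 := div_mul_cancel₀ _ (mul_ne_zero h1 h2)
  have e1 : (u + g) / (1 + u * g) * (1 + u * g) = u + g := div_mul_cancel₀ _ h1
  have e2 : (u - g) / (1 - u * g) * (1 - u * g) = u - g := div_mul_cancel₀ _ h2
  apply mul_right_cancel₀ (mul_ne_zero h1 h2)
  linear_combination (u + g) / 2 * (1 - u * g) * e1 + (u - g) / 2 * (1 + u * g) * e2 - e3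

/-- The normal law with mean and variance both equal to `v`. -/
noncomputable def driftGauss (v : ℝ) : Measure ℝ := gaussianReal v v.toNNReal

instance (v : ℝ) : IsProbabilityMeasure (driftGauss v) := by
  unfold driftGauss; infer_instance

lemma continuous_tanh : Continuous Real.tanh := by
  have : Real.tanh = fun x => Real.sinh x / Real.cosh x := by
    funext x; exact Real.tanh_eq_sinh_div_cosh x
  rw [this]
  exact Real.continuous_sinh.div Real.continuous_cosh fun x => (Real.cosh_pos x).ne'

lemma abs_tanh_lt_one (x : ℝ) : |Real.tanh x| < 1 :=
  abs_lt.2 ⟨Real.neg_one_lt_tanh x, Real.tanh_lt_one x⟩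

lemma tanh_add (x y : ℝ) :
    Real.tanh (x + y) = (Real.tanh x + Real.tanh y) / (1 + Real.tanh x * Real.tanh y) := by
  simp only [Real.tanh_eq_sinh_div_cosh, Real.sinh_add, Real.cosh_add]
  have hx := (Real.cosh_pos x).ne'
  have hy := (Real.cosh_pos y).ne'
  have h := (Real.cosh_pos (x + y)).ne'
  rw [Real.cosh_add] at h
  have h2 : 1 + Real.sinh x / Real.cosh x * (Real.sinh y / Real.cosh y) =
      (Real.cosh x * Real.cosh y + Real.sinh x * Real.sinh y) / (Real.cosh x * Real.cosh y) := by
    field_simp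
  rw [h2]
  field_simp

lemma one_add_tanh_mul_pos (x y : ℝ) : 0 < 1 + Real.tanh x * Real.tanh y := by
  have h1 := abs_tanh_lt_one x
  have h2 := abs_tanh_lt_one y
  have : |Real.tanh x * Real.tanh y| < 1 := by
    rw [abs_mul]; nlinarith [abs_nonneg (Real.tanh x), abs_nonneg (Real.tanh y)]
  linarith [(abs_lt.1 this).1]

lemma one_add_tanh (x : ℝ) : 1 + Real.tanh x = Real.exp (2 * x) * (1 - Real.tanh x) := by
  rw [Real.tanh_eq_sinh_div_cosh]
  have hx := (Real.cosh_pos x).ne'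
  have h1 : Real.cosh x + Real.sinh x = Real.exp x := Real.cosh_add_sinh x
  have h2 : Real.cosh x - Real.sinh x = Real.exp (-x) := Real.cosh_sub_sinh x
  have h3 : Real.exp (2 * x) * Real.exp (-x) = Real.exp x := by
    rw [← Real.exp_add]; ring_nf
  field_simp
  rw [h1, h2, h3]

lemma one_sub_tanh_le (x : ℝ) : 1 - Real.tanh x ≤ Real.exp (-x) := by
  rw [Real.tanh_eq_sinh_div_cosh]
  have hx := Real.cosh_pos x
  have h2 : Real.cosh x - Real.sinh x = Real.exp (-x) := Real.cosh_sub_sinh x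
  have h4 : 1 - Real.sinh x / Real.cosh x = Real.exp (-x) / Real.cosh x := by
    field_simp; exact h2
  rw [h4]
  exact div_le_self (Real.exp_pos _).le (Real.one_le_cosh x)

lemma integrable_driftGauss {f : ℝ → ℝ} (hf : Continuous f) (C : ℝ) (hC : ∀ x, |f x| ≤ C)
    (v : ℝ) : Integrable f (driftGauss v) :=
  Integrable.of_bound hf.aestronglyMeasurable C (ae_of_all _ hC)

lemma integral_standard_eq_driftGauss {v : ℝ} (hv : 0 ≤ v) {f : ℝ → ℝ} (hf : Measurable f) :
    ∫ z, f (v + √v * z) ∂(gaussianReal 0 1) = ∫ y, f y ∂(driftGauss v) := by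
  have h : (gaussianReal 0 1).map (fun z => v + √v * z) = driftGauss v := by
    have h1 : (gaussianReal 0 1).map (fun z => v + √v * z) =
        ((gaussianReal 0 1).map (fun z => √v * z)).map (fun z => v + z) := by
      rw [Measure.map_map (by fun_prop) (by fun_prop)]; rfl
    rw [h1, gaussianReal_map_const_mul, gaussianReal_map_const_add, driftGauss]
    congr 1
    · simp
    · ext; simp [Real.sq_sqrt hv, Real.coe_toNNReal _ hv]
  rw [← h, integral_map (by fun_prop) hf.aestronglyMeasurable]

/-- The density p of N(v, v) satisfies p(y) = exp(2y) p(-y), and 1 + tanh y = exp(2y)(1 - tanh y).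
So p(y)(1 - tanh y) is even and the integrand is odd. No integrability is needed, since the integral
equals its own negative in any case. -/
lemma integral_odd_mul_one_sub_tanh {v : ℝ} (hv : 0 ≤ v) {φ : ℝ → ℝ}
    (hφ : ∀ x, φ (-x) = -φ x) :
    ∫ y, φ y * (1 - Real.tanh y) ∂(driftGauss v) = 0 := by
  rcases hv.eq_or_lt with rfl | hv
  · have h0 : φ 0 = 0 := by have := hφ 0; simp at this; linarith
    simp [driftGauss, gaussianReal_zero_var, h0]
  · have hne : v.toNNReal ≠ 0 := by simpa using hv
    rw [driftGauss, integral_gaussianReal_eq_integral_smul hne]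
    set F := fun x : ℝ => gaussianPDFReal v v.toNNReal x • (φ x * (1 - Real.tanh x)) with hF
    have hodd : ∀ x, F (-x) = -F x := by
      intro x
      have hp : gaussianPDFReal v v.toNNReal x =
          Real.exp (2 * x) * gaussianPDFReal v v.toNNReal (-x) := by
        simp only [gaussianPDFReal, Real.coe_toNNReal _ hv.le]
        rw [mul_left_comm, ← Real.exp_add]
        congr 2
        field_simp
        ring
      simp only [hF, hφ, Real.tanh_neg, smul_eq_mul, sub_neg_eq_add]
      rw [hp, one_add_tanh]
      ring
    have h1 : ∫ x, F (-x) = ∫ x, F x := integral_neg_eq_self F volume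
    simp_rw [hodd] at h1
    rw [integral_neg] at h1
    linarith

lemma integral_odd_eq {v : ℝ} (hv : 0 ≤ v) {φ : ℝ → ℝ} (hφ : ∀ x, φ (-x) = -φ x)
    (h1 : Integrable φ (driftGauss v))
    (h2 : Integrable (fun y => φ y * Real.tanh y) (driftGauss v)) :
    ∫ y, φ y ∂(driftGauss v) = ∫ y, φ y * Real.tanh y ∂(driftGauss v) := by
  have h := integral_odd_mul_one_sub_tanh hv hφ
  have h3 : (fun y => φ y * (1 - Real.tanh y)) = fun y => φ y - φ y * Real.tanh y := by
    funext y; ring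
  rw [h3, integral_sub h1 h2] at h
  linarith

/-- The law of `driftGauss v` is invariant under the reflection with odds `exp (2 y)`. -/
lemma integral_symmetrize {v : ℝ} (hv : 0 ≤ v) {ψ : ℝ → ℝ} (hc : Continuous ψ) (C : ℝ)
    (hC : ∀ x, |ψ x| ≤ C) :
    ∫ y, ψ y ∂(driftGauss v) = ∫ y, ((1 + Real.tanh y) / 2 * ψ y +
      (1 - Real.tanh y) / 2 * ψ (-y)) ∂(driftGauss v) := by
  have hC0 : 0 ≤ C := (abs_nonneg _).trans (hC 0)
  have ht := continuous_tanh
  have h := integral_odd_mul_one_sub_tanh hv (φ := fun y => (ψ y - ψ (-y)) / 2)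
    (by intro x; simp; ring)
  have h3 : (fun y => (ψ y - ψ (-y)) / 2 * (1 - Real.tanh y)) = fun y => ψ y -
      ((1 + Real.tanh y) / 2 * ψ y + (1 - Real.tanh y) / 2 * ψ (-y)) := by
    funext y; ring
  rw [h3, integral_sub] at h
  · linarith
  · exact integrable_driftGauss hc C hC v
  · refine integrable_driftGauss (by fun_prop) (C + C) ?_ v
    intro x
    have h1 := abs_tanh_lt_one x
    have h4 := abs_lt.1 h1
    refine (abs_add_le _ _).trans (add_le_add ?_ ?_)
    · rw [abs_mul, abs_of_nonneg (by linarith : 0 ≤ (1 + Real.tanh x) / 2)]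
      nlinarith [hC x, abs_nonneg (ψ x)]
    · rw [abs_mul, abs_of_nonneg (by linarith : 0 ≤ (1 - Real.tanh x) / 2)]
      nlinarith [hC (-x), abs_nonneg (ψ (-x))]

lemma tanh_sq_le_mul_tanh (y : ℝ) : Real.tanh y ^ 2 ≤ y * Real.tanh y := by
  have key : ∀ z : ℝ, 0 ≤ z → Real.tanh z ≤ z := by
    intro z hz
    have h1 := one_add_tanh z
    have h4 := abs_lt.1 (abs_tanh_lt_one z)
    rw [Real.tanh_eq_sinh_div_cosh, div_le_iff₀ (Real.cosh_pos z)]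
    have hmono : MonotoneOn (fun w => w * Real.cosh w - Real.sinh w) (Set.Ici 0) := by
      apply monotoneOn_of_deriv_nonneg (convex_Ici 0)
      · fun_prop
      · fun_prop
      · intro w hw
        simp at hw
        have : deriv (fun w => w * Real.cosh w - Real.sinh w) w = w * Real.sinh w := by
          rw [(((hasDerivAt_id' w).fun_mul (Real.hasDerivAt_cosh w)).fun_sub
            (Real.hasDerivAt_sinh w)).deriv]
          ring
        rw [this]
        exact mul_nonneg hw.le (Real.sinh_nonneg_iff.2 hw.le)
    have := hmono (Set.self_mem_Ici) (Set.mem_Ici.2 hz) hz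
    simp at this
    linarith
  rcases le_total 0 y with hy | hy
  · have h0 : 0 ≤ Real.tanh y := by
      rw [Real.tanh_eq_sinh_div_cosh]
      exact div_nonneg (Real.sinh_nonneg_iff.2 hy) (Real.cosh_pos y).le
    nlinarith [key y hy]
  · have hk := key (-y) (by linarith)
    rw [Real.tanh_neg] at hk
    have h0 : Real.tanh y ≤ 0 := by
      rw [Real.tanh_eq_sinh_div_cosh]
      exact div_nonpos_of_nonpos_of_nonneg (Real.sinh_nonpos_iff.2 hy) (Real.cosh_pos y).le
    nlinarith

/-- E[tanh² Y] ≤ E[Y tanh Y] = E[Y] = v, the middle equality being the Nishimori identity for the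
identity function. -/
lemma integral_tanh_sq_le {v : ℝ} (hv : 0 ≤ v) :
    ∫ y, Real.tanh y ^ 2 ∂(driftGauss v) ≤ v := by
  have hid : Integrable (fun y : ℝ => y) (driftGauss v) :=
    (memLp_id_gaussianReal 1).integrable (by norm_num)
  have hid2 : Integrable (fun y : ℝ => y * Real.tanh y) (driftGauss v) := by
    refine Integrable.mono hid (by have := continuous_tanh; fun_prop) (ae_of_all _ fun y => ?_)
    simp only [Real.norm_eq_abs, abs_mul]
    nlinarith [abs_tanh_lt_one y, abs_nonneg y]
  have h1 : ∫ y, y ∂(driftGauss v) = v := integral_id_gaussianReal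
  calc ∫ y, Real.tanh y ^ 2 ∂(driftGauss v) ≤ ∫ y, y * Real.tanh y ∂(driftGauss v) := by
        refine integral_mono (integrable_driftGauss (by have := continuous_tanh; fun_prop) 1 ?_ v)
          hid2 fun y => tanh_sq_le_mul_tanh y
        intro x
        have := abs_tanh_lt_one x
        rw [abs_pow]; nlinarith [abs_nonneg (Real.tanh x)]
    _ = v := by rw [← integral_odd_eq hv (φ := fun y => y) (fun x => rfl) hid hid2, h1]

/-- The mean of `φ (Y + X)` where `Y` has law `driftGauss v` and `X = ± x` with probabilities
`(1 ± tanh x) / 2`. -/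
noncomputable def mix (φ : ℝ → ℝ) (x v : ℝ) : ℝ :=
  (1 + Real.tanh x) / 2 * ∫ y, φ (y + x) ∂(driftGauss v) +
    (1 - Real.tanh x) / 2 * ∫ y, φ (y - x) ∂(driftGauss v)

lemma mix_eq_integral {φ : ℝ → ℝ} (hc : Continuous φ) (C : ℝ) (hC : ∀ x, |φ x| ≤ C) (x v : ℝ) :
    mix φ x v = ∫ y, ((1 + Real.tanh x) / 2 * φ (y + x) + (1 - Real.tanh x) / 2 * φ (y - x))
      ∂(driftGauss v) := by
  rw [integral_add, integral_const_mul, integral_const_mul, mix]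
  · exact (integrable_driftGauss (by fun_prop) C (fun _ => hC _) v).const_mul _
  · exact (integrable_driftGauss (by fun_prop) C (fun _ => hC _) v).const_mul _

lemma mix_mono {φ ψ : ℝ → ℝ} (hc : Continuous φ) (C : ℝ) (hC : ∀ x, |φ x| ≤ C)
    (hc' : Continuous ψ) (C' : ℝ) (hC' : ∀ x, |ψ x| ≤ C') (h : ∀ x, φ x ≤ ψ x) (x v : ℝ) :
    mix φ x v ≤ mix ψ x v := by
  have h4 := abs_lt.1 (abs_tanh_lt_one x)
  have i1 : ∀ s, Integrable (fun y => φ (y + s)) (driftGauss v) := fun s =>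
    integrable_driftGauss (by fun_prop) C (fun _ => hC _) v
  have i2 : ∀ s, Integrable (fun y => ψ (y + s)) (driftGauss v) := fun s =>
    integrable_driftGauss (by fun_prop) C' (fun _ => hC' _) v
  refine add_le_add (mul_le_mul_of_nonneg_left ?_ (by linarith))
    (mul_le_mul_of_nonneg_left ?_ (by linarith))
  · exact integral_mono (i1 x) (i2 x) fun y => h _
  · simp_rw [sub_eq_add_neg]
    exact integral_mono (i1 (-x)) (i2 (-x)) fun y => h _

lemma mix_sub {φ ψ : ℝ → ℝ} (hc : Continuous φ) (C : ℝ) (hC : ∀ x, |φ x| ≤ C)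
    (hc' : Continuous ψ) (C' : ℝ) (hC' : ∀ x, |ψ x| ≤ C') (x v : ℝ) :
    mix (fun y => φ y - ψ y) x v = mix φ x v - mix ψ x v := by
  have i1 : ∀ s, Integrable (fun y => φ (y + s)) (driftGauss v) := fun s =>
    integrable_driftGauss (by fun_prop) C (fun _ => hC _) v
  have i2 : ∀ s, Integrable (fun y => ψ (y + s)) (driftGauss v) := fun s =>
    integrable_driftGauss (by fun_prop) C' (fun _ => hC' _) v
  simp only [mix, sub_eq_add_neg (_ : ℝ) x]
  rw [integral_sub (i1 _) (i2 _), integral_sub (i1 _) (i2 _)]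
  ring

lemma mix_const (c x v : ℝ) : mix (fun _ => c) x v = c := by
  simp [mix]; ring

lemma mix_const_mul (φ : ℝ → ℝ) (c x v : ℝ) : mix (fun y => c * φ y) x v = c * mix φ x v := by
  simp only [mix, integral_const_mul]; ring

/-- Nishimori identity for the mixture. -/
lemma mix_odd {φ : ℝ → ℝ} (hc : Continuous φ) (C : ℝ) (hC : ∀ x, |φ x| ≤ C)
    (hφ : ∀ x, φ (-x) = -φ x) (x : ℝ) {v : ℝ} (hv : 0 ≤ v) :
    mix φ x v = mix (fun y => φ y * Real.tanh y) x v := by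
  have ht := continuous_tanh
  have hC0 : 0 ≤ C := (abs_nonneg _).trans (hC 0)
  have hC' : ∀ x, |φ x * Real.tanh x| ≤ C := by
    intro x
    rw [abs_mul]
    nlinarith [hC x, abs_tanh_lt_one x, abs_nonneg (φ x), abs_nonneg (Real.tanh x)]
  have hb : ∀ (χ : ℝ → ℝ), (∀ x, |χ x| ≤ C) → ∀ y, |(1 + Real.tanh x) / 2 * χ (y + x) +
      (1 - Real.tanh x) / 2 * χ (y - x)| ≤ C := by
    intro χ h y
    have h4 := abs_lt.1 (abs_tanh_lt_one x)
    have e1 := abs_le.1 (h (y + x))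
    have e2 := abs_le.1 (h (y - x))
    rw [abs_le]
    constructor <;> nlinarith
  rw [mix_eq_integral hc C hC, mix_eq_integral (by fun_prop) C hC',
    integral_symmetrize hv (by fun_prop) C (hb φ hC),
    integral_symmetrize hv (by fun_prop) C (hb _ hC')]
  congr 1
  funext y
  have e1 : φ (-y + x) = - φ (y - x) := by rw [← hφ]; ring_nf
  have e2 : φ (-y - x) = - φ (y + x) := by rw [← hφ]; ring_nf
  have e3 : Real.tanh (-y + x) = - Real.tanh (y - x) := by rw [← Real.tanh_neg]; ring_nf
  have e4 : Real.tanh (-y - x) = - Real.tanh (y + x) := by rw [← Real.tanh_neg]; ring_nf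
  have e5 : Real.tanh (y - x) = (Real.tanh y - Real.tanh x) / (1 - Real.tanh y * Real.tanh x) := by
    rw [sub_eq_add_neg, tanh_add, Real.tanh_neg]; ring_nf
  rw [e1, e2, e3, e4, e5, tanh_add]
  have p1 := one_add_tanh_mul_pos y x
  have p2 := one_add_tanh_mul_pos y (-x)
  rw [Real.tanh_neg] at p2
  have p3 : 1 - Real.tanh y * Real.tanh x ≠ 0 := by
    have : 0 < 1 - Real.tanh y * Real.tanh x := by linarith
    exact this.ne'
  have p4 := p1.ne'
  field_simp
  ring

/-- This is why one number describes both the correlation of a message with the label and its second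
moment. -/
lemma mix_tanh_eq_sq (x : ℝ) {v : ℝ} (hv : 0 ≤ v) :
    mix Real.tanh x v = mix (fun y => Real.tanh y ^ 2) x v := by
  rw [mix_odd continuous_tanh 1 (fun x => (abs_tanh_lt_one x).le) Real.tanh_neg x hv]
  simp_rw [sq]

lemma mix_tanh_zero (x : ℝ) : mix Real.tanh x 0 = Real.tanh x ^ 2 := by
  simp [mix, driftGauss, gaussianReal_zero_var, Real.tanh_neg]; ring

/-- Symmetrizing in y leaves g² plus a term between 0 and (1 - g²) tanh² y, where g = tanh x, and
E[tanh² Y] ≤ v. By `mix_tanh_zero` this bounds the increment of the mixture from v = 0. -/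
lemma tanh_sq_le_mix_tanh (x : ℝ) {v : ℝ} (hv : 0 ≤ v) :
    Real.tanh x ^ 2 ≤ mix Real.tanh x v ∧
      mix Real.tanh x v ≤ Real.tanh x ^ 2 + (1 - Real.tanh x ^ 2) * v := by
  have ht := continuous_tanh
  have h1 : ∀ z, |Real.tanh z| ≤ 1 := fun z => (abs_tanh_lt_one z).le
  rw [mix_eq_integral ht 1 h1, integral_symmetrize hv (by fun_prop) 1]
  swap
  · intro y
    have h4 := abs_lt.1 (abs_tanh_lt_one x)
    have e1 := abs_le.1 (h1 (y + x))
    have e2 := abs_le.1 (h1 (y - x))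
    rw [abs_le]
    constructor <;> nlinarith
  set g := Real.tanh x with hg
  have hg1 : g ^ 2 < 1 := by
    have := abs_tanh_lt_one x
    rw [← sq_abs]; nlinarith [abs_nonneg (Real.tanh x)]
  have hpt : ∀ y, (1 + Real.tanh y) / 2 * ((1 + g) / 2 * Real.tanh (y + x) +
      (1 - g) / 2 * Real.tanh (y - x)) + (1 - Real.tanh y) / 2 *
      ((1 + g) / 2 * Real.tanh (-y + x) + (1 - g) / 2 * Real.tanh (-y - x)) =
      g ^ 2 + Real.tanh y ^ 2 * (1 - g ^ 2) ^ 2 / (1 - g ^ 2 * Real.tanh y ^ 2) := by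
    intro y
    have e3 : Real.tanh (-y + x) = - Real.tanh (y - x) := by rw [← Real.tanh_neg]; ring_nf
    have e4 : Real.tanh (-y - x) = - Real.tanh (y + x) := by rw [← Real.tanh_neg]; ring_nf
    have e5 : Real.tanh (y - x) = (Real.tanh y - g) / (1 - Real.tanh y * g) := by
      rw [sub_eq_add_neg, tanh_add, Real.tanh_neg, ← hg]; ring_nf
    have p1 := one_add_tanh_mul_pos y x
    have p2 := one_add_tanh_mul_pos y (-x)
    rw [Real.tanh_neg] at p2
    rw [← hg] at p1 p2
    have p3 : 0 < 1 - Real.tanh y * g := by linarith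
    rw [e3, e4, e5, tanh_add, ← hg]
    exact symmetrized_rational_identity _ _ p1.ne' p3.ne'
  simp_rw [hpt]
  have hu : ∀ y, Real.tanh y ^ 2 < 1 := by
    intro y
    have := abs_tanh_lt_one y
    rw [← sq_abs]; nlinarith [abs_nonneg (Real.tanh y)]
  have hden : ∀ y, 1 - g ^ 2 ≤ 1 - g ^ 2 * Real.tanh y ^ 2 := by
    intro y; nlinarith [hu y, sq_nonneg g]
  have hlow : ∀ y, 0 ≤ Real.tanh y ^ 2 * (1 - g ^ 2) ^ 2 / (1 - g ^ 2 * Real.tanh y ^ 2) := by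
    intro y
    have := hden y
    exact div_nonneg (by positivity) (by linarith)
  have hup : ∀ y, Real.tanh y ^ 2 * (1 - g ^ 2) ^ 2 / (1 - g ^ 2 * Real.tanh y ^ 2) ≤
      (1 - g ^ 2) * Real.tanh y ^ 2 := by
    intro y
    have := hden y
    rw [div_le_iff₀ (by linarith)]
    have : 0 ≤ Real.tanh y ^ 2 * (1 - g ^ 2) := mul_nonneg (sq_nonneg _) (by linarith)
    nlinarith
  have hden0 : ∀ y, 1 - g ^ 2 * Real.tanh y ^ 2 ≠ 0 := by
    intro y; have := hden y
    have h : 0 < 1 - g ^ 2 * Real.tanh y ^ 2 := by linarith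
    exact h.ne'
  have hcont : Continuous fun y => Real.tanh y ^ 2 * (1 - g ^ 2) ^ 2 /
      (1 - g ^ 2 * Real.tanh y ^ 2) := by
    refine Continuous.div ?_ ?_ hden0 <;> fun_prop
  have hi1 : Integrable (fun y => Real.tanh y ^ 2 * (1 - g ^ 2) ^ 2 /
      (1 - g ^ 2 * Real.tanh y ^ 2)) (driftGauss v) := by
    refine integrable_driftGauss hcont 1 (fun y => ?_) v
    rw [abs_of_nonneg (hlow y)]
    refine (hup y).trans ?_
    nlinarith [hu y, sq_nonneg (Real.tanh y), sq_nonneg g]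
  have hi2 : Integrable (fun y => Real.tanh y ^ 2) (driftGauss v) :=
    integrable_driftGauss (by fun_prop) 1 (fun y => by
      rw [abs_of_nonneg (sq_nonneg _)]; exact (hu y).le) v
  rw [integral_add (integrable_const _) hi1]
  simp only [integral_const, probReal_univ, one_smul]
  have hge : 0 ≤ ∫ y, Real.tanh y ^ 2 * (1 - g ^ 2) ^ 2 / (1 - g ^ 2 * Real.tanh y ^ 2)
      ∂(driftGauss v) := integral_nonneg hlow
  have hle : ∫ y, Real.tanh y ^ 2 * (1 - g ^ 2) ^ 2 / (1 - g ^ 2 * Real.tanh y ^ 2)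
      ∂(driftGauss v) ≤ (1 - g ^ 2) * v := by
    refine (integral_mono hi1 (hi2.const_mul _) hup).trans ?_
    rw [integral_const_mul]
    exact mul_le_mul_of_nonneg_left (integral_tanh_sq_le hv) (by linarith)
  constructor <;> linarith

lemma driftGauss_conv {v w : ℝ} (hv : 0 ≤ v) (hw : 0 ≤ w) :
    driftGauss v ∗ driftGauss w = driftGauss (v + w) := by
  simp only [driftGauss]
  rw [gaussianReal_conv_gaussianReal, Real.toNNReal_add hv hw]

lemma continuous_integral_shift {φ : ℝ → ℝ} (hc : Continuous φ) (C : ℝ) (hC : ∀ x, |φ x| ≤ C)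
    (w : ℝ) : Continuous fun x => ∫ y, φ (y + x) ∂(driftGauss w) := by
  refine continuous_of_dominated (bound := fun _ => C) ?_ ?_ ?_ ?_
  · intro x; exact (by fun_prop : Continuous fun y => φ (y + x)).aestronglyMeasurable
  · intro x; exact ae_of_all _ fun y => hC _
  · exact integrable_const _
  · exact ae_of_all _ fun y => by fun_prop

lemma abs_integral_shift_le {φ : ℝ → ℝ} (C : ℝ) (hC : ∀ x, |φ x| ≤ C)
    (w x : ℝ) : |∫ y, φ (y + x) ∂(driftGauss w)| ≤ C := by
  have := norm_integral_le_of_norm_le_const (μ := driftGauss w) (f := fun y => φ (y + x))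
    (C := C) (ae_of_all _ fun y => hC _)
  simpa using this

/-- Semigroup property: N(v, v) * N(w, w) = N(v + w, v + w), and the position reached after v can
serve as a new starting point whose sign is again randomized with the posterior odds. -/
lemma mix_tanh_add (x : ℝ) {v w : ℝ} (hv : 0 ≤ v) (hw : 0 ≤ w) :
    mix Real.tanh x (v + w) = mix (fun y => mix Real.tanh y w) x v := by
  have ht := continuous_tanh
  have h1 : ∀ z, |Real.tanh z| ≤ 1 := fun z => (abs_tanh_lt_one z).le
  set ψ : ℝ → ℝ := fun y => ∫ z, Real.tanh (z + y) ∂(driftGauss w) with hψ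
  have hψc : Continuous ψ := continuous_integral_shift ht 1 h1 w
  have hψ1 : ∀ y, |ψ y| ≤ 1 := fun y => abs_integral_shift_le 1 h1 w y
  have hconv : ∀ s, ∫ y, Real.tanh (y + s) ∂(driftGauss (v + w)) =
      ∫ y, ψ (y + s) ∂(driftGauss v) := by
    intro s
    rw [← driftGauss_conv hv hw, integral_conv]
    · simp only [hψ]
      congr 1; funext y; congr 1; funext z; ring_nf
    · rw [driftGauss_conv hv hw]
      exact integrable_driftGauss (by fun_prop) 1 (fun _ => h1 _) _
  have hL : mix Real.tanh x (v + w) = mix ψ x v := by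
    simp only [mix, sub_eq_add_neg (_ : ℝ) x]
    rw [hconv, hconv]
  -- Randomizing the sign of y changes ψ by its odd part times 1 - tanh y, a function whose mixture
  -- vanishes by `mix_odd`.
  have hR : (fun y => mix Real.tanh y w) = fun y => ψ y -
      ((ψ y - ψ (-y)) / 2 - (ψ y - ψ (-y)) / 2 * Real.tanh y) := by
    funext y
    simp only [mix, sub_eq_add_neg (_ : ℝ) y]
    rw [show ∫ z, Real.tanh (z + y) ∂(driftGauss w) = ψ y from rfl,
      show ∫ z, Real.tanh (z + -y) ∂(driftGauss w) = ψ (-y) from rfl]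
    ring
  have hoc : Continuous fun y => (ψ y - ψ (-y)) / 2 := by fun_prop
  have hob : ∀ y, |(ψ y - ψ (-y)) / 2| ≤ 1 := by
    intro y
    have e1 := abs_le.1 (hψ1 y)
    have e2 := abs_le.1 (hψ1 (-y))
    rw [abs_le]; constructor <;> linarith
  have hob2 : ∀ y, |(ψ y - ψ (-y)) / 2 * Real.tanh y| ≤ 1 := by
    intro y
    rw [abs_mul]
    nlinarith [hob y, h1 y, abs_nonneg ((ψ y - ψ (-y)) / 2), abs_nonneg (Real.tanh y)]
  rw [hL, hR, mix_sub hψc 1 hψ1 (by fun_prop) 2, mix_sub hoc 1 hob (by fun_prop) 1 hob2,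
    ← mix_odd hoc 1 hob (by intro y; simp; ring) x hv]
  · ring
  · intro y
    have e1 := abs_le.1 (hob y)
    have e2 := abs_le.1 (hob2 y)
    rw [abs_le]; constructor <;> linarith

lemma abs_mix_le {φ : ℝ → ℝ} (C : ℝ) (hC : ∀ x, |φ x| ≤ C) (x v : ℝ) : |mix φ x v| ≤ C := by
  have h4 := abs_lt.1 (abs_tanh_lt_one x)
  have e1 := abs_le.1 (abs_integral_shift_le C hC v x)
  have e2 := abs_le.1 (abs_integral_shift_le C hC v (-x))
  simp only [mix, sub_eq_add_neg (_ : ℝ) x]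
  rw [abs_le]; constructor <;> nlinarith

lemma continuous_mix {φ : ℝ → ℝ} (hc : Continuous φ) (C : ℝ) (hC : ∀ x, |φ x| ≤ C) (v : ℝ) :
    Continuous fun x => mix φ x v := by
  have ht := continuous_tanh
  have h1 := continuous_integral_shift hc C hC v
  have h2 : Continuous fun x => ∫ y, φ (y - x) ∂(driftGauss v) := h1.comp continuous_neg
  unfold mix
  fun_prop

/-- By the semigroup property the value at v + w is an average over y of values at w, each between
tanh² y and tanh² y + (1 - tanh² y) w. The average of tanh² y is the value at v by the Nishimori
identity. -/
lemma mix_tanh_increment (x : ℝ) {v w : ℝ} (hv : 0 ≤ v) (hw : 0 ≤ w) :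
    mix Real.tanh x v ≤ mix Real.tanh x (v + w) ∧
      mix Real.tanh x (v + w) - mix Real.tanh x v ≤ (1 - mix Real.tanh x v) * w := by
  have ht := continuous_tanh
  have h1 : ∀ z, |Real.tanh z| ≤ 1 := fun z => (abs_tanh_lt_one z).le
  have h2 : ∀ z, |Real.tanh z ^ 2| ≤ 1 := fun z => by
    rw [abs_pow]; nlinarith [h1 z, abs_nonneg (Real.tanh z)]
  have hm1 : ∀ z, |mix Real.tanh z w| ≤ 1 := fun z => abs_mix_le 1 h1 z w
  have hmc := continuous_mix ht 1 h1 w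
  rw [mix_tanh_add x hv hw]
  constructor
  · rw [mix_tanh_eq_sq x hv]
    exact mix_mono (by fun_prop) 1 h2 hmc 1 hm1 (fun y => (tanh_sq_le_mix_tanh y hw).1) x v
  · have h3 : mix (fun y => mix Real.tanh y w) x v - mix (fun y => Real.tanh y ^ 2) x v ≤
        w * (1 - mix (fun y => Real.tanh y ^ 2) x v) := by
      rw [← mix_sub hmc 1 hm1 (by fun_prop) 1 h2]
      have : w * (1 - mix (fun y => Real.tanh y ^ 2) x v) =
          mix (fun y => w * (1 - Real.tanh y ^ 2)) x v := by
        rw [mix_const_mul, mix_sub continuous_const 1 (by simp) (by fun_prop) 1 h2, mix_const]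
      rw [this]
      refine mix_mono (by fun_prop) 2 ?_ (by fun_prop) (w * 2) ?_ ?_ x v
      · intro z
        have e1 := abs_le.1 (hm1 z)
        have e2 := abs_le.1 (h2 z)
        rw [abs_le]; constructor <;> linarith
      · intro z
        have e2 := abs_le.1 (h2 z)
        rw [abs_mul, abs_of_nonneg hw]
        refine mul_le_mul_of_nonneg_left ?_ hw
        rw [abs_le]; constructor <;> linarith
      · intro y
        have := (tanh_sq_le_mix_tanh y hw).2
        linarith
    rw [mix_tanh_eq_sq x hv]
    linarith

lemma mix_tanh_nonneg (x : ℝ) {v : ℝ} (hv : 0 ≤ v) : 0 ≤ mix Real.tanh x v :=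
  (sq_nonneg _).trans (tanh_sq_le_mix_tanh x hv).1

lemma mix_tanh_le_one (x v : ℝ) : mix Real.tanh x v ≤ 1 :=
  (abs_le.1 (abs_mix_le 1 (fun z => (abs_tanh_lt_one z).le) x v)).2

/-- The side information x only helps (`mixture_rational_identity`), so it suffices to bound E[1 -
tanh Y], and 1 - tanh y ≤ exp(-y) with E[exp(-Y)] = exp(-v/2). -/
lemma one_sub_mix_tanh_le (x : ℝ) {v : ℝ} (hv : 0 ≤ v) :
    1 - mix Real.tanh x v ≤ Real.exp (-(v / 2)) := by
  have ht := continuous_tanh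
  have h1 : ∀ z, |Real.tanh z| ≤ 1 := fun z => (abs_tanh_lt_one z).le
  have hexp : ∫ y, Real.exp (-y) ∂(driftGauss v) = Real.exp (-(v / 2)) := by
    have := mgf_fun_id_gaussianReal (μ := v) (v := v.toNNReal)
    have h2 := congrFun this (-1)
    simp only [mgf, Real.coe_toNNReal _ hv] at h2
    rw [driftGauss]
    simp only [neg_mul, one_mul] at h2
    rw [h2]; congr 1; ring
  have hiexp : Integrable (fun y => Real.exp (-y)) (driftGauss v) := by
    have := integrable_exp_mul_gaussianReal (μ := v) (v := v.toNNReal) (-1)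
    simpa [driftGauss] using this
  rw [mix_eq_integral ht 1 h1, ← hexp]
  have hi : Integrable (fun y => (1 + Real.tanh x) / 2 * Real.tanh (y + x) +
      (1 - Real.tanh x) / 2 * Real.tanh (y - x)) (driftGauss v) := by
    refine integrable_driftGauss (by fun_prop) 1 (fun y => ?_) v
    have h4 := abs_lt.1 (abs_tanh_lt_one x)
    have e1 := abs_le.1 (h1 (y + x))
    have e2 := abs_le.1 (h1 (y - x))
    rw [abs_le]
    constructor <;> nlinarith
  have h0 : (1 : ℝ) = ∫ y, (1 : ℝ) ∂(driftGauss v) := by simp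
  rw [sub_le_iff_le_add, ← integral_add hiexp hi]
  conv_lhs => rw [h0]
  refine integral_mono (integrable_const _) (hiexp.add hi) fun y => ?_
  have e5 : Real.tanh (y - x) = (Real.tanh y - Real.tanh x) / (1 - Real.tanh y * Real.tanh x) := by
    rw [sub_eq_add_neg, tanh_add, Real.tanh_neg]; ring_nf
  have p1 := one_add_tanh_mul_pos y x
  have p2 := one_add_tanh_mul_pos y (-x)
  rw [Real.tanh_neg] at p2
  have p2' : 0 < 1 - Real.tanh y * Real.tanh x := by linarith
  have hle := one_sub_tanh_le y
  have hu := abs_lt.1 (abs_tanh_lt_one y)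
  have hg := abs_lt.1 (abs_tanh_lt_one x)
  suffices (1 + Real.tanh x) / 2 * Real.tanh (y + x) +
      (1 - Real.tanh x) / 2 * Real.tanh (y - x) ≥ Real.tanh y by
    show (1 : ℝ) ≤ Real.exp (-y) + _
    linarith
  rw [e5, tanh_add]
  have hid : (1 + Real.tanh x) / 2 * ((Real.tanh y + Real.tanh x) / (1 + Real.tanh y * Real.tanh x))
      + (1 - Real.tanh x) / 2 * ((Real.tanh y - Real.tanh x) / (1 - Real.tanh y * Real.tanh x)) -
      Real.tanh y = (1 - Real.tanh y) * Real.tanh x ^ 2 * (1 - Real.tanh y ^ 2) /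
      ((1 + Real.tanh y * Real.tanh x) * (1 - Real.tanh y * Real.tanh x)) :=
    mixture_rational_identity _ _ p1.ne' p2'.ne'
  have hpos : 0 ≤ (1 - Real.tanh y) * Real.tanh x ^ 2 * (1 - Real.tanh y ^ 2) /
      ((1 + Real.tanh y * Real.tanh x) * (1 - Real.tanh y * Real.tanh x)) := by
    refine div_nonneg (mul_nonneg (mul_nonneg (by linarith) (sq_nonneg _)) ?_) (by positivity)
    nlinarith
  linarith

end Gaussian

/-! ### The function h, its fixed points, and their uniqueness. -/

section FixedPoints

/-- The real value of `gam α` for `α ≠ 0`. -/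
noncomputable def rgam (α : ℝ) : ℝ := 1 / 2 * Real.log ((1 - α) / α)

lemma gam_eq {α : ℝ} (hα : 0 < α) : gam α = (rgam α : EReal) := by
  simp [gam, rgam, hα.ne']

lemma exp_two_rgam {α : ℝ} (hα : 0 < α) (hα2 : α < 1 / 2) :
    Real.exp (2 * rgam α) = (1 - α) / α := by
  rw [rgam, ← mul_assoc]
  norm_num
  rw [Real.exp_log (div_pos (by linarith) hα)]

lemma tanh_rgam {α : ℝ} (hα : 0 < α) (hα2 : α < 1 / 2) : Real.tanh (rgam α) = 1 - 2 * α := by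
  have h := one_add_tanh (rgam α)
  rw [exp_two_rgam hα hα2] at h
  have hα' := hα.ne'
  field_simp at h
  linarith

lemma rgam_pos {α : ℝ} (hα : 0 < α) (hα2 : α < 1 / 2) : 0 < rgam α := by
  have h1 : 1 < (1 - α) / α := by rw [lt_div_iff₀ hα]; linarith
  have := Real.log_pos h1
  unfold rgam; linarith

lemma etanh_coe (x : ℝ) : etanh (x : EReal) = Real.tanh x := by
  simp [etanh]

lemma expU_eq {α : ℝ} (hα : 0 < α) (f : EReal → ℝ) :
    expU α f = (1 - α) * f (rgam α : EReal) + α * f ((-rgam α : ℝ) : EReal) := by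
  rw [expU, gam_eq hα]
  norm_cast

/-- Since tanh γ = 1 - 2α, the weights (1 ± tanh γ)/2 of the mixture are the probabilities 1 - α and
α of U. -/
lemma h_eq_mix {α : ℝ} (hα : 0 < α) (hα2 : α < 1 / 2) {v : ℝ} (hv : 0 ≤ v) :
    h α v = mix Real.tanh (rgam α) v := by
  have ht := continuous_tanh
  rw [h, expU_eq hα, mix, tanh_rgam hα hα2]
  have e1 : ∀ s : ℝ, ∫ z, etanh (((v + √v * z : ℝ) : EReal) + (s : EReal)) ∂(gaussianReal 0 1) =
      ∫ y, Real.tanh (y + s) ∂(driftGauss v) := by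
    intro s
    rw [← integral_standard_eq_driftGauss hv (f := fun y => Real.tanh (y + s))
      (by fun_prop : Continuous fun y => Real.tanh (y + s)).measurable]
    congr 1
  rw [e1, e1]
  simp_rw [sub_eq_add_neg (_ : ℝ) (rgam α)]
  ring

lemma h_zero_left (v : ℝ) : h 0 v = 1 := by
  have : ∀ z : ℝ, etanh (((v + √v * z : ℝ) : EReal) + ⊤) = 1 := by
    intro z
    rw [EReal.coe_add_top]; simp [etanh]
  simp only [h, expU, gam, if_true, this]
  simp

lemma h_nonneg {α : ℝ} (hα : 0 ≤ α) (hα2 : α < 1 / 2) {v : ℝ} (hv : 0 ≤ v) : 0 ≤ h α v := by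
  rcases hα.eq_or_lt with rfl | hα
  · simp [h_zero_left]
  · rw [h_eq_mix hα hα2 hv]; exact mix_tanh_nonneg _ hv

lemma h_le_one {α : ℝ} (hα : 0 ≤ α) (hα2 : α < 1 / 2) {v : ℝ} (hv : 0 ≤ v) : h α v ≤ 1 := by
  rcases hα.eq_or_lt with rfl | hα
  · simp [h_zero_left]
  · rw [h_eq_mix hα hα2 hv]; exact mix_tanh_le_one _ _

lemma h_zero_right {α : ℝ} (hα : 0 ≤ α) (hα2 : α < 1 / 2) : h α 0 = (1 - 2 * α) ^ 2 := by
  rcases hα.eq_or_lt with rfl | hα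
  · simp [h_zero_left]
  · rw [h_eq_mix hα hα2 le_rfl, mix_tanh_zero, tanh_rgam hα hα2]

lemma h_mono {α : ℝ} (hα : 0 ≤ α) (hα2 : α < 1 / 2) {v w : ℝ} (hv : 0 ≤ v) (hw : v ≤ w) :
    h α v ≤ h α w := by
  rcases hα.eq_or_lt with rfl | hα
  · simp [h_zero_left]
  · have := (mix_tanh_increment (rgam α) hv (sub_nonneg.2 hw)).1
    rw [add_sub_cancel] at this
    rwa [h_eq_mix hα hα2 hv, h_eq_mix hα hα2 (hv.trans hw)]

lemma h_increment {α : ℝ} (hα : 0 ≤ α) (hα2 : α < 1 / 2) {v w : ℝ} (hv : 0 ≤ v) (hw : v ≤ w) :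
    h α w - h α v ≤ (1 - h α v) * (w - v) := by
  rcases hα.eq_or_lt with rfl | hα
  · simp [h_zero_left]
  · have := (mix_tanh_increment (rgam α) hv (sub_nonneg.2 hw)).2
    rw [add_sub_cancel] at this
    rwa [h_eq_mix hα hα2 hv, h_eq_mix hα hα2 (hv.trans hw)]

lemma one_sub_h_le {α : ℝ} (hα : 0 ≤ α) (hα2 : α < 1 / 2) {v : ℝ} (hv : 0 ≤ v) :
    1 - h α v ≤ Real.exp (-(v / 2)) := by
  rcases hα.eq_or_lt with rfl | hα
  · simp [h_zero_left, Real.exp_nonneg]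
  · rw [h_eq_mix hα hα2 hv]; exact one_sub_mix_tanh_le _ hv

lemma continuousOn_h {α : ℝ} (hα : 0 ≤ α) (hα2 : α < 1 / 2) : ContinuousOn (h α) (Set.Ici 0) := by
  have : LipschitzOnWith 1 (h α) (Set.Ici 0) := by
    refine LipschitzOnWith.of_dist_le_mul ?_
    have key : ∀ v w : ℝ, 0 ≤ v → v ≤ w → |h α w - h α v| ≤ w - v := by
      intro v w hv hw
      rw [abs_of_nonneg (sub_nonneg.2 (h_mono hα hα2 hv hw))]
      refine (h_increment hα hα2 hv hw).trans ?_
      have := h_nonneg hα hα2 hv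
      nlinarith
    intro v hv w hw
    simp only [Set.mem_Ici] at hv hw
    rw [Real.dist_eq, Real.dist_eq]
    simp only [NNReal.coe_one, one_mul]
    rcases le_total v w with hvw | hvw
    · rw [abs_sub_comm, abs_sub_comm v w, abs_of_nonneg (sub_nonneg.2 hvw)]
      exact key v w hv hvw
    · rw [abs_of_nonneg (sub_nonneg.2 hvw)]
      exact key w v hw hvw
  exact this.continuousOn

/-- The state evolution `v ↦ (μ² / 4) h(v)`, iterated from `v`. -/
noncomputable def evolve (α μ v : ℝ) : ℕ → ℝ
  | 0 => v
  | t + 1 => μ ^ 2 / 4 * h α (evolve α μ v t)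

lemma evolve_nonneg {α : ℝ} (hα : 0 ≤ α) (hα2 : α < 1 / 2) (μ : ℝ) {v : ℝ} (hv : 0 ≤ v) (t : ℕ) :
    0 ≤ evolve α μ v t := by
  induction t with
  | zero => exact hv
  | succ t ih => exact mul_nonneg (by positivity) (h_nonneg hα hα2 ih)

lemma evolve_succ' (α μ v : ℝ) (t : ℕ) :
    evolve α μ v (t + 1) = evolve α μ (μ ^ 2 / 4 * h α v) t := by
  induction t with
  | zero => rfl
  | succ t ih => rw [evolve, ih]; rfl

lemma evolve_le_of_fixed {α : ℝ} (hα : 0 ≤ α) (hα2 : α < 1 / 2) {μ v w : ℝ} (hv : 0 ≤ v)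
    (hw : w ∈ fixedPoints α μ) (hvw : v ≤ w) (t : ℕ) : evolve α μ v t ≤ w := by
  induction t with
  | zero => exact hvw
  | succ t ih =>
    rw [hw.2]
    exact mul_le_mul_of_nonneg_left (h_mono hα hα2 (evolve_nonneg hα hα2 μ hv t) ih) (by positivity)

lemma le_evolve_of_fixed {α : ℝ} (hα : 0 ≤ α) (hα2 : α < 1 / 2) {μ v w : ℝ}
    (hw : w ∈ fixedPoints α μ) (hvw : w ≤ v) (t : ℕ) : w ≤ evolve α μ v t := by
  induction t with
  | zero => exact hvw
  | succ t ih =>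
    rw [hw.2]
    exact mul_le_mul_of_nonneg_left (h_mono hα hα2 hw.1 ih) (by positivity)

lemma fixed_of_tendsto {α : ℝ} (hα : 0 ≤ α) (hα2 : α < 1 / 2) {μ v w : ℝ} (hv : 0 ≤ v)
    (hw : Tendsto (evolve α μ v) atTop (𝓝 w)) : w ∈ fixedPoints α μ := by
  have hw0 : 0 ≤ w := ge_of_tendsto' hw fun t => evolve_nonneg hα hα2 μ hv t
  refine ⟨hw0, ?_⟩
  have h1 : Tendsto (fun t => evolve α μ v (t + 1)) atTop (𝓝 w) := (tendsto_add_atTop_iff_nat 1).2 hw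
  have h2 : Tendsto (fun t => evolve α μ v (t + 1)) atTop (𝓝 (μ ^ 2 / 4 * h α w)) := by
    refine Tendsto.const_mul _ ?_
    refine ((continuousOn_h hα hα2) w hw0).tendsto.comp ?_
    exact tendsto_nhdsWithin_iff.2 ⟨hw, Eventually.of_forall fun t => evolve_nonneg hα hα2 μ hv t⟩
  exact tendsto_nhds_unique h1 h2

/-- The orbit of 0 increases, is bounded by μ²/4, and stays below every fixed point, because h is
monotone; its limit is a fixed point by continuity. -/
lemma exists_isLeast_fixedPoints {α : ℝ} (hα : 0 ≤ α) (hα2 : α < 1 / 2) (μ : ℝ) :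
    ∃ v, IsLeast (fixedPoints α μ) v ∧ Tendsto (evolve α μ 0) atTop (𝓝 v) := by
  have hmono : Monotone (evolve α μ 0) := by
    refine monotone_nat_of_le_succ fun t => ?_
    induction t with
    | zero => exact evolve_nonneg hα hα2 μ le_rfl 1
    | succ t ih =>
      exact mul_le_mul_of_nonneg_left (h_mono hα hα2 (evolve_nonneg hα hα2 μ le_rfl t) ih)
        (by positivity)
  have hbdd : BddAbove (Set.range (evolve α μ 0)) := by
    refine ⟨μ ^ 2 / 4, ?_⟩
    rintro _ ⟨t, rfl⟩
    cases t with
    | zero => simp [evolve]; positivity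
    | succ t =>
      exact mul_le_of_le_one_right (by positivity)
        (h_le_one hα hα2 (evolve_nonneg hα hα2 μ le_rfl t))
  have hlim := tendsto_atTop_ciSup hmono hbdd
  refine ⟨_, ⟨fixed_of_tendsto hα hα2 le_rfl hlim, fun w hw => ?_⟩, hlim⟩
  exact le_of_tendsto' hlim fun t => evolve_le_of_fixed hα hα2 le_rfl hw hw.1 t

/-- Since h ≤ 1, the point μ²/4 lies above its image and above every fixed point, so its orbit
decreases to the greatest one. -/
lemma exists_isGreatest_fixedPoints {α : ℝ} (hα : 0 ≤ α) (hα2 : α < 1 / 2) (μ : ℝ) :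
    ∃ v, IsGreatest (fixedPoints α μ) v ∧ Tendsto (evolve α μ (μ ^ 2 / 4)) atTop (𝓝 v) := by
  have hp : 0 ≤ μ ^ 2 / 4 := by positivity
  have hanti : Antitone (evolve α μ (μ ^ 2 / 4)) := by
    refine antitone_nat_of_succ_le fun t => ?_
    induction t with
    | zero => exact mul_le_of_le_one_right hp (h_le_one hα hα2 hp)
    | succ t ih =>
      exact mul_le_mul_of_nonneg_left (h_mono hα hα2 (evolve_nonneg hα hα2 μ hp _) ih) hp
  have hbdd : BddBelow (Set.range (evolve α μ (μ ^ 2 / 4))) := by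
    refine ⟨0, ?_⟩
    rintro _ ⟨t, rfl⟩
    exact evolve_nonneg hα hα2 μ hp t
  have hlim := tendsto_atTop_ciInf hanti hbdd
  refine ⟨_, ⟨fixed_of_tendsto hα hα2 hp hlim, fun w hw => ?_⟩, hlim⟩
  refine ge_of_tendsto' hlim fun t => le_evolve_of_fixed hα hα2 hw ?_ t
  rw [hw.2]
  exact mul_le_of_le_one_right hp (h_le_one hα hα2 hw.1)

/-- The slope bound at v is global to the right of v, so one inequality at the lower fixed point
excludes any other above it. -/
lemma eq_of_contraction {α : ℝ} (hα : 0 ≤ α) (hα2 : α < 1 / 2) {μ v w : ℝ}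
    (hv : v ∈ fixedPoints α μ) (hw : w ∈ fixedPoints α μ) (hvw : v ≤ w)
    (hc : μ ^ 2 / 4 * (1 - h α v) < 1) : v = w := by
  by_contra hne
  have hlt : 0 < w - v := sub_pos.2 (lt_of_le_of_ne hvw hne)
  have h1 : w - v = μ ^ 2 / 4 * (h α w - h α v) := by
    have e1 := hv.2
    have e2 := hw.2
    rw [mul_sub, ← e1, ← e2]
  have h2 := mul_le_mul_of_nonneg_left (h_increment hα hα2 hv.1 hvw)
    (by positivity : (0 : ℝ) ≤ μ ^ 2 / 4)
  rw [← h1] at h2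
  nlinarith

lemma fixedPoints_unique_of_small {α : ℝ} (hα : 0 ≤ α) (hα2 : α < 1 / 2) {μ v w : ℝ}
    (hv : v ∈ fixedPoints α μ) (hw : w ∈ fixedPoints α μ) (hvw : v ≤ w) (hμ : |μ| < 2) :
    v = w := by
  refine eq_of_contraction hα hα2 hv hw hvw ?_
  have h1 : μ ^ 2 < 4 := by rw [← sq_abs]; nlinarith [abs_nonneg μ]
  have h2 := h_nonneg hα hα2 hv.1
  nlinarith [sq_nonneg μ]

/-- Let l = μ²/4 > 16. A positive fixed point satisfies l (1 - exp(-v/2)) ≤ v, which already forces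
v ≥ l - 2, and then l exp(-v/2) < 1. The value v = 0 is excluded by h(0) = (1 - 2α)² > 0. -/
lemma fixedPoints_unique_of_large {α : ℝ} (hα : 0 ≤ α) (hα2 : α < 1 / 2) {μ v w : ℝ}
    (hv : v ∈ fixedPoints α μ) (hw : w ∈ fixedPoints α μ) (hvw : v ≤ w) (hμ : 8 < |μ|) :
    v = w := by
  have hl : 16 < μ ^ 2 / 4 := by
    have : 64 < μ ^ 2 := by rw [← sq_abs]; nlinarith [abs_nonneg μ]
    linarith
  set l := μ ^ 2 / 4 with hldef
  have hfix : v = l * h α v := hv.2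
  have hv0 := hv.1
  have hh := one_sub_h_le hα hα2 hv0
  have hvpos : 0 < v := by
    rcases hv0.eq_or_lt with h0 | h0
    · exfalso
      rw [← h0, h_zero_right hα hα2] at hfix
      have : 0 < (1 - 2 * α) ^ 2 := by apply pow_pos; linarith
      nlinarith
    · exact h0
  have hexp : ∀ x : ℝ, 0 ≤ x → Real.exp (-x) ≤ 1 / (1 + x + x ^ 2 / 2) := by
    intro x hx
    rw [Real.exp_neg, ← one_div]
    exact one_div_le_one_div_of_le (by positivity) (Real.quadratic_le_exp_of_nonneg hx)
  have hmain : l * (1 - 1 / (1 + v / 2)) ≤ v := by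
    have h3 : Real.exp (-(v / 2)) ≤ 1 / (1 + v / 2) := by
      refine (hexp _ (by linarith)).trans ?_
      exact one_div_le_one_div_of_le (by positivity) (by nlinarith)
    have : 1 - 1 / (1 + v / 2) ≤ h α v := by linarith
    calc l * (1 - 1 / (1 + v / 2)) ≤ l * h α v := mul_le_mul_of_nonneg_left this (by linarith)
      _ = v := hfix.symm
  have hge : l - 2 ≤ v := by
    have e : 1 - 1 / (1 + v / 2) = v / (2 + v) := by field_simp; ring
    rw [e, ← mul_div_assoc, div_le_iff₀ (by linarith)] at hmain
    have : l ≤ 2 + v := by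
      by_contra hcon
      push Not at hcon
      nlinarith
    linarith
  refine eq_of_contraction hα hα2 hv hw hvw ?_
  have h4 : Real.exp (-(v / 2)) ≤ 1 / (1 + v / 2 + (v / 2) ^ 2 / 2) := hexp _ (by linarith)
  have h5 : l * (1 - h α v) ≤ l * (1 / (1 + v / 2 + (v / 2) ^ 2 / 2)) :=
    mul_le_mul_of_nonneg_left (hh.trans h4) (by linarith)
  refine h5.trans_lt ?_
  rw [mul_one_div, div_lt_one (by positivity)]
  nlinarith

/-- For |μ| ≤ 8 the contraction factor is at most 16 (1 - h(0)) ≤ 16 · 4α < 1. -/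
lemma fixedPoints_unique_of_accurate {α : ℝ} (hα : 0 ≤ α) (hα2 : α ≤ 1 / 100) {μ v w : ℝ}
    (hv : v ∈ fixedPoints α μ) (hw : w ∈ fixedPoints α μ) (hvw : v ≤ w) : v = w := by
  have hα3 : α < 1 / 2 := by linarith
  by_cases hμ : 8 < |μ|
  · exact fixedPoints_unique_of_large hα hα3 hv hw hvw hμ
  · push Not at hμ
    refine eq_of_contraction hα hα3 hv hw hvw ?_
    have h1 : μ ^ 2 ≤ 64 := by rw [← sq_abs]; nlinarith [abs_nonneg μ]
    have h2 := h_mono hα hα3 le_rfl hv.1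
    rw [h_zero_right hα hα3] at h2
    have h3 : 1 - h α v ≤ 4 * α := by nlinarith
    have h4 : 0 ≤ 1 - h α v := by linarith [h_le_one hα hα3 hv.1]
    nlinarith [sq_nonneg μ]

end FixedPoints

/-! ### Weak convergence to N(v, v) through characteristic functions. -/

section Weak

lemma tendsto_of_charFun {P : ℕ → Measure ℝ} [∀ n, IsProbabilityMeasure (P n)] {P0 : Measure ℝ}
    [IsProbabilityMeasure P0] (hP : ∀ u, Tendsto (fun n => charFun (P n) u) atTop (𝓝 (charFun P0 u))) :
    Tendsto (fun n => ⟨P n, inferInstance⟩ : ℕ → ProbabilityMeasure ℝ) atTop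
      (@nhds (ProbabilityMeasure ℝ) _ ⟨P0, inferInstance⟩) :=
  ProbabilityMeasure.tendsto_of_tendsto_charFun hP

lemma tendsto_integral_of_charFun {P : ℕ → Measure ℝ} [∀ n, IsProbabilityMeasure (P n)]
    {P0 : Measure ℝ} [IsProbabilityMeasure P0]
    (hP : ∀ u, Tendsto (fun n => charFun (P n) u) atTop (𝓝 (charFun P0 u))) {f : ℝ → ℝ}
    (hf : Continuous f) (C : ℝ) (hC : ∀ x, |f x| ≤ C) :
    Tendsto (fun n => ∫ x, f x ∂(P n)) atTop (𝓝 (∫ x, f x ∂P0)) :=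
  (ProbabilityMeasure.tendsto_iff_forall_integral_tendsto.1 (tendsto_of_charFun hP))
    (BoundedContinuousFunction.ofNormedAddCommGroup f hf C hC)

lemma tendsto_real_of_charFun {P : ℕ → Measure ℝ} [∀ n, IsProbabilityMeasure (P n)]
    {P0 : Measure ℝ} [IsProbabilityMeasure P0]
    (hP : ∀ u, Tendsto (fun n => charFun (P n) u) atTop (𝓝 (charFun P0 u))) {E : Set ℝ}
    (hE : P0 (frontier E) = 0) : Tendsto (fun n => (P n).real E) atTop (𝓝 (P0.real E)) :=
  (ENNReal.tendsto_toReal (measure_ne_top _ _)).comp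
    (ProbabilityMeasure.tendsto_measure_of_null_frontier_of_tendsto' (tendsto_of_charFun hP) hE)

lemma driftGauss_singleton {v s : ℝ} (h : 0 < v ∨ s ≠ v) : driftGauss v {s} = 0 := by
  by_cases hv : 0 < v
  · have hne : v.toNNReal ≠ 0 := by simpa using hv
    have := nullSingletonClass_gaussianReal (μ := v) hne
    rw [driftGauss]
    exact measure_singleton s
  · have hs := h.resolve_left hv
    rw [driftGauss, Real.toNNReal_of_nonpos (not_lt.1 hv), gaussianReal_zero_var]
    simp [hs.symm]

lemma driftGauss_Ici_eq_Ioi {v s : ℝ} (hv : 0 ≤ v) (hs : s ≠ 0) :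
    (driftGauss v).real {y | 0 < y + s} = (driftGauss v).real {y | 0 ≤ y + s} := by
  have h0 : driftGauss v {-s} = 0 := by
    refine driftGauss_singleton ?_
    rcases hv.eq_or_lt with rfl | hv
    · right; simpa using hs
    · exact Or.inl hv
  have : {y : ℝ | 0 ≤ y + s} = {y | 0 < y + s} ∪ {-s} := by
    ext y
    simp only [Set.mem_ofPred_eq, Set.mem_union, Set.mem_singleton_iff]
    rw [le_iff_lt_or_eq]
    constructor
    · rintro (h | h)
      · exact Or.inl h
      · right; linarith
    · rintro (h | h)
      · exact Or.inl h
      · right; rw [h]; ring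
  rw [this, measureReal_def, measureReal_def,
    measure_congr (union_ae_eq_left_of_ae_eq_empty (ae_eq_empty.mpr h0))]

/-- The threshold -s is not an atom of the limit: for v = 0 the limit is the point mass at 0 and s ≠
0. Open and closed half-lines are both needed, since ties are decided asymmetrically by the
estimator. -/
lemma tendsto_real_halfline {P : ℕ → Measure ℝ} [∀ n, IsProbabilityMeasure (P n)] {v s : ℝ}
    (hv : 0 ≤ v) (hs : s ≠ 0)
    (hP : ∀ u, Tendsto (fun n => charFun (P n) u) atTop (𝓝 (charFun (driftGauss v) u))) :
    Tendsto (fun n => (P n).real {y | 0 ≤ y + s}) atTop (𝓝 ((driftGauss v).real {y | 0 ≤ y + s})) ∧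
    Tendsto (fun n => (P n).real {y | 0 < y + s}) atTop
      (𝓝 ((driftGauss v).real {y | 0 ≤ y + s})) := by
  have h0 : driftGauss v {-s} = 0 := by
    refine driftGauss_singleton ?_
    rcases hv.eq_or_lt with rfl | hv
    · right; simpa using hs
    · exact Or.inl hv
  have e1 : {y : ℝ | 0 ≤ y + s} = Set.Ici (-s) := by
    ext y; simp; constructor <;> intro h <;> linarith
  have e2 : {y : ℝ | 0 < y + s} = Set.Ioi (-s) := by
    ext y; simp; constructor <;> intro h <;> linarith
  constructor
  · exact tendsto_real_of_charFun hP (by rw [e1, frontier_Ici]; exact h0)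
  · rw [← driftGauss_Ici_eq_Ioi hv hs]
    exact tendsto_real_of_charFun hP (by rw [e2, frontier_Ioi]; exact h0)

end Weak

/-! ### The limiting accuracy as a Gaussian probability, and its continuity in v. -/

section GaussAccuracy

lemma Q_coe (x : ℝ) : Q (x : EReal) = (gaussianReal 0 1).real (Set.Ioi x) := by
  have hset : {y : ℝ | (x : EReal) < (y : EReal)} = Set.Ioi x := by
    ext y; simp
  rw [Q, hset, measureReal_def, gaussianReal_apply_eq_integral 0 one_ne_zero,
    ENNReal.toReal_ofReal]
  · refine integral_congr_ae (ae_of_all _ fun y => ?_)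
    simp [gaussianPDFReal]
  · exact integral_nonneg fun y => gaussianPDFReal_nonneg _ _ _

lemma Q_top : Q ⊤ = 0 := by
  simp [Q]

lemma Q_bot : Q ⊥ = 1 := by
  have hset : {y : ℝ | (⊥ : EReal) < (y : EReal)} = Set.univ := by
    ext y; simp [EReal.bot_lt_coe]
  rw [Q, hset, Measure.restrict_univ]
  have := integral_gaussianPDFReal_eq_one 0 (v := 1) one_ne_zero
  refine Eq.trans (integral_congr_ae (ae_of_all _ fun y => ?_)) this
  simp [gaussianPDFReal]

/-- By symmetry of Z, Z ≤ (v + s)/√v has the probability of v + √v Z + s ≥ 0. At v = 0 the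
conventions for `ratio` and the point mass agree because s ≠ 0. -/
lemma one_sub_Q_ratio {v s : ℝ} (hv : 0 ≤ v) (hs : s ≠ 0) :
    1 - Q (ratio v (s : EReal)) = (driftGauss v).real {y | 0 ≤ y + s} := by
  rcases hv.eq_or_lt with rfl | hv
  · simp only [ratio, if_true]
    rw [driftGauss, Real.toNNReal_zero, gaussianReal_zero_var]
    rcases hs.lt_or_gt with hs | hs
    · rw [EReal.coe_mul_top_of_neg hs, Q_bot]
      rw [measureReal_def, Measure.dirac_apply' _ (measurableSet_le (by fun_prop) (by fun_prop))]
      simp [hs]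
    · rw [EReal.coe_mul_top_of_pos hs, Q_top]
      rw [measureReal_def, Measure.dirac_apply' _ (measurableSet_le (by fun_prop) (by fun_prop))]
      simp [hs.le]
  · have hsq : 0 < √v := Real.sqrt_pos.2 hv
    have hr : ratio v (s : EReal) = (((v + s) / √v : ℝ) : EReal) := by
      rw [ratio, if_neg hv.ne', ← EReal.coe_add, ← EReal.coe_div]
    rw [hr, Q_coe]
    have hcompl : 1 - (gaussianReal 0 1).real (Set.Ioi ((v + s) / √v)) =
        (gaussianReal 0 1).real (Set.Iic ((v + s) / √v)) := by
      rw [← Set.compl_Ioi, probReal_compl_eq_one_sub measurableSet_Ioi]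
    have hneg : (gaussianReal 0 1).real (Set.Iic ((v + s) / √v)) =
        (gaussianReal 0 1).real {z | 0 ≤ v + √v * z + s} := by
      have h1 : (gaussianReal 0 1).map (fun x => -x) = gaussianReal 0 1 := by
        rw [gaussianReal_map_neg]; simp
      conv_lhs => rw [← h1]
      rw [map_measureReal_apply (by fun_prop) measurableSet_Iic]
      congr 1
      ext z
      simp only [Set.mem_preimage, Set.mem_Iic, Set.mem_ofPred_eq]
      rw [le_div_iff₀ hsq]
      constructor <;> intro h <;> linarith
    have hmap : (gaussianReal 0 1).real {z | 0 ≤ v + √v * z + s} =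
        (driftGauss v).real {y | 0 ≤ y + s} := by
      have hm : MeasurableSet {y : ℝ | 0 ≤ y + s} := measurableSet_le (by fun_prop) (by fun_prop)
      have := integral_standard_eq_driftGauss hv.le
        (f := Set.indicator {y : ℝ | 0 ≤ y + s} 1) (measurable_one.indicator hm)
      rw [integral_indicator_one hm] at this
      rw [← this]
      have hm' : MeasurableSet {z : ℝ | 0 ≤ v + √v * z + s} :=
        measurableSet_le (by fun_prop) (by fun_prop)
      rw [← integral_indicator_one hm']
      rfl
    rw [hcompl, hneg, hmap]

/-- The probability that the sign of `Y + U` is positive, where `Y` has law `P`. -/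
noncomputable def signAccuracy (α : ℝ) (P : Measure ℝ) : ℝ :=
  (1 - α) * P.real {y | 0 ≤ y + rgam α} + α * P.real {y | 0 ≤ y + -rgam α}

lemma gaussAccuracy_eq {α : ℝ} (hα : 0 < α) (hα2 : α < 1 / 2) {v : ℝ} (hv : 0 ≤ v) :
    gaussAccuracy α v = signAccuracy α (driftGauss v) := by
  have hg := (rgam_pos hα hα2).ne'
  rw [gaussAccuracy, expU_eq hα, signAccuracy, ← one_sub_Q_ratio hv hg,
    ← one_sub_Q_ratio hv (neg_ne_zero.2 hg)]
  ring

lemma gaussAccuracy_zero_left {v : ℝ} (hv : 0 ≤ v) : gaussAccuracy 0 v = 1 := by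
  have : ratio v ⊤ = ⊤ := by
    unfold ratio
    split_ifs with h
    · rfl
    · rw [EReal.coe_add_top]
      exact EReal.top_div_of_pos_ne_top (by
        exact_mod_cast Real.sqrt_pos.2 (lt_of_le_of_ne hv (Ne.symm h))) (EReal.coe_ne_top _)
  simp [gaussAccuracy, expU, gam, this, Q_top]

lemma charFun_driftGauss {v : ℝ} (hv : 0 ≤ v) (u : ℝ) :
    charFun (driftGauss v) u = Complex.exp (u * v * Complex.I - v * u ^ 2 / 2) := by
  rw [driftGauss, charFun_gaussianReal]
  congr 2
  simp [Real.coe_toNNReal _ hv]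

/-- Continuity comes from that of the characteristic function of N(v, v) in v, which also covers the
degenerate limit v = 0. -/
lemma tendsto_gaussAccuracy {α : ℝ} (hα : 0 ≤ α) (hα2 : α < 1 / 2) {w : ℕ → ℝ} {v : ℝ}
    (hw0 : ∀ t, 0 ≤ w t) (hw : Tendsto w atTop (𝓝 v)) :
    Tendsto (fun t => gaussAccuracy α (w t)) atTop (𝓝 (gaussAccuracy α v)) := by
  have hv : 0 ≤ v := ge_of_tendsto' hw hw0
  rcases hα.eq_or_lt with rfl | hα
  · simp_rw [gaussAccuracy_zero_left (hw0 _)]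
    rw [gaussAccuracy_zero_left hv]
    exact tendsto_const_nhds
  · have hg := (rgam_pos hα hα2).ne'
    simp_rw [gaussAccuracy_eq hα hα2 (hw0 _)]
    rw [gaussAccuracy_eq hα hα2 hv]
    have hP : ∀ u, Tendsto (fun n => charFun (driftGauss (w n)) u) atTop
        (𝓝 (charFun (driftGauss v) u)) := by
      intro u
      simp_rw [charFun_driftGauss (hw0 _)]
      rw [charFun_driftGauss hv]
      have hc : Continuous fun x : ℝ => Complex.exp (u * x * Complex.I - x * u ^ 2 / 2) := by
        fun_prop
      exact (hc.tendsto v).comp hw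
    exact ((tendsto_real_halfline hv hg hP).1.const_mul _).add
      ((tendsto_real_halfline hv (neg_ne_zero.2 hg) hP).1.const_mul _)

end GaussAccuracy

/-! ### Expectation and independence on finite product spaces. -/

section ProductExpectation

set_option linter.unusedSectionVars false

variable {ι K : Type*} [Fintype ι] [DecidableEq ι] [Fintype K]

/-- The weight of a configuration under a product law. -/
noncomputable def pweight (w : ι → K → ℝ) (ω : ι → K) : ℝ := ∏ x, w x (ω x)

/-- The expectation under a product law on a finite product space. -/
noncomputable def ex {M : Type*} [AddCommMonoid M] [SMul ℝ M] (w : ι → K → ℝ) (f : (ι → K) → M) : M :=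
  ∑ ω, pweight w ω • f ω

lemma sum_pweight {w : ι → K → ℝ} (hw : ∀ x, ∑ k, w x k = 1) : ∑ ω, pweight w ω = 1 := by
  classical
  simp only [pweight]
  rw [← Fintype.piFinset_univ, ← Finset.prod_univ_sum]
  simp [hw]

lemma pweight_nonneg {w : ι → K → ℝ} (hw : ∀ x k, 0 ≤ w x k) (ω : ι → K) : 0 ≤ pweight w ω :=
  Finset.prod_nonneg fun x _ => hw x _

lemma pweight_swap (w : ι → K → ℝ) (B : Finset ι) (ω ω' : ι → K) :
    pweight w (B.piecewise ω' ω) * pweight w (B.piecewise ω ω') = pweight w ω * pweight w ω' := by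
  simp only [pweight, ← Finset.prod_mul_distrib]
  refine Finset.prod_congr rfl fun x _ => ?_
  by_cases hx : x ∈ B <;> simp [hx, mul_comm]

lemma sum_swap {M : Type*} [AddCommMonoid M] (B : Finset ι) (F : (ι → K) → (ι → K) → M) :
    ∑ ω, ∑ ω', F (B.piecewise ω' ω) (B.piecewise ω ω') = ∑ ω, ∑ ω', F ω ω' := by
  rw [← Finset.sum_product', ← Finset.sum_product']
  refine Finset.sum_nbij' (fun p => (B.piecewise p.2 p.1, B.piecewise p.1 p.2))
    (fun p => (B.piecewise p.2 p.1, B.piecewise p.1 p.2)) (by simp) (by simp) ?_ ?_ (by simp)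
  all_goals
    rintro ⟨ω, ω'⟩ _
    ext x <;> by_cases hx : x ∈ B <;> simp [hx]

variable {𝕜 : Type*} [CommRing 𝕜] [Algebra ℝ 𝕜]

lemma ex_const {w : ι → K → ℝ} (hw : ∀ x, ∑ k, w x k = 1) (c : 𝕜) : ex w (fun _ => c) = c := by
  simp only [ex]
  rw [← Finset.sum_smul, sum_pweight hw, one_smul]

/-- An independent copy ω' is introduced and the coordinates in B are exchanged between ω and ω'.
This preserves the joint weight, keeps f as a function of ω and makes g a function of ω'. -/
lemma ex_mul_of_disjoint {w : ι → K → ℝ} (hw : ∀ x, ∑ k, w x k = 1) {f g : (ι → K) → 𝕜}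
    {A B : Set ι} (hf : DependsOn f A) (hg : DependsOn g B) (hAB : Disjoint A B) :
    ex w (fun ω => f ω * g ω) = ex w f * ex w g := by
  classical
  have h1 : ex w (fun ω => f ω * g ω) =
      ∑ ω, ∑ ω', (pweight w ω * pweight w ω') • (f ω * g ω) := by
    simp only [ex]
    refine Finset.sum_congr rfl fun ω _ => ?_
    rw [← Finset.sum_smul, ← Finset.mul_sum, sum_pweight hw, mul_one]
  rw [h1, ← sum_swap (Finset.univ.filter (· ∈ B))]
  simp only [pweight_swap]
  simp only [ex, Finset.sum_mul_sum]
  refine Finset.sum_congr rfl fun ω _ => Finset.sum_congr rfl fun ω' _ => ?_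
  have e1 : f ((Finset.univ.filter (· ∈ B)).piecewise ω' ω) = f ω := by
    refine hf fun x hx => ?_
    have : x ∉ B := fun h => Set.disjoint_left.1 hAB hx h
    simp [this]
  have e2 : g ((Finset.univ.filter (· ∈ B)).piecewise ω' ω) = g ω' := by
    refine hg fun x hx => ?_
    simp [hx]
  rw [e1, e2, smul_mul_smul_comm]

lemma dependsOn_prod {κ : Type*} {L : Finset κ} {g : κ → (ι → K) → 𝕜} {A : κ → Set ι}
    (hg : ∀ l ∈ L, DependsOn (g l) (A l)) :
    DependsOn (fun ω => ∏ l ∈ L, g l ω) (⋃ l ∈ L, A l) := by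
  intro ω ω' h
  refine Finset.prod_congr rfl fun l hl => hg l hl fun x hx => h x ?_
  simp only [Set.mem_iUnion]
  exact ⟨l, hl, hx⟩

lemma ex_prod_of_disjoint {w : ι → K → ℝ} (hw : ∀ x, ∑ k, w x k = 1) {κ : Type*}
    {L : Finset κ} {g : κ → (ι → K) → 𝕜} {A : κ → Set ι}
    (hg : ∀ l ∈ L, DependsOn (g l) (A l))
    (hA : ∀ l ∈ L, ∀ l' ∈ L, l ≠ l' → Disjoint (A l) (A l')) :
    ex w (fun ω => ∏ l ∈ L, g l ω) = ∏ l ∈ L, ex w (g l) := by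
  classical
  induction L using Finset.induction_on with
  | empty => simpa using ex_const hw (1 : 𝕜)
  | insert a L ha ih =>
    simp only [Finset.prod_insert ha]
    have hL : DependsOn (fun ω => ∏ l ∈ L, g l ω) (⋃ l ∈ L, A l) :=
      dependsOn_prod fun l hl => hg l (Finset.mem_insert_of_mem hl)
    rw [ex_mul_of_disjoint hw (hg a (Finset.mem_insert_self _ _)) hL, ih]
    · exact fun l hl => hg l (Finset.mem_insert_of_mem hl)
    · exact fun l hl l' hl' => hA l (Finset.mem_insert_of_mem hl) l' (Finset.mem_insert_of_mem hl')
    · simp only [Set.disjoint_iUnion_right]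
      intro l hl
      refine hA a (Finset.mem_insert_self _ _) l (Finset.mem_insert_of_mem hl) ?_
      rintro rfl; exact ha hl

lemma ex_add (w : ι → K → ℝ) (f g : (ι → K) → 𝕜) :
    ex w (fun ω => f ω + g ω) = ex w f + ex w g := by
  simp [ex, smul_add, Finset.sum_add_distrib]

lemma ex_sub (w : ι → K → ℝ) (f g : (ι → K) → 𝕜) :
    ex w (fun ω => f ω - g ω) = ex w f - ex w g := by
  simp [ex, smul_sub, Finset.sum_sub_distrib]

lemma ex_const_mul (w : ι → K → ℝ) (c : 𝕜) (f : (ι → K) → 𝕜) :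
    ex w (fun ω => c * f ω) = c * ex w f := by
  simp [ex, Finset.mul_sum]

lemma ex_mul_const (w : ι → K → ℝ) (c : 𝕜) (f : (ι → K) → 𝕜) :
    ex w (fun ω => f ω * c) = ex w f * c := by
  simp [ex, Finset.sum_mul]

lemma ex_sum (w : ι → K → ℝ) {κ : Type*} (L : Finset κ) (f : κ → (ι → K) → 𝕜) :
    ex w (fun ω => ∑ l ∈ L, f l ω) = ∑ l ∈ L, ex w (f l) := by
  simp only [ex, Finset.smul_sum]
  rw [Finset.sum_comm]

lemma ex_mono {w : ι → K → ℝ} (hw : ∀ x k, 0 ≤ w x k) {f g : (ι → K) → ℝ} (h : ∀ ω, f ω ≤ g ω) :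
    ex w f ≤ ex w g :=
  Finset.sum_le_sum fun ω _ => mul_le_mul_of_nonneg_left (h ω) (pweight_nonneg hw ω)

lemma ex_nonneg {w : ι → K → ℝ} (hw : ∀ x k, 0 ≤ w x k) {f : (ι → K) → ℝ} (h : ∀ ω, 0 ≤ f ω) :
    0 ≤ ex w f :=
  Finset.sum_nonneg fun ω _ => mul_nonneg (pweight_nonneg hw ω) (h ω)

lemma norm_ex_le {w : ι → K → ℝ} (hw : ∀ x k, 0 ≤ w x k) (f : (ι → K) → ℂ) :
    ‖ex w f‖ ≤ ex w (fun ω => ‖f ω‖) := by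
  refine (norm_sum_le _ _).trans (Finset.sum_le_sum fun ω _ => ?_)
  rw [norm_smul, Real.norm_of_nonneg (pweight_nonneg hw ω), smul_eq_mul]

lemma abs_ex_le {w : ι → K → ℝ} (hw : ∀ x k, 0 ≤ w x k) (f : (ι → K) → ℝ) :
    |ex w f| ≤ ex w (fun ω => |f ω|) := by
  refine (Finset.abs_sum_le_sum_abs _ _).trans (Finset.sum_le_sum fun ω _ => ?_)
  rw [smul_eq_mul, abs_mul, abs_of_nonneg (pweight_nonneg hw ω), smul_eq_mul]

lemma sq_ex_le {w : ι → K → ℝ} (hw : ∀ x k, 0 ≤ w x k) (hw1 : ∀ x, ∑ k, w x k = 1)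
    (f : (ι → K) → ℝ) : ex w f ^ 2 ≤ ex w (fun ω => f ω ^ 2) := by
  have h : 0 ≤ ex w (fun ω => (f ω - ex w f) ^ 2) := ex_nonneg hw fun ω => sq_nonneg _
  have e : (fun ω => (f ω - ex w f) ^ 2) =
      fun ω => (f ω ^ 2 - 2 * ex w f * f ω) + ex w f ^ 2 := by funext ω; ring
  rw [e, ex_add, ex_sub, ex_const_mul, ex_const hw1] at h
  nlinarith

/-- The probability of an event under a product law. -/
noncomputable def pr (w : ι → K → ℝ) (E : (ι → K) → Prop) : ℝ :=
  open Classical in ex w fun ω => if E ω then (1 : ℝ) else 0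

lemma pr_nonneg {w : ι → K → ℝ} (hw : ∀ x k, 0 ≤ w x k) (E : (ι → K) → Prop) : 0 ≤ pr w E :=
  ex_nonneg hw fun ω => by split_ifs <;> norm_num

lemma pr_mono {w : ι → K → ℝ} (hw : ∀ x k, 0 ≤ w x k) {E F : (ι → K) → Prop}
    (h : ∀ ω, E ω → F ω) : pr w E ≤ pr w F := by
  refine ex_mono hw fun ω => ?_
  by_cases hE : E ω
  · simp [hE, h ω hE]
  · rw [if_neg hE]; split_ifs <;> norm_num

lemma pr_le_one {w : ι → K → ℝ} (hw : ∀ x k, 0 ≤ w x k) (hw1 : ∀ x, ∑ k, w x k = 1)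
    (E : (ι → K) → Prop) : pr w E ≤ 1 := by
  refine (ex_mono hw (g := fun _ => 1) fun ω => ?_).trans (ex_const hw1 (1 : ℝ)).le
  split_ifs <;> norm_num

lemma pr_or_le {w : ι → K → ℝ} (hw : ∀ x k, 0 ≤ w x k) (E F : (ι → K) → Prop) :
    pr w (fun ω => E ω ∨ F ω) ≤ pr w E + pr w F := by
  rw [pr, pr, pr, ← ex_add]
  refine ex_mono hw fun ω => ?_
  by_cases hE : E ω <;> by_cases hF : F ω <;> simp [hE, hF]

lemma pr_exists_le {w : ι → K → ℝ} (hw : ∀ x k, 0 ≤ w x k) {κ : Type*} (L : Finset κ)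
    (E : κ → (ι → K) → Prop) : pr w (fun ω => ∃ l ∈ L, E l ω) ≤ ∑ l ∈ L, pr w (E l) := by
  classical
  simp only [pr]
  rw [← ex_sum]
  refine ex_mono hw fun ω => ?_
  split_ifs with h
  · obtain ⟨l, hl, hE⟩ := h
    refine le_trans ?_ (Finset.single_le_sum (f := fun l => if E l ω then (1 : ℝ) else 0)
      (fun l _ => by split_ifs <;> norm_num) hl)
    simp [hE]
  · exact Finset.sum_nonneg fun l _ => by split_ifs <;> norm_num

lemma pr_and_of_disjoint {w : ι → K → ℝ} (hw : ∀ x, ∑ k, w x k = 1) {E F : (ι → K) → Prop}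
    {A B : Set ι} (hE : DependsOn E A) (hF : DependsOn F B) (hAB : Disjoint A B) :
    pr w (fun ω => E ω ∧ F ω) = pr w E * pr w F := by
  classical
  rw [pr, pr, pr, ← ex_mul_of_disjoint hw (A := A) (B := B) _ _ hAB]
  · congr 1; funext ω
    by_cases h1 : E ω <;> by_cases h2 : F ω <;> simp [h1, h2]
  · intro ω ω' h; simp only [hE h]
  · intro ω ω' h; simp only [hF h]

lemma markov {w : ι → K → ℝ} (hw : ∀ x k, 0 ≤ w x k) {f : (ι → K) → ℝ} (hf : ∀ ω, 0 ≤ f ω)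
    {c : ℝ} (hc : 0 < c) : pr w (fun ω => c < f ω) ≤ ex w f / c := by
  rw [le_div_iff₀ hc, pr, ← ex_mul_const]
  refine ex_mono hw fun ω => ?_
  split_ifs with h
  · linarith
  · simpa using hf ω

lemma ex_coordinate {w : ι → K → ℝ} (hw : ∀ x, ∑ k, w x k = 1) (x : ι) (f : K → 𝕜) :
    ex w (fun ω => f (ω x)) = ∑ k, w x k • f k := by
  classical
  have h1 : ∀ ω : ι → K, pweight w ω • f (ω x) =
      ∏ y, (if y = x then w y (ω y) • f (ω y) else algebraMap ℝ 𝕜 (w y (ω y))) := by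
    intro ω
    rw [← Finset.mul_prod_erase Finset.univ _ (Finset.mem_univ x), pweight,
      ← Finset.mul_prod_erase Finset.univ _ (Finset.mem_univ x)]
    simp only [if_true]
    rw [Finset.prod_congr rfl (g := fun y => algebraMap ℝ 𝕜 (w y (ω y)))
      (fun y hy => if_neg (Finset.ne_of_mem_erase hy)), ← map_prod]
    simp only [Algebra.smul_def, map_mul]
    ring
  simp only [ex, h1]
  rw [← Fintype.piFinset_univ, ← Finset.prod_univ_sum
    (f := fun y k => if y = x then w y k • f k else algebraMap ℝ 𝕜 (w y k)),
    ← Finset.mul_prod_erase Finset.univ _ (Finset.mem_univ x)]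
  simp only [if_true]
  rw [Finset.prod_eq_one, mul_one]
  intro y hy
  simp only [if_neg (Finset.ne_of_mem_erase hy)]
  rw [← map_sum, hw, map_one]

end ProductExpectation

/-! ### Self-avoiding exploration of a graph and the message recursion along it. -/

section Recursion

variable {V : Type*} [Fintype V] [DecidableEq V]

/-- The neighbours of `i` outside of `S` and different from `i`. -/
noncomputable def nb (A : V → V → Prop) (S : Finset V) (i : V) : Finset V :=
  open Classical in Finset.univ.filter fun l => A i l ∧ l ∉ insert i S

/-- The vertices reached from `i` by self-avoiding walks of length at most `t` outside of `S`. -/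
noncomputable def reach (A : V → V → Prop) : ℕ → Finset V → V → Finset V
  | 0, _, i => {i}
  | t + 1, S, i => insert i ((nb A S i).biUnion fun l => reach A t (insert i S) l)

/-- The vertices reached from `i` by self-avoiding walks of length less than `t` outside of `S`. -/
noncomputable def inner (A : V → V → Prop) : ℕ → Finset V → V → Finset V
  | 0, _, _ => ∅
  | t + 1, S, i => insert i ((nb A S i).biUnion fun l => inner A t (insert i S) l)

/-- The self-avoiding walks of length at most `t` from `i` outside of `S` form a tree. -/
def treeLike (A : V → V → Prop) : ℕ → Finset V → V → Prop
  | 0, _, _ => True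
  | t + 1, S, i => (∀ l ∈ nb A S i, ∀ l' ∈ nb A S i, l ≠ l' →
      Disjoint (reach A t (insert i S) l) (reach A t (insert i S) l')) ∧
      ∀ l ∈ nb A S i, treeLike A t (insert i S) l

/-- The hyperbolic tangents of the messages sent by `i` in the self-avoiding recursion. -/
noncomputable def msg (A : V → V → Prop) (θ : ℝ) (f init : V → ℝ) : ℕ → Finset V → V → ℝ
  | 0, _, i => init i
  | t + 1, S, i =>
    Real.tanh (f i + ∑ l ∈ nb A S i, Real.artanh (θ * msg A θ f init t (insert i S) l))

/-- The sum of the messages received by `i` in the self-avoiding recursion. -/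
noncomputable def cav (A : V → V → Prop) (θ : ℝ) (f init : V → ℝ) (t : ℕ) (S : Finset V)
    (i : V) : ℝ :=
  ∑ l ∈ nb A S i, Real.artanh (θ * msg A θ f init t (insert i S) l)

variable {A A' : V → V → Prop} {θ : ℝ} {f init f' init' : V → ℝ}

lemma msg_succ (t : ℕ) (S : Finset V) (i : V) :
    msg A θ f init (t + 1) S i = Real.tanh (f i + cav A θ f init t S i) := rfl

lemma mem_nb {S : Finset V} {i l : V} : l ∈ nb A S i ↔ A i l ∧ l ∉ insert i S := by
  simp [nb]

lemma self_mem_reach (t : ℕ) (S : Finset V) (i : V) : i ∈ reach A t S i := by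
  cases t <;> simp [reach]

lemma reach_subset_reach_succ {t : ℕ} {S : Finset V} {i l : V} (hl : l ∈ nb A S i) :
    reach A t (insert i S) l ⊆ reach A (t + 1) S i := by
  intro x hx
  simp only [reach, Finset.mem_insert, Finset.mem_biUnion]
  exact Or.inr ⟨l, hl, hx⟩

lemma nb_subset_reach_succ {t : ℕ} {S : Finset V} {i : V} :
    nb A S i ⊆ reach A (t + 1) S i := fun l hl =>
  reach_subset_reach_succ hl (self_mem_reach t _ l)

lemma inner_subset_reach (t : ℕ) : ∀ (S : Finset V) (i : V), inner A t S i ⊆ reach A t S i := by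
  induction t with
  | zero => intro S i; simp [inner]
  | succ t ih =>
    intro S i x hx
    simp only [inner, reach, Finset.mem_insert, Finset.mem_biUnion] at hx ⊢
    rcases hx with hx | ⟨l, hl, hx⟩
    · exact Or.inl hx
    · exact Or.inr ⟨l, hl, ih _ _ hx⟩

lemma reach_disjoint (t : ℕ) : ∀ {S : Finset V} {i : V}, i ∉ S → ∀ x ∈ reach A t S i, x ∉ S := by
  induction t with
  | zero => intro S i hi x hx; simp only [reach, Finset.mem_singleton] at hx; rwa [hx]
  | succ t ih =>
    intro S i hi x hx
    simp only [reach, Finset.mem_insert, Finset.mem_biUnion] at hx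
    rcases hx with hx | ⟨l, hl, hx⟩
    · rwa [hx]
    · intro hxS
      exact ih (mem_nb.1 hl).2 x hx (Finset.mem_insert_of_mem hxS)

lemma inner_disjoint (t : ℕ) {S : Finset V} {i : V} (hi : i ∉ S) (x : V)
    (hx : x ∈ inner A t S i) : x ∉ S :=
  reach_disjoint t hi x (inner_subset_reach t _ _ hx)

lemma mem_reach_of_adj_inner (t : ℕ) : ∀ {S : Finset V} {i x y : V}, x ∈ inner A t S i → A x y →
    y ∉ S → y ∈ reach A t S i := by
  induction t with
  | zero => intro S i x y hx; simp [inner] at hx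
  | succ t ih =>
    intro S i x y hx hxy hy
    by_cases hyi : y = i
    · rw [hyi]; exact self_mem_reach _ _ _
    have hy' : y ∉ insert i S := by simp [hyi, hy]
    simp only [inner, Finset.mem_insert, Finset.mem_biUnion] at hx
    rcases hx with rfl | ⟨l, hl, hx⟩
    · exact nb_subset_reach_succ (mem_nb.2 ⟨hxy, hy'⟩)
    · exact reach_subset_reach_succ hl (ih hx hxy hy')

lemma nb_union {S B : Finset V} {i : V} (h : ∀ l ∈ nb A S i, l ∉ B) :
    nb A (S ∪ B) i = nb A S i := by
  ext l
  simp only [mem_nb, Finset.mem_insert, Finset.mem_union, not_or]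
  constructor
  · rintro ⟨h1, h2, h3, _⟩; exact ⟨h1, h2, h3⟩
  · rintro ⟨h1, h2, h3⟩
    exact ⟨h1, h2, h3, h l (mem_nb.2 ⟨h1, by simp [h2, h3]⟩)⟩

/-- Forbidding vertices that the exploration never meets changes neither the exploration nor the
message. This is what allows a neighbourhood to be disentangled from a disjoint one. -/
lemma reach_union (t : ℕ) : ∀ {S B : Finset V} {i : V}, Disjoint (reach A t S i) B →
    reach A t (S ∪ B) i = reach A t S i ∧
      msg A θ f init t (S ∪ B) i = msg A θ f init t S i := by
  induction t with
  | zero => intro S B i _; exact ⟨rfl, rfl⟩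
  | succ t ih =>
    intro S B i h
    have hnb : nb A (S ∪ B) i = nb A S i :=
      nb_union fun l hl => Finset.disjoint_left.1 h (nb_subset_reach_succ hl)
    have hl : ∀ l ∈ nb A S i, Disjoint (reach A t (insert i S) l) B := fun l hl =>
      Finset.disjoint_of_subset_left (reach_subset_reach_succ hl) h
    constructor
    · simp only [reach, hnb]
      congr 1
      refine Finset.biUnion_congr rfl fun l hl' => ?_
      rw [← Finset.insert_union]
      exact (ih (hl l hl')).1
    · simp only [msg, hnb]
      congr 2
      refine Finset.sum_congr rfl fun l hl' => ?_
      rw [← Finset.insert_union, (ih (hl l hl')).2]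

lemma inner_subset_inner_succ {t : ℕ} {S : Finset V} {i l : V} (hl : l ∈ nb A S i) :
    inner A t (insert i S) l ⊆ inner A (t + 1) S i := by
  intro x hx
  simp only [inner, Finset.mem_insert, Finset.mem_biUnion]
  exact Or.inr ⟨l, hl, hx⟩

lemma nb_congr {S : Finset V} {i : V} (h : ∀ y ∉ S, (A i y ↔ A' i y)) : nb A' S i = nb A S i := by
  ext l
  simp only [mem_nb, Finset.mem_insert, not_or]
  constructor
  · rintro ⟨e1, e2, e3⟩; exact ⟨(h l e3).2 e1, e2, e3⟩
  · rintro ⟨e1, e2, e3⟩; exact ⟨(h l e3).1 e1, e2, e3⟩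

/-- Fields and initial values are read on all reached vertices, adjacency only at those reached in
fewer than t steps. The sets X and Y keep the two apart: pairs inside the outer boundary are never
inspected. -/
lemma reach_local (t : ℕ) : ∀ {S X Y : Finset V} {i : V}, reach A t S i ⊆ X → inner A t S i ⊆ Y →
    (∀ x ∈ Y, ∀ y ∉ S, (A x y ↔ A' x y)) → (∀ x ∈ X, f x = f' x) → (∀ x ∈ X, init x = init' x) →
    reach A' t S i = reach A t S i ∧ msg A' θ f' init' t S i = msg A θ f init t S i := by
  induction t with
  | zero =>
    intro S X Y i h _ _ _ h3
    exact ⟨rfl, (h3 i (h (self_mem_reach _ _ _))).symm⟩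
  | succ t ih =>
    intro S X Y i h hY h1 h2 h3
    have hi : i ∈ X := h (self_mem_reach _ _ _)
    have hnb : nb A' S i = nb A S i := nb_congr (h1 i (hY (by simp [inner])))
    have hl := fun l (hl : l ∈ nb A S i) => ih (S := insert i S) (i := l)
      ((reach_subset_reach_succ hl).trans h) ((inner_subset_inner_succ hl).trans hY)
      (fun x hx y hy => h1 x hx y fun hyS => hy (Finset.mem_insert_of_mem hyS)) h2 h3
    constructor
    · simp only [reach, hnb]
      congr 1
      exact Finset.biUnion_congr rfl fun l hl' => (hl l hl').1
    · simp only [msg, hnb]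
      rw [h2 i hi]
      congr 2
      refine Finset.sum_congr rfl fun l hl' => ?_
      rw [(hl l hl').2]

lemma treeLike_local (t : ℕ) : ∀ {S X : Finset V} {i : V}, reach A t S i ⊆ X →
    (∀ x ∈ X, ∀ y ∉ S, (A x y ↔ A' x y)) → (treeLike A t S i ↔ treeLike A' t S i) := by
  induction t with
  | zero => intro S X i _ _; exact Iff.rfl
  | succ t ih =>
    intro S X i h h1
    have hi : i ∈ X := h (self_mem_reach _ _ _)
    have hnb : nb A' S i = nb A S i := nb_congr (h1 i hi)
    have hr : ∀ l ∈ nb A S i, reach A' t (insert i S) l = reach A t (insert i S) l := fun l hl =>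
      (reach_local (θ := 0) (f := 0) (f' := 0) (init := 0) (init' := 0) t
        ((reach_subset_reach_succ hl).trans h)
        ((inner_subset_reach _ _ _).trans ((reach_subset_reach_succ hl).trans h))
        (fun x hx y hy => h1 x hx y fun hyS => hy (Finset.mem_insert_of_mem hyS))
        (fun _ _ => rfl) (fun _ _ => rfl)).1
    simp only [treeLike, hnb]
    refine and_congr ?_ ?_
    · refine forall₂_congr fun l hl => forall₂_congr fun l' hl' => ?_
      rw [hr l hl, hr l' hl']
    · exact forall₂_congr fun l hl => ih ((reach_subset_reach_succ hl).trans h)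
        (fun x hx y hy => h1 x hx y fun hyS => hy (Finset.mem_insert_of_mem hyS))

lemma nb_mono (h : ∀ x y, A x y → A' x y) (S : Finset V) (i : V) : nb A S i ⊆ nb A' S i :=
  fun _ hl => mem_nb.2 ⟨h _ _ (mem_nb.1 hl).1, (mem_nb.1 hl).2⟩

lemma reach_mono (h : ∀ x y, A x y → A' x y) (t : ℕ) : ∀ (S : Finset V) (i : V),
    reach A t S i ⊆ reach A' t S i := by
  induction t with
  | zero => intro S i; exact subset_rfl
  | succ t ih =>
    intro S i
    exact Finset.insert_subset_insert _ (Finset.biUnion_subset_biUnion_of_subset_left _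
      (nb_mono h S i) |>.trans' (Finset.biUnion_mono fun _ _ => ih _ _))

lemma inner_mono (h : ∀ x y, A x y → A' x y) (t : ℕ) : ∀ (S : Finset V) (i : V),
    inner A t S i ⊆ inner A' t S i := by
  induction t with
  | zero => intro S i; exact subset_rfl
  | succ t ih =>
    intro S i
    exact Finset.insert_subset_insert _ (Finset.biUnion_subset_biUnion_of_subset_left _
      (nb_mono h S i) |>.trans' (Finset.biUnion_mono fun _ _ => ih _ _))

/-- The tree property is estimated for a larger relation that ignores the labels, and passes to the
graph by this monotonicity. -/
lemma treeLike_anti (h : ∀ x y, A x y → A' x y) (t : ℕ) : ∀ (S : Finset V) (i : V),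
    treeLike A' t S i → treeLike A t S i := by
  induction t with
  | zero => intro S i _; trivial
  | succ t ih =>
    rintro S i ⟨h1, h2⟩
    refine ⟨fun l hl l' hl' hne => ?_, fun _ hl => ih _ _ (h2 _ (nb_mono h S i hl))⟩
    exact Finset.disjoint_of_subset_left (reach_mono h _ _ _) (Finset.disjoint_of_subset_right
      (reach_mono h _ _ _) (h1 l (nb_mono h S i hl) l' (nb_mono h S i hl') hne))

lemma msg_neg (t : ℕ) : ∀ (S : Finset V) (i : V),
    msg A θ (fun x => -f x) (fun x => -init x) t S i = - msg A θ f init t S i := by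
  induction t with
  | zero => intro S i; rfl
  | succ t ih =>
    intro S i
    simp only [msg, ih, mul_neg]
    rw [← Real.tanh_neg, neg_add, ← Finset.sum_neg_distrib]
    congr 2
    refine Finset.sum_congr rfl fun l _ => ?_
    simp only [Real.artanh, ← sub_eq_add_neg, sub_neg_eq_add]
    rw [← Real.log_inv, ← Real.sqrt_inv, inv_div]

lemma abs_msg_le (h : ∀ i, |init i| ≤ 1) (t : ℕ) (S : Finset V) (i : V) :
    |msg A θ f init t S i| ≤ 1 := by
  cases t with
  | zero => exact h i
  | succ t => exact (abs_tanh_lt_one _).le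

/-- On a tree, non-backtracking messages are given by the self-avoiding recursion. -/
lemma nonbacktracking_eq_msg (hsymm : ∀ x y, A x y → A y x) (hirr : ∀ x, ¬ A x x)
    {m : ℕ → V → V → ℝ} (h0 : ∀ i j, m 0 i j = init i)
    (hs : ∀ t i j, m (t + 1) i j = Real.tanh (f i + open Classical in
      ∑ l with A l i ∧ l ≠ j, Real.artanh (θ * m t l i))) (t : ℕ) :
    ∀ {S : Finset V} {i j : V}, i ∉ S → treeLike A t S i → j ∈ S →
      (∀ x ∈ reach A t S i, x ≠ i → ∀ y ∈ S, ¬ A x y) → (∀ y ∈ S, A i y → y = j) →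
      m t i j = msg A θ f init t S i := by
  classical
  induction t with
  | zero => intro S i j _ _ _ _ _; exact h0 i j
  | succ t ih =>
    intro S i j hi ht hj hr hij
    rw [hs, msg]
    congr 2
    have hset : (Finset.univ.filter fun l => A l i ∧ l ≠ j) = nb A S i := by
      ext l
      simp only [Finset.mem_filter, Finset.mem_univ, true_and, mem_nb, Finset.mem_insert, not_or]
      constructor
      · rintro ⟨h1, h2⟩
        refine ⟨hsymm _ _ h1, ?_, fun hlS => h2 (hij l hlS (hsymm _ _ h1))⟩
        rintro rfl; exact hirr _ h1
      · rintro ⟨h1, h2, h3⟩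
        refine ⟨hsymm _ _ h1, ?_⟩
        rintro rfl; exact h3 hj
    refine Finset.sum_congr (by convert! hset) fun l hl => ?_
    have hli := (mem_nb.1 hl).2
    have hne : l ≠ i := fun h => hli (by simp [h])
    congr 2
    refine ih hli (ht.2 l hl) (Finset.mem_insert_self _ _) ?_ ?_
    · intro x hx hxl y hy hxy
      have hxi := reach_disjoint t hli x hx
      rcases Finset.mem_insert.1 hy with rfl | hyS
      -- An edge from x back to the root would make x a second neighbour of the root inside the
      -- subtree of l, against the disjointness of the subtrees.
      · have hxnb : x ∈ nb A S y := mem_nb.2 ⟨hsymm _ _ hxy, hxi⟩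
        exact Finset.disjoint_left.1 (ht.1 l hl x hxnb (Ne.symm hxl)) hx (self_mem_reach _ _ _)
      · refine hr x (reach_subset_reach_succ hl hx) ?_ y hyS hxy
        rintro rfl; exact hxi (Finset.mem_insert_self _ _)
    · intro y hy hly
      rcases Finset.mem_insert.1 hy with rfl | hyS
      · rfl
      · exact absurd hly (hr l (nb_subset_reach_succ hl) hne y hyS)

end Recursion

/-! ### Marginals of the Ising model on a tree. -/

section Posterior

/-- The spin of a label. -/
def spin (s : Bool) : ℝ := if s then 1 else -1

lemma spin_mul_self (s : Bool) : spin s * spin s = 1 := by cases s <;> norm_num [spin]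

lemma abs_spin (s : Bool) : |spin s| = 1 := by cases s <;> norm_num [spin]

variable {V : Type*} [Fintype V] [DecidableEq V] {A : V → V → Prop} {θ : ℝ}

/-- The uniform law on labels. -/
noncomputable def unif : V → Bool → ℝ := fun _ _ => 1 / 2

lemma sum_unif (x : V) : ∑ k, unif x k = 1 := by simp [unif]

/-- The interaction weight of the self-avoiding walk tree of depth `t` at `i`. -/
noncomputable def treeWeight (A : V → V → Prop) (β : ℝ) (f : V → ℝ) (ρ : V → Bool) :
    ℕ → Finset V → V → ℝ
  | 0, _, _ => 1
  | t + 1, S, i => Real.exp (f i * spin (ρ i)) * ∏ l ∈ nb A S i,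
      (Real.exp (β * (spin (ρ i) * spin (ρ l))) * treeWeight A β f ρ t (insert i S) l)

lemma treeWeight_congr {β : ℝ} {f : V → ℝ} {ρ ρ' : V → Bool} (t : ℕ) : ∀ {S : Finset V} {i : V},
    (∀ x ∈ reach A t S i, ρ x = ρ' x) → treeWeight A β f ρ t S i = treeWeight A β f ρ' t S i := by
  induction t with
  | zero => intro S i _; rfl
  | succ t ih =>
    intro S i h
    simp only [treeWeight]
    rw [h i (self_mem_reach _ _ _)]
    congr 1
    refine Finset.prod_congr rfl fun l hl => ?_
    rw [h l (nb_subset_reach_succ hl), ih fun x hx => h x (reach_subset_reach_succ hl hx)]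

/-- The average of `F` over the labels in `B`, the other labels being those of `σ`. -/
noncomputable def marg (B : Finset V) (F : (V → Bool) → ℝ) (σ : V → Bool) : ℝ :=
  ex unif fun τ => F (B.piecewise τ σ)

/-- Up to a factor independent of the spin, the likelihood factor of a neighbour is an exponential,
so the product over neighbours becomes a sum of inverse hyperbolic tangents. -/
lemma one_add_mul_eq_exp_artanh {x : ℝ} (hx : x ∈ Set.Ioo (-1) 1) (s : Bool) :
    1 + spin s * x = √(1 - x ^ 2) * Real.exp (spin s * Real.artanh x) := by
  have h1 : 0 < 1 + x := by linarith [hx.1]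
  have h2 : 0 < 1 - x := by linarith [hx.2]
  have e : 1 - x ^ 2 = (1 + x) * (1 - x) := by ring
  rw [e, Real.sqrt_mul h1.le]
  have hs1 := Real.sqrt_pos.2 h1
  have hs2 := Real.sqrt_pos.2 h2
  have e1 := Real.mul_self_sqrt h1.le
  have e2 := Real.mul_self_sqrt h2.le
  cases s
  · simp only [spin, Bool.false_eq_true, if_false, neg_one_mul, Real.exp_neg,
      Real.exp_artanh hx, Real.sqrt_div h1.le]
    field_simp
    nlinarith
  · simp only [spin, if_true, one_mul, Real.exp_artanh hx, Real.sqrt_div h1.le]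
    field_simp
    nlinarith

lemma exp_spin_mul (s : Bool) (x : ℝ) :
    Real.exp (spin s * x) = Real.cosh x * (1 + spin s * Real.tanh x) := by
  have hc := (Real.cosh_pos x).ne'
  have : Real.cosh x * (1 + spin s * Real.tanh x) = Real.cosh x + spin s * Real.sinh x := by
    rw [Real.tanh_eq_sinh_div_cosh]; field_simp
  rw [this]
  cases s
  · simp only [spin, Bool.false_eq_true, if_false, neg_one_mul]
    rw [← Real.cosh_sub_sinh]; ring
  · simp only [spin, if_true, one_mul]
    rw [← Real.cosh_add_sinh]

/-- Belief propagation computes the marginals of the Ising model on a tree. -/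
lemma exists_marg_treeWeight {β : ℝ} {f : V → ℝ} (hθ : θ = Real.tanh β) (σ : V → Bool) (t : ℕ) :
    ∀ {S : Finset V} {i : V}, i ∉ S → treeLike A t S i → ∃ c : ℝ, 0 < c ∧ ∀ s : Bool,
      marg (inner A t S i)
        (fun ρ => (if ρ i = s then 1 else 0) * treeWeight A β f ρ t S i) σ =
      c * (1 + spin s * msg A θ f (fun x => spin (σ x)) t S i) := by
  induction t with
  | zero =>
    intro S i _ _
    -- At depth 0 nothing is averaged, and the indicator of σ i = s is (1 + s σ i)/2 in terms of
    -- spins.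
    refine ⟨1 / 2, by norm_num, fun s => ?_⟩
    have hpw : ∀ τ, (inner A 0 S i).piecewise τ σ = σ := fun τ => by
      ext x; exact Finset.piecewise_eq_of_notMem _ _ _ (by simp [inner])
    simp only [marg, hpw, treeWeight, msg, mul_one]
    rw [ex_const sum_unif]
    cases s <;> cases h : σ i <;> norm_num [spin]
  | succ t ih =>
    intro S i hi ht
    have hIH := fun l (hl : l ∈ nb A S i) => ih (mem_nb.1 hl).2 (ht.2 l hl)
    choose! c hc hcs using hIH
    set T := fun l => msg A θ f (fun x => spin (σ x)) t (insert i S) l with hT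
    have hTb : ∀ l, |T l| ≤ 1 := fun l => abs_msg_le (fun i => (abs_spin _).le) _ _ _
    have hθ1 : |θ| < 1 := hθ ▸ abs_tanh_lt_one β
    have hθT : ∀ l, θ * T l ∈ Set.Ioo (-1 : ℝ) 1 := by
      intro l
      have : |θ * T l| < 1 := by
        rw [abs_mul]; nlinarith [hTb l, abs_nonneg θ, abs_nonneg (T l)]
      exact ⟨(abs_lt.1 this).1, (abs_lt.1 this).2⟩
    set B := inner A (t + 1) S i with hB
    have hBl : ∀ l ∈ nb A S i, ∀ x ∈ reach A t (insert i S) l,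
        (x ∈ B ↔ x ∈ inner A t (insert i S) l) := by
      intro l hl x hx
      rw [hB]
      simp only [inner, Finset.mem_insert, Finset.mem_biUnion]
      constructor
      · rintro (rfl | ⟨l', hl', hx'⟩)
        · exact absurd (Finset.mem_insert_self _ _) (reach_disjoint t (mem_nb.1 hl).2 _ hx)
        · by_cases hll : l = l'
          · rwa [hll]
          · exact absurd (inner_subset_reach t _ _ hx')
              (Finset.disjoint_left.1 (ht.1 l hl l' hl' hll) hx)
      · intro hx; exact Or.inr ⟨l, hl, hx⟩
    have hiB : i ∈ B := by rw [hB]; simp [inner]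
    -- The factor 1/2 is the probability that a uniform label equals s. Summing out the label of l
    -- gives 2 c_l cosh β (1 + sθT_l), whose spin-free part is the factor of l. The last cosh turns
    -- the exponential of the total field into 1 + s tanh.
    refine ⟨1 / 2 * (∏ l ∈ nb A S i, (2 * c l * Real.cosh β * √(1 - (θ * T l) ^ 2))) *
      Real.cosh (f i + cav A θ f (fun x => spin (σ x)) t S i), ?_, fun s => ?_⟩
    · refine mul_pos (mul_pos (by norm_num) (Finset.prod_pos fun l hl => ?_)) (Real.cosh_pos _)
      have h1 := hc l hl
      have h2 := Real.cosh_pos β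
      have h3 : 0 < √(1 - (θ * T l) ^ 2) := Real.sqrt_pos.2 (by nlinarith [(hθT l).1, (hθT l).2])
      positivity
    -- The factor of l is written with labels resampled only in its own subtree, so that different
    -- neighbours involve disjoint coordinates and their expectations multiply.
    · set g : V → (V → Bool) → ℝ := fun l τ =>
        Real.exp (β * (spin s * spin (((inner A t (insert i S) l).piecewise τ σ) l))) *
          treeWeight A β f ((inner A t (insert i S) l).piecewise τ σ) t (insert i S) l with hg
      have hpw : ∀ l ∈ nb A S i, ∀ τ, ∀ x ∈ reach A t (insert i S) l,
          B.piecewise τ σ x = (inner A t (insert i S) l).piecewise τ σ x := by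
        intro l hl τ x hx
        by_cases hxB : x ∈ B
        · have := (hBl l hl x hx).1 hxB
          simp [hxB, this]
        · have : x ∉ inner A t (insert i S) l := fun h => hxB ((hBl l hl x hx).2 h)
          simp [hxB, this]
      have hrew : marg B (fun ρ => (if ρ i = s then 1 else 0) * treeWeight A β f ρ (t + 1) S i) σ =
          ex unif (fun τ => (if τ i = s then Real.exp (f i * spin s) else 0) *
            ∏ l ∈ nb A S i, g l τ) := by
        simp only [marg]
        congr 1
        funext τ
        have hτ : B.piecewise τ σ i = τ i := by simp [hiB]
        rw [hτ]
        by_cases hs : τ i = s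
        · simp only [if_pos hs, one_mul, treeWeight]
          rw [hτ, hs]
          congr 1
          refine Finset.prod_congr rfl fun l hl => ?_
          rw [hg]
          simp only
          rw [hpw l hl τ l (self_mem_reach _ _ _), treeWeight_congr t (hpw l hl τ)]
        · simp [if_neg hs]
      have hdep : ∀ l ∈ nb A S i, DependsOn (g l) (↑(inner A t (insert i S) l) : Set V) := by
        intro l hl τ τ' h
        have : (inner A t (insert i S) l).piecewise τ σ = (inner A t (insert i S) l).piecewise τ' σ := by
          ext x
          by_cases hx : x ∈ inner A t (insert i S) l
          · simp [hx, h x hx]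
          · simp [hx]
        simp only [hg, this]
      have hinn : ∀ l ∈ nb A S i, i ∉ inner A t (insert i S) l := fun l hl h =>
        inner_disjoint t (mem_nb.1 hl).2 i h (Finset.mem_insert_self _ _)
      rw [hrew, ex_mul_of_disjoint sum_unif (A := {i})
        (B := ⋃ l ∈ nb A S i, (↑(inner A t (insert i S) l) : Set V)) _ (dependsOn_prod hdep),
        ex_prod_of_disjoint sum_unif hdep]
      · have hgl : ∀ l ∈ nb A S i, ex unif (g l) =
            (2 * c l * Real.cosh β * √(1 - (θ * T l) ^ 2)) *
              Real.exp (spin s * Real.artanh (θ * T l)) := by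
          intro l hl
          have h1 : g l = fun τ => ∑ s' : Bool, Real.exp (β * (spin s * spin s')) *
              ((if ((inner A t (insert i S) l).piecewise τ σ) l = s' then 1 else 0) *
                treeWeight A β f ((inner A t (insert i S) l).piecewise τ σ) t (insert i S) l) := by
            funext τ
            simp [hg, ite_mul]
          rw [h1, ex_sum]
          simp only [ex_const_mul]
          have h2 : ∀ s', ex unif (fun τ =>
              (if ((inner A t (insert i S) l).piecewise τ σ) l = s' then 1 else 0) *
                treeWeight A β f ((inner A t (insert i S) l).piecewise τ σ) t (insert i S) l) =
              c l * (1 + spin s' * T l) := fun s' => hcs l hl s'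
          simp only [h2, Fintype.sum_bool]
          have h3 := one_add_mul_eq_exp_artanh (hθT l) s
          rw [mul_assoc _ (√_), ← h3]
          have e1 := exp_spin_mul s β
          have e2 : Real.exp (β * (spin s * spin true)) = Real.cosh β * (1 + spin s * Real.tanh β) := by
            rw [← e1]; congr 1; simp [spin, mul_comm]
          have e3 : Real.exp (β * (spin s * spin false)) =
              Real.cosh β * (1 - spin s * Real.tanh β) := by
            have := exp_spin_mul s (-β)
            rw [Real.cosh_neg, Real.tanh_neg] at this
            rw [sub_eq_add_neg, ← mul_neg, ← this]; congr 1; simp [spin, mul_comm]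
          rw [e2, e3, ← hθ]
          simp only [spin, if_true, Bool.false_eq_true, if_false]
          ring
        rw [Finset.prod_congr rfl hgl, Finset.prod_mul_distrib, ← Real.exp_sum,
          ← Finset.mul_sum]
        have h4 : ex unif (fun τ : V → Bool => if τ i = s then Real.exp (f i * spin s) else 0) =
            1 / 2 * Real.exp (spin s * f i) := by
          rw [ex_coordinate sum_unif i (fun k => if k = s then Real.exp (f i * spin s) else 0)]
          simp [unif, mul_comm]
        rw [h4, msg_succ]
        have h5 := exp_spin_mul s (f i + cav A θ f (fun x => spin (σ x)) t S i)
        rw [mul_add, Real.exp_add] at h5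
        rw [mul_assoc _ (Real.cosh _), ← h5]
        simp only [cav, hT]
        ring
      · intro l hl l' hl' hne
        rw [Finset.disjoint_coe]
        exact Finset.disjoint_of_subset_left (inner_subset_reach t _ _)
          (Finset.disjoint_of_subset_right (inner_subset_reach t _ _) (ht.1 l hl l' hl' hne))
      · rw [Set.disjoint_singleton_left]
        simp only [Set.mem_iUnion, not_exists]
        exact fun l hl h => hinn l hl h
      · intro τ τ' h
        simp only [h i rfl]

end Posterior

/-! ### The tree weight as a product over vertices and edges. -/

section Edges

variable {V : Type*} [Fintype V] [DecidableEq V]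

/-- The edges outside of `S` with an endpoint in `B`. -/
noncomputable def edgesTouching (G : SimpleGraph V) (S B : Finset V) : Finset (Sym2 V) :=
  open Classical in
  Finset.univ.filter fun e => e ∈ G.edgeSet ∧ (∀ x ∈ e, x ∉ S) ∧ ∃ x ∈ e, x ∈ B

lemma mem_edgesTouching {G : SimpleGraph V} {S B : Finset V} {x y : V} :
    s(x, y) ∈ edgesTouching G S B ↔ G.Adj x y ∧ (x ∉ S ∧ y ∉ S) ∧ (x ∈ B ∨ y ∈ B) := by
  simp [edgesTouching]

/-- The product of the spins at the endpoints of a pair. -/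
def pairSpin (ρ : V → Bool) : Sym2 V → ℝ :=
  Sym2.lift ⟨fun x y => spin (ρ x) * spin (ρ y), fun _ _ => mul_comm _ _⟩

lemma pairSpin_mk (ρ : V → Bool) (x y : V) : pairSpin ρ s(x, y) = spin (ρ x) * spin (ρ y) := rfl

/-- The edges counted are those joining i to its neighbours and those counted in the subtrees. An
edge of a subtree has both ends reached there, so disjointness of the subtrees prevents double
counting. -/
lemma treeWeight_eq {G : SimpleGraph V} {β : ℝ} {f : V → ℝ} (ρ : V → Bool) (t : ℕ) :
    ∀ {S : Finset V} {i : V}, i ∉ S → treeLike G.Adj t S i →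
      treeWeight G.Adj β f ρ t S i =
        (∏ x ∈ inner G.Adj t S i, Real.exp (f x * spin (ρ x))) *
        ∏ e ∈ edgesTouching G S (inner G.Adj t S i), Real.exp (β * pairSpin ρ e) := by
  classical
  induction t with
  | zero =>
    intro S i _ _
    simp [treeWeight, inner, edgesTouching]
  | succ t ih =>
    intro S i hi ht
    have hdisj : ∀ l ∈ nb G.Adj S i, ∀ l' ∈ nb G.Adj S i, l ≠ l' →
        Disjoint (inner G.Adj t (insert i S) l) (inner G.Adj t (insert i S) l') :=
      fun l hl l' hl' hne => Finset.disjoint_of_subset_left (inner_subset_reach t _ _)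
          (Finset.disjoint_of_subset_right (inner_subset_reach t _ _) (ht.1 l hl l' hl' hne))
    have hinn : ∀ l ∈ nb G.Adj S i, i ∉ inner G.Adj t (insert i S) l := fun l hl h =>
        inner_disjoint t (mem_nb.1 hl).2 i h (Finset.mem_insert_self _ _)
    have hE : edgesTouching G S (inner G.Adj (t + 1) S i) =
        ((nb G.Adj S i).image fun l => s(i, l)) ∪ (nb G.Adj S i).biUnion fun l =>
          edgesTouching G (insert i S) (inner G.Adj t (insert i S) l) := by
      ext e
      induction e using Sym2.ind with
      | _ x y =>
      simp only [Finset.mem_union, Finset.mem_image, Finset.mem_biUnion, mem_edgesTouching, inner,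
        Finset.mem_insert, not_or]
      constructor
      · rintro ⟨h1, ⟨hx, hy⟩, h3⟩
        by_cases hxi : x = i
        · subst hxi
          exact Or.inl ⟨y, mem_nb.2 ⟨h1, by simp [hy, h1.ne']⟩, rfl⟩
        by_cases hyi : y = i
        · subst hyi
          exact Or.inl ⟨x, mem_nb.2 ⟨h1.symm, by simp [hx, hxi]⟩, Sym2.eq_swap⟩
        · right
          simp only [hxi, hyi, false_or] at h3
          rcases h3 with ⟨l, hl, h⟩ | ⟨l, hl, h⟩
          · exact ⟨l, hl, h1, ⟨⟨hxi, hx⟩, ⟨hyi, hy⟩⟩, Or.inl h⟩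
          · exact ⟨l, hl, h1, ⟨⟨hxi, hx⟩, ⟨hyi, hy⟩⟩, Or.inr h⟩
      · rintro (⟨l, hl, h⟩ | ⟨l, hl, h1, ⟨⟨hxi, hx⟩, ⟨hyi, hy⟩⟩, h⟩)
        · have hl' := mem_nb.1 hl
          simp only [Finset.mem_insert, not_or] at hl'
          rw [Sym2.eq_iff] at h
          rcases h with ⟨rfl, rfl⟩ | ⟨rfl, rfl⟩
          · exact ⟨hl'.1, ⟨hi, hl'.2.2⟩, Or.inl (Or.inl rfl)⟩
          · exact ⟨hl'.1.symm, ⟨hl'.2.2, hi⟩, Or.inr (Or.inl rfl)⟩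
        · refine ⟨h1, ⟨hx, hy⟩, ?_⟩
          rcases h with h | h
          · exact Or.inl (Or.inr ⟨l, hl, h⟩)
          · exact Or.inr (Or.inr ⟨l, hl, h⟩)
    have hED : Disjoint ((nb G.Adj S i).image fun l => s(i, l)) ((nb G.Adj S i).biUnion fun l =>
          edgesTouching G (insert i S) (inner G.Adj t (insert i S) l)) := by
      rw [Finset.disjoint_left]
      intro e he he'
      simp only [Finset.mem_image, Finset.mem_biUnion] at he he'
      obtain ⟨l, hl, rfl⟩ := he
      obtain ⟨l', hl', h⟩ := he'
      rw [mem_edgesTouching] at h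
      exact h.2.1.1 (Finset.mem_insert_self _ _)
    have hEE : Set.PairwiseDisjoint (↑(nb G.Adj S i) : Set V)
        fun l => edgesTouching G (insert i S) (inner G.Adj t (insert i S) l) := by
      intro l hl l' hl' hne
      rw [Function.onFun, Finset.disjoint_left]
      intro e he he'
      induction e using Sym2.ind with
      | _ x y =>
      rw [mem_edgesTouching] at he he'
      have hd := ht.1 l hl l' hl' hne
      obtain ⟨h1, ⟨hx, hy⟩, h3⟩ := he
      obtain ⟨_, _, h3'⟩ := he'
      have key : ∀ {l x y}, x ∈ inner G.Adj t (insert i S) l → G.Adj x y → y ∉ insert i S →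
          x ∈ reach G.Adj t (insert i S) l ∧ y ∈ reach G.Adj t (insert i S) l :=
        fun hx hxy hy => ⟨inner_subset_reach t _ _ hx, mem_reach_of_adj_inner t hx hxy hy⟩
      have k1 : x ∈ reach G.Adj t (insert i S) l := by
        rcases h3 with h | h
        · exact (key h h1 hy).1
        · exact (key h h1.symm hx).2
      have k2 : x ∈ reach G.Adj t (insert i S) l' := by
        rcases h3' with h | h
        · exact (key h h1 hy).1
        · exact (key h h1.symm hx).2
      exact Finset.disjoint_left.1 hd k1 k2
    rw [hE, Finset.prod_union hED, Finset.prod_biUnion hEE, Finset.prod_image]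
    · simp only [inner]
      rw [Finset.prod_insert, Finset.prod_biUnion]
      · simp only [treeWeight, Finset.prod_mul_distrib, pairSpin_mk]
        rw [Finset.prod_congr rfl fun l hl => ih (mem_nb.1 hl).2 (ht.2 l hl),
          Finset.prod_mul_distrib]
        ring
      · exact fun l hl l' hl' hne => hdisj l hl l' hl' hne
      · simp only [Finset.mem_biUnion, not_exists, not_and]
        exact hinn
    · intro l _ l' _ h
      exact Sym2.congr_right.1 h

end Edges

/-! ### The block model on independent sites, and the probability that balls meet or fail to be
trees. -/

section Model

/-- The sites carrying independent randomness: vertices and (ordered) pairs of vertices. -/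
abbrev Site (n : ℕ) : Type := Fin n ⊕ (Fin n × Fin n)

/-- A vertex site carries the label and the correctness of the noisy label, a pair site carries
the presence of the edge if the labels agree and if they differ. -/
abbrev Conf (n : ℕ) : Type := Site n → Bool × Bool

/-- The Bernoulli weights. -/
def bern (p : ℝ) (k : Bool) : ℝ := if k then p else 1 - p

/-- The law of the sites. -/
noncomputable def law (n : ℕ) (α p q : ℝ) : Site n → Bool × Bool → ℝ
  | .inl _, k => 1 / 2 * bern (1 - α) k.2
  | .inr _, k => bern p k.1 * bern q k.2

/-- The parameters of the law are probabilities. -/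
structure ValidParams (α p q : ℝ) : Prop where
  α0 : 0 ≤ α
  α1 : α ≤ 1
  p0 : 0 ≤ p
  p1 : p ≤ 1
  q0 : 0 ≤ q
  q1 : q ≤ 1

variable {n : ℕ} {α p q : ℝ}

lemma law_nonneg (hv : ValidParams α p q) (x : Site n) (k : Bool × Bool) : 0 ≤ law n α p q x k := by
  obtain ⟨h1, h2, h3, h4, h5, h6⟩ := hv
  rcases x with x | x <;> rcases k with ⟨k1, k2⟩ <;> cases k1 <;> cases k2 <;>
    simp only [law, bern, if_true, Bool.false_eq_true, if_false] <;> nlinarith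

lemma law_sum (x : Site n) : ∑ k, law n α p q x k = 1 := by
  rcases x with x | x <;>
    simp only [law, bern, Fintype.sum_prod_type, Fintype.sum_bool, if_true, Bool.false_eq_true,
      if_false] <;> ring

/-- The site of a pair of vertices. -/
def pairSite (x y : Fin n) : Site n := .inr (min x y, max x y)

lemma pairSite_comm (x y : Fin n) : pairSite x y = pairSite y x := by
  simp [pairSite, min_comm, max_comm]

lemma pairSite_injective {x y z : Fin n} (h : pairSite x y = pairSite x z) : y = z := by
  simp only [pairSite, Sum.inr.injEq, Prod.mk.injEq] at h
  obtain ⟨h1, h2⟩ := h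
  rcases le_total x y with hy | hy <;> rcases le_total x z with hz | hz <;>
    simp only [min_eq_left, min_eq_right, max_eq_left, max_eq_right, hy, hz] at h1 h2
  · exact h2
  · rw [h2, ← h1]
  · rw [h1, h2]
  · exact h1

/-- The sites of vertices and pairs that avoid `S`. -/
def offSites (S : Finset (Fin n)) : Set (Site n) :=
  {x | match x with
    | .inl x => x ∉ S
    | .inr e => e.1 ∉ S ∧ e.2 ∉ S}

/-- The sites of vertices and pairs that meet `X`. -/
def touchSites (X : Finset (Fin n)) : Set (Site n) :=
  {x | match x with
    | .inl x => x ∈ X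
    | .inr e => e.1 ∈ X ∨ e.2 ∈ X}

lemma pairSite_mem_offSites {S : Finset (Fin n)} {x y : Fin n} :
    pairSite x y ∈ offSites S ↔ x ∉ S ∧ y ∉ S := by
  have : pairSite x y ∈ offSites S ↔ min x y ∉ S ∧ max x y ∉ S := Iff.rfl
  rw [this]
  rcases le_total x y with h | h <;> simp [h, and_comm]

lemma pairSite_mem_touchSites {S : Finset (Fin n)} {x y : Fin n} :
    pairSite x y ∈ touchSites S ↔ x ∈ S ∨ y ∈ S := by
  have : pairSite x y ∈ touchSites S ↔ min x y ∈ S ∨ max x y ∈ S := Iff.rfl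
  rw [this]
  rcases le_total x y with h | h <;> simp [h, or_comm]

lemma touchSites_disjoint_offSites (X S : Finset (Fin n)) (h : X ⊆ S) :
    Disjoint (touchSites X) (offSites S) := by
  rw [Set.disjoint_left]
  rintro (x | e) hx hx'
  · exact hx' (h hx)
  · rcases hx with hx | hx
    · exact hx'.1 (h hx)
    · exact hx'.2 (h hx)

/-- The true label. -/
def lab (ω : Conf n) (x : Fin n) : Bool := (ω (.inl x)).1

/-- The correctness of the noisy label. -/
def ok (ω : Conf n) (x : Fin n) : Bool := (ω (.inl x)).2

/-- The noisy label. -/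
def noisy (ω : Conf n) (x : Fin n) : Bool := if ok ω x then lab ω x else !lab ω x

/-- The edge bit of a pair. -/
def edgeBit (ω : Conf n) (x y : Fin n) : Bool :=
  if lab ω x = lab ω y then (ω (pairSite x y)).1 else (ω (pairSite x y)).2

/-- The adjacency relation of the block model. -/
def adj (ω : Conf n) (x y : Fin n) : Prop := x ≠ y ∧ edgeBit ω x y = true

/-- A relation containing `adj` that does not depend on the labels. -/
def supAdj (ω : Conf n) (x y : Fin n) : Prop :=
  x ≠ y ∧ ((ω (pairSite x y)).1 = true ∨ (ω (pairSite x y)).2 = true)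

lemma adj_symm {ω : Conf n} {x y : Fin n} (h : adj ω x y) : adj ω y x := by
  refine ⟨h.1.symm, ?_⟩
  have := h.2
  simp only [edgeBit] at this ⊢
  rw [pairSite_comm y x]
  by_cases h2 : lab ω x = lab ω y
  · rw [if_pos h2.symm]; rwa [if_pos h2] at this
  · rw [if_neg (Ne.symm h2)]; rwa [if_neg h2] at this

lemma supAdj_of_adj {ω : Conf n} (x y : Fin n) (h : adj ω x y) : supAdj ω x y := by
  refine ⟨h.1, ?_⟩
  have := h.2
  simp only [edgeBit] at this
  split_ifs at this
  · exact Or.inl this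
  · exact Or.inr this

lemma supAdj_congr {ω ω' : Conf n} {x y : Fin n} (h : ω (pairSite x y) = ω' (pairSite x y)) :
    supAdj ω x y ↔ supAdj ω' x y := by
  simp [supAdj, h]

lemma adj_congr {ω ω' : Conf n} {x y : Fin n} (h : ω (pairSite x y) = ω' (pairSite x y))
    (hx : ω (.inl x) = ω' (.inl x)) (hy : ω (.inl y) = ω' (.inl y)) :
    adj ω x y ↔ adj ω' x y := by
  unfold adj edgeBit lab
  rw [h, hx, hy]

lemma dependsOn_supAdj (x y : Fin n) :
    DependsOn (fun ω : Conf n => supAdj ω x y) {pairSite x y} := fun _ _ h =>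
  propext (supAdj_congr (h _ rfl))

lemma pr_supAdj_le (hv : ValidParams α p q) (x y : Fin n) :
    pr (law n α p q) (fun ω => supAdj ω x y) ≤ p + q := by
  classical
  have h1 : pr (law n α p q) (fun ω => supAdj ω x y) ≤
      ex (law n α p q) (fun ω => (if (ω (pairSite x y)).1 = true ∨ (ω (pairSite x y)).2 = true
        then (1 : ℝ) else 0)) := by
    refine ex_mono (law_nonneg hv) fun ω => ?_
    by_cases h : supAdj ω x y
    · simp [h, h.2]
    · simp only [h, if_false]; split_ifs <;> norm_num
  refine h1.trans ?_
  rw [ex_coordinate law_sum (pairSite x y)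
    (fun k : Bool × Bool => if k.1 = true ∨ k.2 = true then (1 : ℝ) else 0)]
  simp only [pairSite, law, bern, Fintype.sum_prod_type, Fintype.sum_bool]
  norm_num
  nlinarith [hv.p0, hv.q0]

/-- An exploration that avoids S inspects no pair meeting S. It is therefore independent of the edge
that led to its starting point, which is the source of all the recursive bounds below. -/
lemma dependsOn_reach {S : Finset (Fin n)} {i : Fin n} (hi : i ∉ S) (t : ℕ) :
    DependsOn (fun ω : Conf n => reach (supAdj ω) t S i) (offSites S) := by
  intro ω ω' h
  refine ((reach_local (θ := 0) (f := 0) (f' := 0) (init := 0) (init' := 0) t (X := Sᶜ) (Y := Sᶜ)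
    ?_ ?_ ?_ (fun _ _ => rfl) (fun _ _ => rfl)).1).symm
  · exact fun x hx => Finset.mem_compl.2 (reach_disjoint t hi x hx)
  · exact fun x hx => Finset.mem_compl.2 (inner_disjoint t hi x hx)
  · exact fun x hx y hy =>
      supAdj_congr (h _ (pairSite_mem_offSites.2 ⟨Finset.mem_compl.1 hx, hy⟩))

lemma dependsOn_treeLike {S : Finset (Fin n)} {i : Fin n} (hi : i ∉ S) (t : ℕ) :
    DependsOn (fun ω : Conf n => treeLike (supAdj ω) t S i) (offSites S) := by
  intro ω ω' h
  refine propext (treeLike_local t (X := Sᶜ) ?_ ?_)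
  · exact fun x hx => Finset.mem_compl.2 (reach_disjoint t hi x hx)
  · exact fun x hx y hy =>
      supAdj_congr (h _ (pairSite_mem_offSites.2 ⟨Finset.mem_compl.1 hx, hy⟩))

lemma reach_congr {S : Finset (Fin n)} {i : Fin n} (hi : i ∉ S) (t : ℕ) {ω ω' : Conf n}
    (h : ∀ x ∈ offSites S, ω x = ω' x) :
    reach (supAdj ω) t S i = reach (supAdj ω') t S i := dependsOn_reach hi t h

lemma treeLike_congr {S : Finset (Fin n)} {i : Fin n} (hi : i ∉ S) (t : ℕ) {ω ω' : Conf n}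
    (h : ∀ x ∈ offSites S, ω x = ω' x) :
    treeLike (supAdj ω) t S i = treeLike (supAdj ω') t S i := dependsOn_treeLike hi t h

lemma pairSite_singleton_disjoint (S : Finset (Fin n)) (i l : Fin n) :
    Disjoint ({pairSite i l} : Set (Site n)) (offSites (insert i S)) := by
  rw [Set.disjoint_singleton_left, pairSite_mem_offSites]
  simp

/-- A bound for the probability that a vertex is reached. -/
def reachBd (n : ℕ) (r : ℝ) : ℕ → ℝ
  | 0 => 0
  | t + 1 => r + n * r * reachBd n r t

lemma reachBd_nonneg {r : ℝ} (hr : 0 ≤ r) (t : ℕ) : 0 ≤ reachBd n r t := by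
  induction t with
  | zero => simp [reachBd]
  | succ t ih => simp only [reachBd]; positivity

/-- Decomposition by the first step i → l: either l = x, or the edge is present and, independently,
x is reached from l avoiding i. -/
lemma pr_mem_reach_le (hv : ValidParams α p q) (t : ℕ) : ∀ {S : Finset (Fin n)} {i x : Fin n},
    x ≠ i → pr (law n α p q) (fun ω => x ∈ reach (supAdj ω) t S i) ≤ reachBd n (p + q) t := by
  have hr : 0 ≤ p + q := add_nonneg hv.p0 hv.q0
  have hnn := law_nonneg (n := n) hv
  induction t with
  | zero =>
    intro S i x hx
    simp [reach, hx, pr, reachBd, ex]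
  | succ t ih =>
    intro S i x hx
    have h1 : pr (law n α p q) (fun ω => x ∈ reach (supAdj ω) (t + 1) S i) ≤
        pr (law n α p q) (fun ω => ∃ l ∈ (insert i S)ᶜ, supAdj ω i l ∧
          x ∈ reach (supAdj ω) t (insert i S) l) := by
      refine pr_mono hnn fun ω h => ?_
      simp only [reach, Finset.mem_insert, hx, false_or, Finset.mem_biUnion] at h
      obtain ⟨l, hl, h⟩ := h
      exact ⟨l, Finset.mem_compl.2 (mem_nb.1 hl).2, (mem_nb.1 hl).1, h⟩
    refine h1.trans ((pr_exists_le hnn _ _).trans ?_)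
    have h2 : ∀ l ∈ (insert i S)ᶜ, pr (law n α p q) (fun ω => supAdj ω i l ∧
          x ∈ reach (supAdj ω) t (insert i S) l) ≤
        (if l = x then p + q else 0) + (p + q) * reachBd n (p + q) t := by
      intro l hl
      have hl := Finset.mem_compl.1 hl
      have hb := reachBd_nonneg (n := n) hr t
      split_ifs with hlx
      · have h3 : pr (law n α p q) (fun ω => supAdj ω i l ∧
          x ∈ reach (supAdj ω) t (insert i S) l) ≤ pr (law n α p q) (fun ω => supAdj ω i l) :=
          pr_mono hnn fun ω h => h.1
        have h4 := pr_supAdj_le (n := n) hv i l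
        have := mul_nonneg hr hb
        linarith
      · rw [pr_and_of_disjoint law_sum (dependsOn_supAdj i l)
          (fun ω ω' h => by rw [reach_congr hl t h]) (pairSite_singleton_disjoint S i l), zero_add]
        exact mul_le_mul (pr_supAdj_le hv i l) (ih (Ne.symm hlx)) (pr_nonneg hnn _) hr
    refine (Finset.sum_le_sum h2).trans ?_
    have hb := mul_nonneg hr (reachBd_nonneg (n := n) hr t)
    refine (Finset.sum_le_sum_of_subset_of_nonneg (Finset.subset_univ _) fun l _ _ => ?_).trans ?_
    · split_ifs <;> linarith
    · rw [Finset.sum_add_distrib]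
      simp [reachBd, mul_assoc]

/-- A bound for the probability that two neighbourhoods meet. -/
def meetBd (n : ℕ) (r : ℝ) (t' : ℕ) : ℕ → ℝ
  | 0 => reachBd n r t'
  | t + 1 => reachBd n r t' + r + n * r * meetBd n r t' t

lemma meetBd_nonneg {r : ℝ} (hr : 0 ≤ r) (t' t : ℕ) : 0 ≤ meetBd n r t' t := by
  have := reachBd_nonneg (n := n) hr t'
  induction t with
  | zero => simpa [meetBd]
  | succ t ih => simp only [meetBd]; positivity

/-- Either l itself lies in the other neighbourhood, or the two meet after a first step l → k. In
the second case l may be excluded from the other exploration too without changing it, and the edge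
from l to k becomes independent of both. -/
lemma pr_reach_meet_le (hv : ValidParams α p q) (t' t : ℕ) : ∀ {S : Finset (Fin n)} {l l' : Fin n},
    l ≠ l' → l ∉ S → l' ∉ S → pr (law n α p q) (fun ω =>
      ¬ Disjoint (reach (supAdj ω) t S l) (reach (supAdj ω) t' S l')) ≤ meetBd n (p + q) t' t := by
  have hr : 0 ≤ p + q := add_nonneg hv.p0 hv.q0
  have hnn := law_nonneg (n := n) hv
  induction t with
  | zero =>
    intro S l l' hll _ _
    simp only [reach, Finset.disjoint_singleton_left, not_not, meetBd]
    exact pr_mem_reach_le hv t' hll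
  | succ t ih =>
    intro S l l' hll hl hl'
    have hl'' : l' ∉ insert l S := by simp [hl', hll.symm]
    have h1 : pr (law n α p q) (fun ω =>
        ¬ Disjoint (reach (supAdj ω) (t + 1) S l) (reach (supAdj ω) t' S l')) ≤
        pr (law n α p q) (fun ω => l ∈ reach (supAdj ω) t' S l' ∨ ∃ k ∈ (insert l S)ᶜ,
          supAdj ω l k ∧ ¬ Disjoint (reach (supAdj ω) t (insert l S) k)
            (reach (supAdj ω) t' (insert l S) l')) := by
      refine pr_mono hnn fun ω h => ?_
      by_cases hmem : l ∈ reach (supAdj ω) t' S l'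
      · exact Or.inl hmem
      right
      have he : reach (supAdj ω) t' (insert l S) l' = reach (supAdj ω) t' S l' := by
        have := (reach_union (A := supAdj ω) (θ := 0) (f := 0) (init := 0) t' (S := S) (B := {l})
          (i := l') (by simpa using hmem)).1
        rwa [Finset.union_singleton] at this
      rw [Finset.not_disjoint_iff] at h
      obtain ⟨x, hx, hx'⟩ := h
      simp only [reach, Finset.mem_insert, Finset.mem_biUnion] at hx
      rcases hx with rfl | ⟨k, hk, hx⟩
      · exact absurd hx' hmem
      · refine ⟨k, Finset.mem_compl.2 (mem_nb.1 hk).2, (mem_nb.1 hk).1, ?_⟩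
        rw [he, Finset.not_disjoint_iff]
        exact ⟨x, hx, hx'⟩
    refine h1.trans ((pr_or_le hnn _ _).trans ?_)
    have h0 := pr_mem_reach_le (n := n) hv t' (S := S) hll
    have hb := meetBd_nonneg (n := n) hr t' t
    have h2 : ∀ k ∈ (insert l S)ᶜ, pr (law n α p q) (fun ω => supAdj ω l k ∧
          ¬ Disjoint (reach (supAdj ω) t (insert l S) k)
            (reach (supAdj ω) t' (insert l S) l')) ≤
        (if k = l' then p + q else 0) + (p + q) * meetBd n (p + q) t' t := by
      intro k hk
      have hk := Finset.mem_compl.1 hk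
      split_ifs with hlx
      · have h3 : pr (law n α p q) (fun ω => supAdj ω l k ∧
          ¬ Disjoint (reach (supAdj ω) t (insert l S) k)
            (reach (supAdj ω) t' (insert l S) l')) ≤ pr (law n α p q) (fun ω => supAdj ω l k) :=
          pr_mono hnn fun ω h => h.1
        have h4 := pr_supAdj_le (n := n) hv l k
        have := mul_nonneg hr hb
        linarith
      · rw [pr_and_of_disjoint law_sum (dependsOn_supAdj l k)
          (fun ω ω' h => by rw [reach_congr hk t h, reach_congr hl'' t' h])
          (pairSite_singleton_disjoint S l k), zero_add]
        exact mul_le_mul (pr_supAdj_le hv l k) (ih hlx hk hl'') (pr_nonneg hnn _) hr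
    have h5 := (pr_exists_le hnn (insert l S)ᶜ (fun k ω => supAdj ω l k ∧
          ¬ Disjoint (reach (supAdj ω) t (insert l S) k)
            (reach (supAdj ω) t' (insert l S) l'))).trans (Finset.sum_le_sum h2)
    have hb' := mul_nonneg hr hb
    have h6 : ∑ k ∈ (insert l S)ᶜ, ((if k = l' then p + q else 0) +
        (p + q) * meetBd n (p + q) t' t) ≤ (p + q) + n * (p + q) * meetBd n (p + q) t' t := by
      refine (Finset.sum_le_sum_of_subset_of_nonneg (Finset.subset_univ _) fun l _ _ => ?_).trans ?_
      · split_ifs <;> linarith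
      · rw [Finset.sum_add_distrib]
        simp [mul_assoc]
    simp only [meetBd]
    linarith

/-- A bound for the probability that a neighbourhood is not a tree. -/
def treeBd (n : ℕ) (r : ℝ) : ℕ → ℝ
  | 0 => 0
  | t + 1 => (n * r) ^ 2 * meetBd n r t t + n * r * treeBd n r t

/-- Union bound over pairs of neighbours of i whose explorations meet, and over neighbours at which
the tree property fails. The edges at i are independent of explorations avoiding i. -/
lemma pr_not_treeLike_le (hv : ValidParams α p q) (t : ℕ) : ∀ {S : Finset (Fin n)} {i : Fin n},
    pr (law n α p q) (fun ω => ¬ treeLike (supAdj ω) t S i) ≤ treeBd n (p + q) t := by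
  have hr : 0 ≤ p + q := add_nonneg hv.p0 hv.q0
  have hnn := law_nonneg (n := n) hv
  induction t with
  | zero => intro S i; simp [treeLike, pr, ex, treeBd]
  | succ t ih =>
    intro S i
    have hb := meetBd_nonneg (n := n) hr t t
    set M := meetBd n (p + q) t t with hM
    have h1 : pr (law n α p q) (fun ω => ¬ treeLike (supAdj ω) (t + 1) S i) ≤
        pr (law n α p q) (fun ω => (∃ l ∈ (insert i S)ᶜ, ∃ l' ∈ (insert i S)ᶜ, l ≠ l' ∧
          supAdj ω i l ∧ supAdj ω i l' ∧ ¬ Disjoint (reach (supAdj ω) t (insert i S) l)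
            (reach (supAdj ω) t (insert i S) l')) ∨
          ∃ l ∈ (insert i S)ᶜ, supAdj ω i l ∧ ¬ treeLike (supAdj ω) t (insert i S) l) := by
      refine pr_mono hnn fun ω h => ?_
      simp only [treeLike, not_and_or, not_forall] at h
      rcases h with ⟨l, hl, l', hl', hne, h⟩ | ⟨l, hl, h⟩
      · exact Or.inl ⟨l, Finset.mem_compl.2 (mem_nb.1 hl).2, l', Finset.mem_compl.2 (mem_nb.1 hl').2,
          hne, (mem_nb.1 hl).1, (mem_nb.1 hl').1, h⟩
      · exact Or.inr ⟨l, Finset.mem_compl.2 (mem_nb.1 hl).2, (mem_nb.1 hl).1, h⟩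
    refine h1.trans ((pr_or_le hnn _ _).trans ?_)
    have hcard : ∀ c : ℝ, 0 ≤ c → ∀ f : Fin n → ℝ, (∀ l ∈ (insert i S)ᶜ, f l ≤ c) →
        ∑ l ∈ (insert i S)ᶜ, f l ≤ n * c := by
      intro c hc f hf
      refine (Finset.sum_le_sum hf).trans ?_
      rw [Finset.sum_const, nsmul_eq_mul]
      refine mul_le_mul_of_nonneg_right ?_ hc
      exact_mod_cast (Finset.card_le_univ _).trans (by simp)
    have hA : pr (law n α p q) (fun ω => ∃ l ∈ (insert i S)ᶜ, ∃ l' ∈ (insert i S)ᶜ, l ≠ l' ∧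
          supAdj ω i l ∧ supAdj ω i l' ∧ ¬ Disjoint (reach (supAdj ω) t (insert i S) l)
            (reach (supAdj ω) t (insert i S) l')) ≤ n * (n * ((p + q) * ((p + q) * M))) := by
      refine (pr_exists_le hnn _ _).trans (hcard _ (by positivity) _ fun l hl => ?_)
      refine (pr_exists_le hnn _ _).trans (hcard _ (by positivity) _ fun l' hl' => ?_)
      rw [Finset.mem_compl] at hl hl'
      by_cases hne : l = l'
      · have : pr (law n α p q) (fun ω => l ≠ l' ∧ supAdj ω i l ∧ supAdj ω i l' ∧
          ¬ Disjoint (reach (supAdj ω) t (insert i S) l) (reach (supAdj ω) t (insert i S) l')) = 0 := by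
          simp [hne, pr, ex]
        rw [this]; positivity
      · have h2 : pr (law n α p q) (fun ω => l ≠ l' ∧ supAdj ω i l ∧ supAdj ω i l' ∧
          ¬ Disjoint (reach (supAdj ω) t (insert i S) l) (reach (supAdj ω) t (insert i S) l')) ≤
          pr (law n α p q) (fun ω => supAdj ω i l ∧ (supAdj ω i l' ∧
          ¬ Disjoint (reach (supAdj ω) t (insert i S) l) (reach (supAdj ω) t (insert i S) l'))) :=
          pr_mono hnn fun ω h => h.2
        refine h2.trans ?_
        have hd : DependsOn (fun ω : Conf n => ¬ Disjoint (reach (supAdj ω) t (insert i S) l)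
            (reach (supAdj ω) t (insert i S) l')) (offSites (insert i S)) := fun ω ω' h => by
          simp only [reach_congr hl t h, reach_congr hl' t h]
        rw [pr_and_of_disjoint law_sum (dependsOn_supAdj i l) (B := {pairSite i l'} ∪
          offSites (insert i S)), pr_and_of_disjoint law_sum (dependsOn_supAdj i l') hd
          (pairSite_singleton_disjoint S i l')]
        · exact mul_le_mul (pr_supAdj_le hv i l) (mul_le_mul (pr_supAdj_le hv i l')
            (pr_reach_meet_le hv t t hne hl hl') (pr_nonneg hnn _) hr)
            (mul_nonneg (pr_nonneg hnn _) (pr_nonneg hnn _)) hr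
        · intro ω ω' h
          have e1 := dependsOn_supAdj i l' (fun x hx => h x (Or.inl hx))
          have e2 := hd (fun x hx => h x (Or.inr hx))
          simp only at e1 e2
          simp only [e1, e2]
        · rw [Set.disjoint_union_right]
          refine ⟨?_, pairSite_singleton_disjoint S i l⟩
          rw [Set.disjoint_singleton]
          exact fun h => hne (pairSite_injective h)
    have hB : pr (law n α p q) (fun ω => ∃ l ∈ (insert i S)ᶜ, supAdj ω i l ∧
        ¬ treeLike (supAdj ω) t (insert i S) l) ≤ n * ((p + q) * treeBd n (p + q) t) := by
      refine (pr_exists_le hnn _ _).trans (hcard _ ?_ _ fun l hl => ?_)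
      · exact mul_nonneg hr ((pr_nonneg hnn _).trans (ih (S := S) (i := i)))
      rw [Finset.mem_compl] at hl
      rw [pr_and_of_disjoint law_sum (dependsOn_supAdj i l)
          (fun ω ω' h => by rw [treeLike_congr hl t h]) (pairSite_singleton_disjoint S i l)]
      exact mul_le_mul (pr_supAdj_le hv i l) ih (pr_nonneg hnn _) hr
    simp only [treeBd]
    rw [← hM]
    refine (add_le_add hA hB).trans (le_of_eq ?_)
    ring

lemma ex_card_reach_le (hv : ValidParams α p q) (t : ℕ) (S : Finset (Fin n)) (i : Fin n) :
    ex (law n α p q) (fun ω => ((reach (supAdj ω) t S i).card : ℝ)) ≤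
      1 + n * reachBd n (p + q) t := by
  classical
  have hr : 0 ≤ p + q := add_nonneg hv.p0 hv.q0
  have hnn := law_nonneg (n := n) hv
  have h1 : (fun ω : Conf n => ((reach (supAdj ω) t S i).card : ℝ)) =
      fun ω => ∑ x, if x ∈ reach (supAdj ω) t S i then (1 : ℝ) else 0 := by
    funext ω; simp
  rw [h1, ex_sum]
  have h2 : ∀ x, ex (law n α p q) (fun ω => if x ∈ reach (supAdj ω) t S i then (1 : ℝ) else 0) ≤
      (if x = i then 1 else 0) + reachBd n (p + q) t := by
    intro x
    have hb := reachBd_nonneg (n := n) hr t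
    have e : ex (law n α p q) (fun ω => if x ∈ reach (supAdj ω) t S i then (1 : ℝ) else 0) =
        pr (law n α p q) (fun ω => x ∈ reach (supAdj ω) t S i) := by
      rw [pr]; congr 1; funext ω; congr
    rw [e]
    split_ifs with hx
    · have := pr_le_one hnn law_sum (fun ω => x ∈ reach (supAdj ω) t S i)
      linarith
    · rw [zero_add]; exact pr_mem_reach_le hv t hx
  refine (Finset.sum_le_sum fun x _ => h2 x).trans ?_
  rw [Finset.sum_add_distrib]
  simp

end Model

/-! ### Messages on the block model: decorrelation and the global flip symmetry. -/

section Decoupling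

variable {n : ℕ} {α p q γ θ : ℝ} {κ : Bool → Bool → ℝ}

/-- The messages of the self-avoiding recursion on the block model, with initial messages given
by `κ`. -/
noncomputable def bmsg (γ θ : ℝ) (κ : Bool → Bool → ℝ) (ω : Conf n) (t : ℕ) (S : Finset (Fin n))
    (i : Fin n) : ℝ :=
  msg (adj ω) θ (fun x => γ * spin (noisy ω x)) (fun x => κ (lab ω x) (ok ω x)) t S i

/-- The sums of messages of the self-avoiding recursion on the block model. -/
noncomputable def bcav (γ θ : ℝ) (κ : Bool → Bool → ℝ) (ω : Conf n) (t : ℕ) (S : Finset (Fin n))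
    (i : Fin n) : ℝ :=
  cav (adj ω) θ (fun x => γ * spin (noisy ω x)) (fun x => κ (lab ω x) (ok ω x)) t S i

lemma bmsg_succ (ω : Conf n) (t : ℕ) (S : Finset (Fin n)) (i : Fin n) :
    bmsg γ θ κ ω (t + 1) S i = Real.tanh (γ * spin (noisy ω i) + bcav γ θ κ ω t S i) := rfl

lemma bcav_eq (ω : Conf n) (t : ℕ) (S : Finset (Fin n)) (i : Fin n) :
    bcav γ θ κ ω t S i =
      ∑ l ∈ nb (adj ω) S i, Real.artanh (θ * bmsg γ θ κ ω t (insert i S) l) := rfl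

lemma noisy_congr {ω ω' : Conf n} {x : Fin n} (h : ω (.inl x) = ω' (.inl x)) :
    noisy ω x = noisy ω' x := by
  unfold noisy ok lab; rw [h]

lemma lab_congr {ω ω' : Conf n} {x : Fin n} (h : ω (.inl x) = ω' (.inl x)) :
    lab ω x = lab ω' x := by
  unfold lab; rw [h]

lemma ok_congr {ω ω' : Conf n} {x : Fin n} (h : ω (.inl x) = ω' (.inl x)) :
    ok ω x = ok ω' x := by
  unfold ok; rw [h]

lemma bmsg_congr {S : Finset (Fin n)} {i : Fin n} (hi : i ∉ S) (t : ℕ) {ω ω' : Conf n}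
    (h : ∀ x ∈ offSites S, ω x = ω' x) : bmsg γ θ κ ω t S i = bmsg γ θ κ ω' t S i := by
  refine (reach_local t (X := Sᶜ) (Y := Sᶜ) ?_ ?_ ?_ ?_ ?_).2.symm
  · exact fun x hx => Finset.mem_compl.2 (reach_disjoint t hi x hx)
  · exact fun x hx => Finset.mem_compl.2 (inner_disjoint t hi x hx)
  · exact fun x hx y hy => adj_congr (h _ (pairSite_mem_offSites.2 ⟨Finset.mem_compl.1 hx, hy⟩))
      (h _ (Finset.mem_compl.1 hx)) (h _ hy)
  · intro x hx; rw [noisy_congr (h _ (Finset.mem_compl.1 hx))]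
  · intro x hx
    rw [lab_congr (h _ (Finset.mem_compl.1 hx)), ok_congr (h _ (Finset.mem_compl.1 hx))]

lemma abs_bmsg_le (hκ : ∀ s e, |κ s e| ≤ 1) (ω : Conf n) (t : ℕ) (S : Finset (Fin n))
    (i : Fin n) : |bmsg γ θ κ ω t S i| ≤ 1 := abs_msg_le (fun _ => hκ _ _) _ _ _

/-- Two configurations that agree near the neighbourhood of `i` have the same neighbourhood and
the same message at `i`. -/
lemma local_congr {S X : Finset (Fin n)} {i : Fin n} (t : ℕ) {ω ω' : Conf n}
    (hX : reach (supAdj ω) t S i = X) (h : ∀ x ∈ touchSites X, ω x = ω' x) :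
    reach (supAdj ω') t S i = X ∧ bmsg γ θ κ ω t S i = bmsg γ θ κ ω' t S i := by
  have hinner := inner_subset_reach (A := supAdj ω) t S i
  constructor
  · rw [← hX]
    refine (reach_local (θ := 0) (f := 0) (f' := 0) (init := 0) (init' := 0) t (X := X) (Y := X)
      hX.le (hinner.trans hX.le) ?_ (fun _ _ => rfl) (fun _ _ => rfl)).1
    exact fun x hx y _ => supAdj_congr (h _ (pairSite_mem_touchSites.2 (Or.inl hx)))
  · refine (reach_local t (X := X) (Y := inner (supAdj ω) t S i)
      ((reach_mono supAdj_of_adj t S i).trans hX.le) (inner_mono supAdj_of_adj t S i)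
      ?_ ?_ ?_).2.symm
    · intro x hx y hy
      have hxX : x ∈ X := hX ▸ hinner hx
      have hp : ω (pairSite x y) = ω' (pairSite x y) :=
        h _ (pairSite_mem_touchSites.2 (Or.inl hxX))
      by_cases hxy : supAdj ω x y
      · have hyX : y ∈ X := hX ▸ mem_reach_of_adj_inner t hx hxy hy
        exact adj_congr hp (h _ hxX) (h _ hyX)
      · have hxy' : ¬ supAdj ω' x y := fun h' => hxy ((supAdj_congr hp).2 h')
        exact iff_of_false (fun h' => hxy (supAdj_of_adj _ _ h'))
          (fun h' => hxy' (supAdj_of_adj _ _ h'))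
    · intro x hx; rw [noisy_congr (h _ hx)]
    · intro x hx; rw [lab_congr (h _ hx), ok_congr (h _ hx)]

lemma abs_ex_sub_ex_le (hv : ValidParams α p q) {f g : Conf n → ℝ} {E : Conf n → Prop} {c : ℝ}
    (h : ∀ ω, ¬ E ω → f ω = g ω) (hc : ∀ ω, |f ω - g ω| ≤ c) :
    |ex (law n α p q) f - ex (law n α p q) g| ≤ c * pr (law n α p q) E := by
  classical
  rw [← ex_sub, pr, ← ex_const_mul]
  refine (abs_ex_le (law_nonneg hv) _).trans (ex_mono (law_nonneg hv) fun ω => ?_)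
  by_cases hE : E ω
  · simpa [hE] using hc ω
  · simp [hE, h ω hE]

/-- A bound for the covariance of functions of the messages at two vertices. -/
def covBd (n : ℕ) (r : ℝ) (t : ℕ) : ℝ :=
  2 * meetBd n r t t + (2 * reachBd n r t * (1 + n * reachBd n r t) + 2 * reachBd n r t)

/-- Decompose according to the set C reached from l. The event that this set is C, together with the
message at l, depends on sites meeting C. The message at l' computed outside C depends on sites
avoiding C, so the two factorize. Restoring the original message at l' costs only the probability
that its neighbourhood meets C, both inside the joint expectation and in the product. -/
lemma abs_cov_le (hv : ValidParams α p q) (hκ : ∀ s e, |κ s e| ≤ 1) {φ : Bool → ℝ → ℝ}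
    (hφ : ∀ s x, |x| ≤ 1 → |φ s x| ≤ 1) (t : ℕ) {S : Finset (Fin n)} {l l' : Fin n} (hne : l ≠ l')
    (hl : l ∉ S) (hl' : l' ∉ S) :
    |ex (law n α p q) (fun ω => φ (lab ω l) (bmsg γ θ κ ω t S l) *
        φ (lab ω l') (bmsg γ θ κ ω t S l')) -
      ex (law n α p q) (fun ω => φ (lab ω l) (bmsg γ θ κ ω t S l)) *
      ex (law n α p q) (fun ω => φ (lab ω l') (bmsg γ θ κ ω t S l'))| ≤ covBd n (p + q) t := by
  classical
  have hr : 0 ≤ p + q := add_nonneg hv.p0 hv.q0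
  have hnn := law_nonneg (n := n) hv
  set g : Fin n → Conf n → ℝ := fun l ω => φ (lab ω l) (bmsg γ θ κ ω t S l) with hg
  set R : Fin n → Conf n → Finset (Fin n) := fun l ω => reach (supAdj ω) t S l with hR
  set u : Finset (Fin n) → Conf n → ℝ := fun C ω => (if R l ω = C then 1 else 0) * g l ω with hu
  -- For l' in C the value 0 is arbitrary; it keeps the bound by 1 and the independence of the sites
  -- meeting C.
  set v : Finset (Fin n) → Conf n → ℝ := fun C ω =>
    if l' ∈ C then 0 else φ (lab ω l') (bmsg γ θ κ ω t (S ∪ C) l') with hvdef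
  have hg1 : ∀ l ω, |g l ω| ≤ 1 := fun l ω => hφ _ _ (abs_bmsg_le hκ _ _ _ _)
  have hv1 : ∀ C ω, |v C ω| ≤ 1 := by
    intro C ω
    simp only [hvdef]
    split_ifs
    · simp
    · exact hφ _ _ (abs_bmsg_le hκ _ _ _ _)
  have hgv : ∀ C ω, Disjoint (R l' ω) C → v C ω = g l' ω := by
    intro C ω hd
    have hmem : l' ∉ C := fun h => Finset.disjoint_left.1 hd (self_mem_reach _ _ _) h
    simp only [hvdef, hg, if_neg hmem, bmsg]
    rw [(reach_union t (Finset.disjoint_of_subset_left (reach_mono supAdj_of_adj t S l') hd)).2]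
  have hdiff : ∀ C ω, |g l' ω - v C ω| ≤ 2 := by
    intro C ω
    have := (abs_sub (g l' ω) (v C ω)).trans (add_le_add (hg1 l' ω) (hv1 C ω))
    linarith
  -- factorization
  have hfac : ∀ C, ex (law n α p q) (fun ω => u C ω * v C ω) =
      ex (law n α p q) (u C) * ex (law n α p q) (v C) := by
    intro C
    refine ex_mul_of_disjoint law_sum (A := touchSites C) (B := offSites (S ∪ C)) ?_ ?_
      (touchSites_disjoint_offSites _ _ Finset.subset_union_right) |>.trans rfl
    · have key : ∀ {ω ω' : Conf n}, (∀ x ∈ touchSites C, ω x = ω' x) → R l ω = C →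
          R l ω' = C ∧ g l ω = g l ω' := by
        intro ω ω' h hC
        have h1 := local_congr (γ := γ) (θ := θ) (κ := κ) t hC h
        have hlC : l ∈ C := hC ▸ self_mem_reach _ _ _
        refine ⟨h1.1, ?_⟩
        simp only [hg]
        rw [h1.2, lab_congr (h _ hlC)]
      intro ω ω' h
      simp only [hu]
      by_cases hC : R l ω = C
      · obtain ⟨h1, h2⟩ := key h hC
        rw [if_pos hC, if_pos h1, h2]
      · have hC' : R l ω' ≠ C := fun h' => hC (key (fun x hx => (h x hx).symm) h').1
        rw [if_neg hC, if_neg hC', zero_mul, zero_mul]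
    · intro ω ω' h
      simp only [hvdef]
      split_ifs with hC
      · rfl
      · have hSC : l' ∉ S ∪ C := by simp [hl', hC]
        rw [bmsg_congr hSC t h, lab_congr (h _ hSC)]
  have hsum : ∀ ω, g l ω = ∑ C, u C ω := by
    intro ω; simp [hu]
  have hsumv : ∀ ω, ∑ C, u C ω * v C ω = g l ω * v (R l ω) ω := by
    intro ω; simp [hu, ite_mul]
  have hρ := reachBd_nonneg (n := n) hr t
  -- first difference
  have h1 : |ex (law n α p q) (fun ω => g l ω * g l' ω) -
      ex (law n α p q) (fun ω => ∑ C, u C ω * v C ω)| ≤ 2 * meetBd n (p + q) t t := by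
    refine (abs_ex_sub_ex_le hv (E := fun ω => ¬ Disjoint (R l ω) (R l' ω)) (c := 2) ?_ ?_).trans
      (mul_le_mul_of_nonneg_left (pr_reach_meet_le hv t t hne hl hl') (by norm_num))
    · intro ω hd
      rw [not_not] at hd
      rw [hsumv, hgv _ _ hd.symm]
    · intro ω
      rw [hsumv, ← mul_sub, abs_mul]
      nlinarith [hg1 l ω, hdiff (R l ω) ω, abs_nonneg (g l ω), abs_nonneg (g l' ω - v (R l ω) ω)]
  -- second difference
  have h2 : ∀ C, |ex (law n α p q) (g l') - ex (law n α p q) (v C)| ≤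
      2 * (C.card * reachBd n (p + q) t + if l' ∈ C then 1 else 0) := by
    intro C
    refine (abs_ex_sub_ex_le hv (E := fun ω => ∃ x ∈ C, x ∈ R l' ω) (c := 2) ?_ (hdiff C)).trans
      (mul_le_mul_of_nonneg_left ((pr_exists_le hnn _ _).trans ?_) (by norm_num))
    · intro ω hd
      refine (hgv _ _ ?_).symm
      rw [Finset.disjoint_right]
      exact fun x hx hx' => hd ⟨x, hx, hx'⟩
    · have h3 : ∀ x ∈ C, pr (law n α p q) (fun ω => x ∈ R l' ω) ≤
          reachBd n (p + q) t + if x = l' then 1 else 0 := by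
        intro x _
        split_ifs with hx
        · have := pr_le_one hnn law_sum (fun ω => x ∈ R l' ω); linarith
        · rw [add_zero]; exact pr_mem_reach_le hv t hx
      refine (Finset.sum_le_sum h3).trans ?_
      rw [Finset.sum_add_distrib]
      simp
  have h3 : |ex (law n α p q) (g l) * ex (law n α p q) (g l') -
      ex (law n α p q) (fun ω => ∑ C, u C ω * v C ω)| ≤
      2 * reachBd n (p + q) t * (1 + n * reachBd n (p + q) t) + 2 * reachBd n (p + q) t := by
    have e1 : ex (law n α p q) (g l) = ∑ C, ex (law n α p q) (u C) := by
      rw [← ex_sum]; congr 1; funext ω; exact hsum ω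
    rw [e1, ex_sum, Finset.sum_mul, ← Finset.sum_sub_distrib]
    have hEu : ∀ C, |ex (law n α p q) (u C)| ≤
        ex (law n α p q) (fun ω => if R l ω = C then (1 : ℝ) else 0) := by
      intro C
      refine (abs_ex_le hnn _).trans (ex_mono hnn fun ω => ?_)
      simp only [hu]
      split_ifs
      · simpa using hg1 l ω
      · simp
    calc |∑ C, (ex (law n α p q) (u C) * ex (law n α p q) (g l') -
          ex (law n α p q) (fun ω => u C ω * v C ω))|
        ≤ ∑ C, |ex (law n α p q) (u C) * ex (law n α p q) (g l') -
          ex (law n α p q) (fun ω => u C ω * v C ω)| := Finset.abs_sum_le_sum_abs _ _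
      _ ≤ ∑ C : Finset (Fin n), ex (law n α p q) (fun ω => if R l ω = C then (1 : ℝ) else 0) *
          (2 * (C.card * reachBd n (p + q) t + if l' ∈ C then 1 else 0)) := by
          refine Finset.sum_le_sum fun C _ => ?_
          rw [hfac, ← mul_sub, abs_mul]
          exact mul_le_mul (hEu C) (h2 C) (abs_nonneg _) ((abs_nonneg _).trans (hEu C))
      _ = ex (law n α p q) (fun ω => 2 * (((R l ω).card : ℝ) * reachBd n (p + q) t +
          if l' ∈ R l ω then 1 else 0)) := by
          simp_rw [← ex_mul_const]
          rw [← ex_sum]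
          congr 1; funext ω
          simp [ite_mul]
      _ ≤ _ := by
          rw [ex_const_mul, ex_add, ex_mul_const]
          have h4 := ex_card_reach_le hv t S l
          have h5 := pr_mem_reach_le hv t (S := S) (Ne.symm hne)
          have h6 : ex (law n α p q) (fun ω => if l' ∈ R l ω then (1 : ℝ) else 0) =
              pr (law n α p q) (fun ω => l' ∈ reach (supAdj ω) t S l) := by
            rw [pr]; congr 1; funext ω; congr
          rw [h6]
          have h7 := mul_le_mul_of_nonneg_right h4 hρ
          simp only [hR]
          nlinarith
  have := abs_sub_le (ex (law n α p q) (fun ω => g l ω * g l' ω))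
    (ex (law n α p q) (fun ω => ∑ C, u C ω * v C ω)) (ex (law n α p q) (g l) * ex (law n α p q) (g l'))
  rw [abs_sub_comm (ex (law n α p q) (fun ω => ∑ C, u C ω * v C ω))] at this
  unfold covBd
  linarith

/-- Reversal of all labels. -/
def flip (ω : Conf n) : Conf n := fun x => match x with
  | .inl x => (!(ω (.inl x)).1, (ω (.inl x)).2)
  | .inr e => ω (.inr e)

lemma flip_flip (ω : Conf n) : flip (flip ω) = ω := by
  funext x
  rcases x with x | x <;> simp [flip]

lemma pweight_flip (ω : Conf n) : pweight (law n α p q) (flip ω) = pweight (law n α p q) ω := by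
  refine Finset.prod_congr rfl fun x _ => ?_
  rcases x with x | x <;> simp [flip, law]

lemma ex_flip (f : Conf n → ℝ) : ex (law n α p q) (fun ω => f (flip ω)) = ex (law n α p q) f := by
  refine Finset.sum_nbij' flip flip (by simp) (by simp) (fun ω _ => flip_flip ω)
    (fun ω _ => flip_flip ω) fun ω _ => ?_
  rw [pweight_flip]

lemma spin_not (s : Bool) : spin (!s) = - spin s := by cases s <;> norm_num [spin]

lemma bmsg_flip (hκ : ∀ s e, κ (!s) e = -κ s e) (ω : Conf n) (t : ℕ) (S : Finset (Fin n))
    (i : Fin n) : bmsg γ θ κ (flip ω) t S i = - bmsg γ θ κ ω t S i := by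
  have h1 : ∀ x, lab (flip ω) x = !lab ω x := fun x => rfl
  have h2 : ∀ x, ok (flip ω) x = ok ω x := fun x => rfl
  have h3 : ∀ x, noisy (flip ω) x = !noisy ω x := fun x => by
    simp only [noisy, h1, h2]; split_ifs <;> simp
  have h4 : adj (flip ω) = adj ω := by
    funext x y
    simp only [adj, edgeBit, h1]
    have e : flip ω (pairSite x y) = ω (pairSite x y) := rfl
    rw [e]
    simp
  unfold bmsg
  rw [h4, ← msg_neg]
  congr 1
  · funext x; rw [h3, spin_not]; ring
  · funext x; rw [h1, h2, hκ]

/-- Reversing all labels preserves the law and the graph and changes the sign of every message. -/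
lemma ex_bmsg (hκ : ∀ s e, κ (!s) e = -κ s e) (t : ℕ) (S : Finset (Fin n)) (i : Fin n) :
    ex (law n α p q) (fun ω => bmsg γ θ κ ω t S i) = 0 := by
  have h := ex_flip (α := α) (p := p) (q := q) (fun ω : Conf n => bmsg γ θ κ ω t S i)
  simp only [bmsg_flip hκ] at h
  have h2 : ex (law n α p q) (fun ω => -bmsg γ θ κ ω t S i) =
      - ex (law n α p q) (fun ω => bmsg γ θ κ ω t S i) := by
    have := ex_const_mul (law n α p q) (-1 : ℝ) (fun ω => bmsg γ θ κ ω t S i)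
    simpa using this
  linarith

/-- The second moment of an average of weakly dependent variables. -/
lemma ex_sq_average_le (hv : ValidParams α p q) {g : Fin n → Conf n → ℝ} {L : Finset (Fin n)}
    {m e c : ℝ} (hg : ∀ l ω, |g l ω| ≤ 1) (hm : |m| ≤ 1) (hc0 : 0 ≤ c)
    (he : ∀ l ∈ L, |ex (law n α p q) (g l) - m| ≤ e)
    (hc : ∀ l ∈ L, ∀ l' ∈ L, l ≠ l' → |ex (law n α p q) (fun ω => g l ω * g l' ω) -
      ex (law n α p q) (g l) * ex (law n α p q) (g l')| ≤ c) :
    ex (law n α p q) (fun ω => ((1 / n : ℝ) * ∑ l ∈ L, (g l ω - m)) ^ 2) ≤ 4 / n + (c + e ^ 2) := by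
  have hnn := law_nonneg (n := n) hv
  rcases Nat.eq_zero_or_pos n with rfl | hn
  · have : (0 : ℝ) ≤ c + e ^ 2 := by positivity
    simpa [ex] using this
  have hn' : (0 : ℝ) < n := by exact_mod_cast hn
  have h1 : (fun ω => ((1 / n : ℝ) * ∑ l ∈ L, (g l ω - m)) ^ 2) =
      fun ω => (1 / n : ℝ) ^ 2 * ∑ l ∈ L, ∑ l' ∈ L, (g l ω - m) * (g l' ω - m) := by
    funext ω; rw [mul_pow, sq (∑ l ∈ L, _), Finset.sum_mul_sum]
  rw [h1, ex_const_mul, ex_sum]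
  have h2 : ∀ l ∈ L, ∀ l' ∈ L, ex (law n α p q) (fun ω => (g l ω - m) * (g l' ω - m)) ≤
      (if l = l' then 4 else 0) + (c + e ^ 2) := by
    intro l hl l' hl'
    split_ifs with hll
    · have h3 : ex (law n α p q) (fun ω => (g l ω - m) * (g l' ω - m)) ≤ 4 := by
        refine (ex_mono hnn (g := fun _ => (4 : ℝ)) fun ω => ?_).trans (ex_const law_sum (4 : ℝ)).le
        have a1 := abs_le.1 (hg l ω)
        have a2 := abs_le.1 hm
        rw [← hll]
        nlinarith
      have : (0 : ℝ) ≤ c + e ^ 2 := by positivity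
      linarith
    · have e1 : (fun ω => (g l ω - m) * (g l' ω - m)) =
          fun ω => ((g l ω * g l' ω - m * g l ω) - m * g l' ω) + m * m := by funext ω; ring
      rw [e1, ex_add, ex_sub, ex_sub, ex_const_mul, ex_const_mul, ex_const law_sum]
      have a1 := (abs_le.1 (hc l hl l' hl' hll)).2
      have a2 := he l hl
      have a3 := he l' hl'
      have a4 : (ex (law n α p q) (g l) - m) * (ex (law n α p q) (g l') - m) ≤ e ^ 2 := by
        refine (le_abs_self _).trans ?_
        rw [abs_mul, sq]
        exact mul_le_mul a2 a3 (abs_nonneg _) ((abs_nonneg _).trans a2)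
      nlinarith
  have h5 : ∑ l ∈ L, ex (law n α p q) (fun ω => ∑ l' ∈ L, (g l ω - m) * (g l' ω - m)) ≤
      n * 4 + n * (n * (c + e ^ 2)) := by
    have hce : (0 : ℝ) ≤ c + e ^ 2 := by positivity
    have hL : (L.card : ℝ) ≤ n := by exact_mod_cast (Finset.card_le_univ L).trans (by simp)
    calc ∑ l ∈ L, ex (law n α p q) (fun ω => ∑ l' ∈ L, (g l ω - m) * (g l' ω - m))
        ≤ ∑ l ∈ L, (4 + n * (c + e ^ 2)) := by
          refine Finset.sum_le_sum fun l hl => ?_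
          rw [ex_sum]
          refine (Finset.sum_le_sum fun l' hl' => h2 l hl l' hl').trans ?_
          rw [Finset.sum_add_distrib, Finset.sum_const, nsmul_eq_mul, Finset.sum_ite_eq, if_pos hl]
          exact add_le_add le_rfl (mul_le_mul_of_nonneg_right hL hce)
      _ ≤ n * (4 + n * (c + e ^ 2)) := by
          rw [Finset.sum_const, nsmul_eq_mul]
          exact mul_le_mul_of_nonneg_right hL (by positivity)
      _ = _ := by ring
  have h6 := mul_le_mul_of_nonneg_left h5 (by positivity : (0 : ℝ) ≤ (1 / n) ^ 2)
  refine h6.trans (le_of_eq ?_)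
  field_simp

end Decoupling

/-! ### Elementary bounds for artanh, exponentials and products. -/

section Elementary

lemma abs_artanh_sub_le {y : ℝ} (hy : |y| ≤ 1 / 2) : |Real.artanh y - y| ≤ 2 * |y| ^ 3 := by
  have hy' := abs_le.1 hy
  have h1 : 0 < 1 - y := by linarith
  have h2 : 0 < 1 + y := by linarith
  have e : Real.artanh y = 1 / 2 * (Real.log (1 + y) - Real.log (1 - y)) := by
    rw [Real.artanh_eq_half_log ⟨by linarith, by linarith⟩, Real.log_div h2.ne' h1.ne']
  have b1 := Real.abs_log_sub_add_sum_range_le (x := y) (by linarith) 2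
  have b2 := Real.abs_log_sub_add_sum_range_le (x := -y) (by rw [abs_neg]; linarith) 2
  simp only [Finset.sum_range_succ, Finset.sum_range_zero, abs_neg, sub_neg_eq_add] at b1 b2
  norm_num at b1 b2
  have h3 : |y| ^ 3 / (1 - |y|) ≤ 2 * |y| ^ 3 := by
    rw [div_le_iff₀ (by linarith)]
    have : 0 ≤ |y| ^ 3 := by positivity
    nlinarith
  rw [e, abs_le]
  have c1 := abs_le.1 (b1.trans h3)
  have c2 := abs_le.1 (b2.trans h3)
  constructor <;> linarith [c1.1, c1.2, c2.1, c2.2]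

lemma norm_exp_mul_I_sub_le {x : ℝ} (hx : |x| ≤ 1) :
    ‖Complex.exp (x * Complex.I) - 1 - (x * Complex.I - x ^ 2 / 2)‖ ≤ |x| ^ 3 := by
  have hn : ‖(x : ℂ) * Complex.I‖ = |x| := by simp
  have h := Complex.exp_bound (x := (x : ℂ) * Complex.I) (by rw [hn]; exact hx) (n := 3) (by norm_num)
  rw [hn] at h
  have e : Complex.exp (x * Complex.I) - 1 - (x * Complex.I - (x : ℂ) ^ 2 / 2) =
      Complex.exp (x * Complex.I) - ∑ m ∈ Finset.range 3, ((x : ℂ) * Complex.I) ^ m / m.factorial := by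
    simp only [Finset.sum_range_succ, Finset.sum_range_zero, Nat.factorial, mul_pow, Complex.I_sq]
    push_cast
    ring
  rw [e]
  refine h.trans ?_
  have : (0 : ℝ) ≤ |x| ^ 3 := by positivity
  norm_num [Nat.factorial]
  nlinarith

lemma norm_exp_sub_exp_le {x y : ℂ} (hx : x.re ≤ 0) (hy : y.re ≤ 0) :
    ‖Complex.exp x - Complex.exp y‖ ≤ ‖x - y‖ := by
  have h := Convex.norm_image_sub_le_of_norm_hasDerivWithin_le (𝕜 := ℂ) (f := Complex.exp)
    (f' := Complex.exp) (s := {z : ℂ | z.re ≤ 0}) (C := 1) (x := y) (y := x)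
    (fun z _ => (Complex.hasDerivAt_exp z).hasDerivWithinAt)
    (fun z hz => by rw [Complex.norm_exp]; exact Real.exp_le_one_iff.2 hz)
    (convex_halfSpace_re_le 0) hy hx
  simpa using h

lemma norm_prod_sub_prod_le {ι : Type*} (L : Finset ι) (f g : ι → ℂ) (hf : ∀ l ∈ L, ‖f l‖ ≤ 1)
    (hg : ∀ l ∈ L, ‖g l‖ ≤ 1) :
    ‖∏ l ∈ L, f l - ∏ l ∈ L, g l‖ ≤ ∑ l ∈ L, ‖f l - g l‖ := by
  classical
  induction L using Finset.induction_on with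
  | empty => simp
  | insert a L ha ih =>
    rw [Finset.prod_insert ha, Finset.prod_insert ha, Finset.sum_insert ha]
    have e : f a * ∏ l ∈ L, f l - g a * ∏ l ∈ L, g l =
        (f a - g a) * ∏ l ∈ L, f l + g a * (∏ l ∈ L, f l - ∏ l ∈ L, g l) := by ring
    rw [e]
    refine (norm_add_le _ _).trans ?_
    rw [norm_mul, norm_mul]
    have h1 : ‖∏ l ∈ L, f l‖ ≤ 1 := by
      rw [norm_prod]
      exact Finset.prod_le_one (fun _ _ => norm_nonneg _)
        fun l hl => hf l (Finset.mem_insert_of_mem hl)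
    have h2 := hg a (Finset.mem_insert_self _ _)
    have h3 := ih (fun l hl => hf l (Finset.mem_insert_of_mem hl))
      (fun l hl => hg l (Finset.mem_insert_of_mem hl))
    have h4 := norm_nonneg (f a - g a)
    have h5 := norm_nonneg (∏ l ∈ L, f l - ∏ l ∈ L, g l)
    nlinarith

/-- The replacement of a product of Bernoulli characteristic functions by an exponential. -/
lemma norm_prod_sub_exp_le {ι : Type*} (L : Finset ι) {P x : ι → ℝ} {r : ℝ} (hr : r ≤ 1 / 2)
    (hP : ∀ l ∈ L, 0 ≤ P l ∧ P l ≤ r) :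
    ‖∏ l ∈ L, (1 + (P l : ℂ) * (Complex.exp (x l * Complex.I) - 1)) -
      Complex.exp (∑ l ∈ L, (P l : ℂ) * (Complex.exp (x l * Complex.I) - 1))‖ ≤
      L.card * (4 * r ^ 2) := by
  have hexp : ∀ l, ‖Complex.exp (x l * Complex.I)‖ = 1 := fun l => Complex.norm_exp_ofReal_mul_I _
  have hz : ∀ l, ‖Complex.exp (x l * Complex.I) - 1‖ ≤ 2 := fun l => by
    refine (norm_sub_le _ _).trans ?_
    rw [hexp]; norm_num
  rw [Complex.exp_sum]
  refine (norm_prod_sub_prod_le L _ _ ?_ ?_).trans ?_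
  · intro l hl
    have e : 1 + (P l : ℂ) * (Complex.exp (x l * Complex.I) - 1) =
        ((1 - P l : ℝ) : ℂ) + (P l : ℂ) * Complex.exp (x l * Complex.I) := by push_cast; ring
    rw [e]
    refine (norm_add_le _ _).trans ?_
    rw [norm_mul, hexp, Complex.norm_real, Complex.norm_real, Real.norm_of_nonneg (hP l hl).1,
      Real.norm_of_nonneg (by linarith [(hP l hl).2])]
    linarith
  · intro l hl
    rw [Complex.norm_exp]
    refine Real.exp_le_one_iff.2 ?_
    have : ((P l : ℂ) * (Complex.exp (x l * Complex.I) - 1)).re = P l * (Real.cos (x l) - 1) := by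
      rw [Complex.re_ofReal_mul, Complex.sub_re, Complex.exp_ofReal_mul_I_re, Complex.one_re]
    rw [this]
    exact mul_nonpos_of_nonneg_of_nonpos (hP l hl).1 (by linarith [Real.cos_le_one (x l)])
  · refine (Finset.sum_le_card_nsmul _ _ (4 * r ^ 2) ?_).trans (by rw [nsmul_eq_mul])
    intro l hl
    have hn : ‖(P l : ℂ) * (Complex.exp (x l * Complex.I) - 1)‖ ≤ 2 * r := by
      rw [norm_mul, Complex.norm_real, Real.norm_of_nonneg (hP l hl).1]
      nlinarith [hz l, (hP l hl).1, (hP l hl).2, norm_nonneg (Complex.exp (x l * Complex.I) - 1)]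
    rw [norm_sub_rev, ← sub_sub]
    refine (Complex.norm_exp_sub_one_sub_id_le (hn.trans (by linarith))).trans ?_
    nlinarith [norm_nonneg ((P l : ℂ) * (Complex.exp (x l * Complex.I) - 1))]

/-- The expansion of the characteristic exponent of one message. -/
lemma norm_phase_sub_le {θ T u s : ℝ} (hθ : |θ| ≤ 1 / 2) (hu : 2 * |u| * |θ| ≤ 1) (hT : |T| ≤ 1)
    (hs : s * s = 1) :
    ‖Complex.exp (((u * s * Real.artanh (θ * T) : ℝ) : ℂ) * Complex.I) - 1 -
      (((u * s * (θ * T) : ℝ) : ℂ) * Complex.I - ((u ^ 2 * (θ * T) ^ 2 / 2 : ℝ) : ℂ))‖ ≤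
      (8 * |u| ^ 3 + 2 * |u| + 2 * u ^ 2) * |θ| ^ 3 := by
  set y := θ * T with hy
  set x := Real.artanh y with hx
  have hs1 : |s| = 1 := by
    have : |s| * |s| = 1 := by rw [← abs_mul, hs, abs_one]
    nlinarith [abs_nonneg s]
  have hyθ : |y| ≤ |θ| := by
    rw [hy, abs_mul]; nlinarith [abs_nonneg θ, abs_nonneg T]
  have h1 : |x - y| ≤ 2 * |θ| ^ 3 := (abs_artanh_sub_le (hyθ.trans hθ)).trans (by gcongr)
  have hθ3 : |θ| ^ 3 ≤ |θ| * (1 / 4) := by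
    have := abs_nonneg θ
    nlinarith [mul_le_mul_of_nonneg_left (mul_self_le_mul_self this hθ) this]
  have h2 : |x| ≤ 2 * |θ| := by
    have := abs_sub_abs_le_abs_sub x y
    linarith [abs_nonneg θ]
  have hux : |u * s * x| ≤ 2 * |u| * |θ| := by
    rw [abs_mul, abs_mul, hs1]; nlinarith [abs_nonneg u]
  have h3 := norm_exp_mul_I_sub_le (hux.trans hu)
  have h4 : |u * s * x| ^ 3 ≤ 8 * |u| ^ 3 * |θ| ^ 3 := by
    refine (pow_le_pow_left₀ (abs_nonneg _) hux 3).trans (le_of_eq (by ring))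
  have e : Complex.exp (((u * s * x : ℝ) : ℂ) * Complex.I) - 1 -
      (((u * s * y : ℝ) : ℂ) * Complex.I - ((u ^ 2 * y ^ 2 / 2 : ℝ) : ℂ)) =
      (Complex.exp (((u * s * x : ℝ) : ℂ) * Complex.I) - 1 -
        (((u * s * x : ℝ) : ℂ) * Complex.I - ((u * s * x : ℝ) : ℂ) ^ 2 / 2)) +
      ((((u * s * (x - y) : ℝ) : ℂ) * Complex.I) + ((-(u ^ 2 * (x ^ 2 - y ^ 2) / 2) : ℝ) : ℂ)) := by
    have hsc : (s : ℂ) ^ 2 = 1 := by rw [sq]; exact_mod_cast hs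
    push_cast
    linear_combination (-(u : ℂ) ^ 2 * x ^ 2 / 2) * hsc
  rw [e]
  refine (norm_add_le _ _).trans ?_
  have h5 : ‖(((u * s * (x - y) : ℝ) : ℂ) * Complex.I)‖ ≤ 2 * |u| * |θ| ^ 3 := by
    rw [norm_mul, Complex.norm_I, mul_one, Complex.norm_real, Real.norm_eq_abs, abs_mul, abs_mul,
      hs1]
    nlinarith [abs_nonneg u]
  have h6 : ‖((-(u ^ 2 * (x ^ 2 - y ^ 2) / 2) : ℝ) : ℂ)‖ ≤ 2 * u ^ 2 * |θ| ^ 3 := by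
    rw [Complex.norm_real, Real.norm_eq_abs, abs_neg, abs_div, abs_mul, abs_of_nonneg (sq_nonneg u),
      abs_of_pos (by norm_num : (0 : ℝ) < 2)]
    have h7 : |x ^ 2 - y ^ 2| ≤ 3 * |θ| ^ 3 := by
      rw [sq_sub_sq, abs_mul]
      have a1 : |x + y| ≤ 3 / 2 := (abs_add_le x y).trans (by linarith)
      nlinarith [abs_nonneg (x - y), abs_nonneg (x + y)]
    have : 0 ≤ |θ| ^ 3 := by positivity
    nlinarith [sq_nonneg u]
  have h8 := norm_add_le (((u * s * (x - y) : ℝ) : ℂ) * Complex.I)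
    ((-(u ^ 2 * (x ^ 2 - y ^ 2) / 2) : ℝ) : ℂ)
  nlinarith

end Elementary

/-! ### Quantitative central limit theorem for the messages received by a vertex. -/

section Clt

variable {n : ℕ} {α p q γ θ : ℝ} {κ : Bool → Bool → ℝ}

/-- As f ignores the site of the pair, the edge indicator may be replaced by its conditional
probability given the labels. -/
lemma ex_edge_mul (x y : Fin n) (hne : x ≠ y) {f : Conf n → ℂ} {A : Set (Site n)}
    (hf : DependsOn f A) (hA : pairSite x y ∉ A) :
    ex (law n α p q) (fun ω => (open Classical in if adj ω x y then (1 : ℂ) else 0) * f ω) =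
      ex (law n α p q) (fun ω => ((if lab ω x = lab ω y then p else q : ℝ) : ℂ) * f ω) := by
  classical
  set b : (Bool × Bool → Bool) → Conf n → ℂ := fun k ω => if k (ω (pairSite x y)) then 1 else 0
  set g : Conf n → ℂ := fun ω => (if lab ω x = lab ω y then 1 else 0) * f ω
  set g' : Conf n → ℂ := fun ω => (if lab ω x = lab ω y then 0 else 1) * f ω
  have hsub : DependsOn (fun ω : Conf n => (lab ω x, lab ω y)) (A ∪ {.inl x, .inl y}) := by
    intro ω ω' h
    simp only [Prod.mk.injEq]
    exact ⟨lab_congr (h _ (by simp)), lab_congr (h _ (by simp))⟩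
  have hfA : DependsOn f (A ∪ {.inl x, .inl y}) := hf.mono Set.subset_union_left
  have hg : DependsOn g (A ∪ {.inl x, .inl y}) := by
    intro ω ω' h
    have := hsub h
    simp only [Prod.mk.injEq] at this
    simp only [g, hfA h, this.1, this.2]
  have hg' : DependsOn g' (A ∪ {.inl x, .inl y}) := by
    intro ω ω' h
    have := hsub h
    simp only [Prod.mk.injEq] at this
    simp only [g', hfA h, this.1, this.2]
  have hb : ∀ k, DependsOn (b k) {pairSite x y} := by
    intro k ω ω' h
    simp only [b, h _ (Set.mem_singleton _)]
  have hd : Disjoint ({pairSite x y} : Set (Site n)) (A ∪ {.inl x, .inl y}) := by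
    rw [Set.disjoint_singleton_left]
    rintro (h | h)
    · exact hA h
    · simp [pairSite] at h
  have hb1 : ex (law n α p q) (b Prod.fst) = p := by
    refine (ex_coordinate law_sum (pairSite x y)
      (fun k : Bool × Bool => if k.1 then (1 : ℂ) else 0)).trans ?_
    simp [Fintype.sum_prod_type, law, bern, pairSite]
    ring
  have hb2 : ex (law n α p q) (b Prod.snd) = q := by
    refine (ex_coordinate law_sum (pairSite x y)
      (fun k : Bool × Bool => if k.2 then (1 : ℂ) else 0)).trans ?_
    simp [Fintype.sum_prod_type, law, bern, pairSite]
    ring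
  have e1 : (fun ω => (if adj ω x y then (1 : ℂ) else 0) * f ω) =
      fun ω => b Prod.fst ω * g ω + b Prod.snd ω * g' ω := by
    funext ω
    by_cases hl : lab ω x = lab ω y <;> simp [b, g, g', adj, edgeBit, hl, hne]
  have e2 : (fun ω => ((if lab ω x = lab ω y then p else q : ℝ) : ℂ) * f ω) =
      fun ω => (p : ℂ) * g ω + (q : ℂ) * g' ω := by
    funext ω
    by_cases hl : lab ω x = lab ω y <;> simp [g, g', hl]
  rw [e1, e2, ex_add, ex_add, ex_mul_of_disjoint law_sum (hb _) hg hd,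
    ex_mul_of_disjoint law_sum (hb _) hg' hd, hb1, hb2, ex_const_mul, ex_const_mul]

/-- The edges at i are replaced one at a time; the factor R carries those already replaced through
the induction. -/
lemma ex_prod_edges {D : Set (Site n)} (i : Fin n) {z : Fin n → Conf n → ℂ} (L : Finset (Fin n))
    (hi : i ∉ L) (hlab : ∀ l ∈ insert i L, (Sum.inl l : Site n) ∈ D)
    (hD : ∀ l, pairSite i l ∉ D) (hz : ∀ l ∈ L, DependsOn (z l) D) :
    ∀ R : Conf n → ℂ, DependsOn R D →
    ex (law n α p q) (fun ω => (∏ l ∈ L, (1 + (open Classical in if adj ω i l then (1 : ℂ) else 0) *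
        z l ω)) * R ω) =
      ex (law n α p q) (fun ω => (∏ l ∈ L, (1 + ((if lab ω i = lab ω l then p else q : ℝ) : ℂ) *
        z l ω)) * R ω) := by
  classical
  induction L using Finset.induction_on with
  | empty => intro R _; simp
  | insert l L hl ih =>
    intro R hR
    have hil : i ≠ l := fun h => hi (by simp [h])
    have hiL : i ∉ L := fun h => hi (Finset.mem_insert_of_mem h)
    have hlD : (Sum.inl l : Site n) ∈ D := hlab l (by simp)
    have hiD : (Sum.inl i : Site n) ∈ D := hlab i (by simp)
    set G : Conf n → ℂ := fun ω => ∏ l ∈ L, (1 + (if adj ω i l then (1 : ℂ) else 0) * z l ω)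
    have hG : DependsOn G {pairSite i l}ᶜ := by
      intro ω ω' h
      refine Finset.prod_congr rfl fun x hx => ?_
      have hmem : ∀ y ∈ D, ω y = ω' y := fun y hy => h y fun hy' => hD l (by
        rw [Set.mem_singleton_iff] at hy'; rwa [← hy'])
      have hxl : x ≠ l := fun h => hl (h ▸ hx)
      have hadj : adj ω i x ↔ adj ω' i x := adj_congr
        (h _ fun hy => hxl (pairSite_injective hy)) (hmem _ hiD)
        (hmem _ (hlab x (by simp [hx])))
      rw [hz x (Finset.mem_insert_of_mem hx) hmem]
      simp only [hadj]
    have hDc : D ⊆ ({pairSite i l} : Set (Site n))ᶜ := fun y hy hy' => hD l (by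
      rw [Set.mem_singleton_iff] at hy'; rwa [← hy'])
    have hzl := hz l (Finset.mem_insert_self _ _)
    have hf : DependsOn (fun ω => z l ω * (G ω * R ω)) {pairSite i l}ᶜ := by
      intro ω ω' h
      simp only [hG h, hzl.mono hDc h, hR.mono hDc h]
    have hP : DependsOn (fun ω : Conf n => (1 + ((if lab ω i = lab ω l then p else q : ℝ) : ℂ) *
        z l ω) * R ω) D := by
      intro ω ω' h
      simp only [hzl h, hR h, lab_congr (h _ hiD), lab_congr (h _ hlD)]
    have h1 := ih hiL (fun x hx => hlab x (by
        rcases Finset.mem_insert.1 hx with h | h <;> simp [h]))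
      (fun x hx => hz x (Finset.mem_insert_of_mem hx)) _ hP
    have h2 := ex_edge_mul (α := α) (p := p) (q := q) i l hil hf (by simp)
    have e1 : (fun ω => (∏ l ∈ insert l L, (1 + (if adj ω i l then (1 : ℂ) else 0) * z l ω)) * R ω) =
        fun ω => G ω * R ω + (if adj ω i l then (1 : ℂ) else 0) * (z l ω * (G ω * R ω)) := by
      funext ω; rw [Finset.prod_insert hl]; ring
    rw [e1, ex_add, h2, ← ex_add]
    refine Eq.trans (congrArg _ ?_) (h1.trans (congrArg _ ?_))
    · funext ω; ring
    · funext ω; rw [Finset.prod_insert hl]; ring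

/-- The quantitative central limit theorem for the sum of the messages at a vertex. -/
lemma norm_charFun_sub_le (hv : ValidParams α p q) (hκ : ∀ s e, |κ s e| ≤ 1)
    (hpq : p + q ≤ 1 / 2) (hθ : |θ| ≤ 1 / 2) {u : ℝ} (hu : 2 * |u| * |θ| ≤ 1) {S : Finset (Fin n)}
    {i : Fin n} (t : ℕ) {v : ℝ} (hv0 : 0 ≤ v) :
    ‖ex (law n α p q) (fun ω => Complex.exp
        (((u * (spin (lab ω i) * bcav γ θ κ ω t S i) : ℝ) : ℂ) * Complex.I)) -
      Complex.exp (u * v * Complex.I - v * u ^ 2 / 2)‖ ≤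
    4 * n * (p + q) ^ 2 + n * (p + q) * ((8 * |u| ^ 3 + 2 * |u| + 2 * u ^ 2) * |θ| ^ 3) +
      |u| * ex (law n α p q) (fun ω => |∑ l ∈ (insert i S)ᶜ, (if lab ω i = lab ω l then p else q) *
        (spin (lab ω i) * (θ * bmsg γ θ κ ω t (insert i S) l)) - v|) +
      u ^ 2 / 2 * ex (law n α p q) (fun ω => |∑ l ∈ (insert i S)ᶜ,
        (if lab ω i = lab ω l then p else q) * (θ * bmsg γ θ κ ω t (insert i S) l) ^ 2 - v|) := by
  classical
  have hnn := law_nonneg (n := n) hv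
  set N := (insert i S)ᶜ with hN
  set T : Fin n → Conf n → ℝ := fun l ω => bmsg γ θ κ ω t (insert i S) l with hT
  set s : Conf n → ℝ := fun ω => spin (lab ω i) with hs
  set P : Fin n → Conf n → ℝ := fun l ω => if lab ω i = lab ω l then p else q with hPdef
  set x : Fin n → Conf n → ℝ := fun l ω => u * s ω * Real.artanh (θ * T l ω) with hx
  set z : Fin n → Conf n → ℂ := fun l ω => Complex.exp ((x l ω : ℂ) * Complex.I) - 1 with hz
  -- All that the labels and the incoming messages use. It contains no pair at i, so the edges at i
  -- are conditionally independent of it.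
  set D : Set (Site n) := insert (.inl i) ((fun l => (Sum.inl l : Site n)) '' N ∪ offSites (insert i S))
  have hmemN : ∀ l ∈ N, l ∉ insert i S := fun l hl => Finset.mem_compl.1 hl
  have hiN : i ∉ N := by simp [hN]
  have hP : ∀ ω, ∀ l ∈ N, 0 ≤ P l ω ∧ P l ω ≤ p + q := by
    intro ω l _
    simp only [hPdef]
    have := hv.p0
    have := hv.q0
    split_ifs <;> constructor <;> linarith
  have hNn : (N.card : ℝ) ≤ n := by exact_mod_cast (Finset.card_le_univ N).trans (by simp)
  have hr : 0 ≤ p + q := add_nonneg hv.p0 hv.q0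
  -- The exponential of a sum over neighbours is a product over all possible neighbours, each
  -- contributing 1 + 1{edge} z.
  have hprod : ∀ ω, Complex.exp (((u * (spin (lab ω i) * bcav γ θ κ ω t S i) : ℝ) : ℂ) * Complex.I) =
      (∏ l ∈ N, (1 + (if adj ω i l then (1 : ℂ) else 0) * z l ω)) * 1 := by
    intro ω
    have e : ((u * (spin (lab ω i) * bcav γ θ κ ω t S i) : ℝ) : ℂ) * Complex.I =
        ∑ l ∈ nb (adj ω) S i, (x l ω : ℂ) * Complex.I := by
      rw [bcav_eq, ← Finset.sum_mul, ← Complex.ofReal_sum, Finset.mul_sum, Finset.mul_sum]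
      congr 2
      exact Finset.sum_congr rfl fun l _ => by simp only [hx, hs, hT]; ring
    have e2 : nb (adj ω) S i = N.filter fun l => adj ω i l := by
      ext l; simp only [mem_nb, hN, Finset.mem_filter, Finset.mem_compl, and_comm]
    rw [e, Complex.exp_sum, e2, Finset.prod_filter, mul_one]
    refine Finset.prod_congr rfl fun l _ => ?_
    split_ifs <;> simp [hz]
  have hdec : ex (law n α p q) (fun ω => Complex.exp
        (((u * (spin (lab ω i) * bcav γ θ κ ω t S i) : ℝ) : ℂ) * Complex.I)) =
      ex (law n α p q) (fun ω => (∏ l ∈ N, (1 + (P l ω : ℂ) * z l ω)) * 1) := by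
    refine (congrArg _ (funext hprod)).trans ?_
    refine ex_prod_edges (D := D) i N hiN ?_ ?_ ?_ (fun _ => 1) (fun _ _ _ => rfl)
    · intro l hl
      rcases Finset.mem_insert.1 hl with h | h
      · exact Or.inl (by rw [h])
      · exact Or.inr (Or.inl ⟨l, h, rfl⟩)
    · rintro l (h | ⟨y, _, h⟩ | h)
      · simp [pairSite] at h
      · simp [pairSite] at h
      · exact (pairSite_mem_offSites.1 h).1 (Finset.mem_insert_self _ _)
    · intro l hl ω ω' h
      have h1 : T l ω = T l ω' := bmsg_congr (hmemN l hl) t fun y hy => h y (Or.inr (Or.inr hy))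
      have h2 : s ω = s ω' := by
        simp only [hs]; rw [lab_congr (h _ (Or.inl rfl))]
      simp only [hz, hx, h1, h2]
  -- The four errors are the passage from the product to an exponential, the expansion of the phases
  -- to second order, and the deviations of drift and variance from v. All exponents have
  -- nonpositive real part, where the exponential is 1-Lipschitz.
  have hpoint : ∀ ω, ‖(∏ l ∈ N, (1 + (P l ω : ℂ) * z l ω)) * 1 -
      Complex.exp (u * v * Complex.I - v * u ^ 2 / 2)‖ ≤
      4 * n * (p + q) ^ 2 + n * (p + q) * ((8 * |u| ^ 3 + 2 * |u| + 2 * u ^ 2) * |θ| ^ 3) +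
      |u| * |∑ l ∈ N, P l ω * (s ω * (θ * T l ω)) - v| +
      u ^ 2 / 2 * |∑ l ∈ N, P l ω * (θ * T l ω) ^ 2 - v| := by
    intro ω
    rw [mul_one]
    have h1 := norm_prod_sub_exp_le N (x := fun l => x l ω) hpq (hP ω)
    have h1' : (N.card : ℝ) * (4 * (p + q) ^ 2) ≤ 4 * n * (p + q) ^ 2 := by nlinarith [sq_nonneg (p + q)]
    have hC : 0 ≤ (8 * |u| ^ 3 + 2 * |u| + 2 * u ^ 2) * |θ| ^ 3 := by positivity
    set W : ℂ := ∑ l ∈ N, (P l ω : ℂ) * z l ω with hW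
    set W' : ℂ := ∑ l ∈ N, (P l ω : ℂ) * (((u * s ω * (θ * T l ω) : ℝ) : ℂ) * Complex.I -
      ((u ^ 2 * (θ * T l ω) ^ 2 / 2 : ℝ) : ℂ)) with hW'
    have h2 : ‖W - W'‖ ≤ n * (p + q) * ((8 * |u| ^ 3 + 2 * |u| + 2 * u ^ 2) * |θ| ^ 3) := by
      rw [hW, hW', ← Finset.sum_sub_distrib]
      refine (norm_sum_le_of_le N (f := _) (n := fun _ => (p + q) *
        ((8 * |u| ^ 3 + 2 * |u| + 2 * u ^ 2) * |θ| ^ 3)) ?_).trans ?_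
      · intro l hl
        rw [← mul_sub, norm_mul, Complex.norm_real, Real.norm_of_nonneg (hP ω l hl).1]
        refine mul_le_mul (hP ω l hl).2 ?_ (norm_nonneg _) hr
        exact norm_phase_sub_le hθ hu (abs_bmsg_le hκ _ _ _ _) (spin_mul_self _)
      · rw [Finset.sum_const, nsmul_eq_mul, mul_assoc]
        exact mul_le_mul_of_nonneg_right hNn (mul_nonneg hr hC)
    have h3 : ‖W' - (u * v * Complex.I - v * u ^ 2 / 2)‖ ≤
        |u| * |∑ l ∈ N, P l ω * (s ω * (θ * T l ω)) - v| +
        u ^ 2 / 2 * |∑ l ∈ N, P l ω * (θ * T l ω) ^ 2 - v| := by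
      have e : W' - (u * v * Complex.I - v * u ^ 2 / 2) =
          ((u * (∑ l ∈ N, P l ω * (s ω * (θ * T l ω)) - v) : ℝ) : ℂ) * Complex.I +
          ((-(u ^ 2 / 2 * (∑ l ∈ N, P l ω * (θ * T l ω) ^ 2 - v)) : ℝ) : ℂ) := by
        have e1 : W' = ((u * ∑ l ∈ N, P l ω * (s ω * (θ * T l ω)) : ℝ) : ℂ) * Complex.I -
            ((u ^ 2 / 2 * (∑ l ∈ N, P l ω * (θ * T l ω) ^ 2) : ℝ) : ℂ) := by
          rw [hW', Finset.mul_sum, Finset.mul_sum, Complex.ofReal_sum, Complex.ofReal_sum,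
            Finset.sum_mul, ← Finset.sum_sub_distrib]
          refine Finset.sum_congr rfl fun l _ => ?_
          push_cast; ring
        rw [e1]; push_cast; ring
      rw [e]
      refine (norm_add_le _ _).trans (le_of_eq ?_)
      rw [norm_mul, Complex.norm_I, mul_one, Complex.norm_real, Complex.norm_real, norm_neg,
        norm_mul, norm_mul, Real.norm_eq_abs, Real.norm_eq_abs, Real.norm_eq_abs, Real.norm_eq_abs,
        abs_of_nonneg (by positivity : 0 ≤ u ^ 2 / 2)]
    have hre1 : W.re ≤ 0 := by
      rw [hW, Complex.re_sum]
      refine Finset.sum_nonpos fun l hl => ?_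
      rw [Complex.re_ofReal_mul]
      simp only [hz, Complex.sub_re, Complex.exp_ofReal_mul_I_re, Complex.one_re]
      exact mul_nonpos_of_nonneg_of_nonpos (hP ω l hl).1 (by linarith [Real.cos_le_one (x l ω)])
    have hre2 : (u * v * Complex.I - v * u ^ 2 / 2 : ℂ).re ≤ 0 := by
      have e : (u * v * Complex.I - v * u ^ 2 / 2 : ℂ) =
        ((u * v : ℝ) : ℂ) * Complex.I + ((-(v * u ^ 2 / 2) : ℝ) : ℂ) := by push_cast; ring
      rw [e, Complex.add_re, Complex.re_ofReal_mul, Complex.I_re, Complex.ofReal_re]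
      have : 0 ≤ v * u ^ 2 / 2 := by positivity
      linarith
    have h4 := norm_exp_sub_exp_le hre1 hre2
    have h5 := norm_sub_le_norm_sub_add_norm_sub (∏ l ∈ N, (1 + (P l ω : ℂ) * z l ω)) (Complex.exp W)
      (Complex.exp (u * v * Complex.I - v * u ^ 2 / 2))
    have h6 := norm_sub_le_norm_sub_add_norm_sub W W' (u * v * Complex.I - v * u ^ 2 / 2)
    linarith
  rw [hdec]
  have hconst := ex_const (w := law n α p q) law_sum
    (Complex.exp (u * v * Complex.I - v * u ^ 2 / 2))
  rw [← hconst, ← ex_sub]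
  refine (norm_ex_le hnn _).trans ((ex_mono hnn hpoint).trans (le_of_eq ?_))
  rw [ex_add, ex_add, ex_const law_sum, ex_const_mul, ex_const_mul]

end Clt

/-! ### Concentration of the drift and of the variance. -/

section Moments

variable {n : ℕ} {α p q γ θ : ℝ} {κ : Bool → Bool → ℝ}

lemma ex_abs_le_sqrt {ι K : Type*} [Fintype ι] [Fintype K] [DecidableEq ι] {w : ι → K → ℝ}
    (hw : ∀ x k, 0 ≤ w x k) (hw1 : ∀ x, ∑ k, w x k = 1)
    {f : (ι → K) → ℝ} {c : ℝ} (h : ex w (fun ω => f ω ^ 2) ≤ c) :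
    ex w (fun ω => |f ω|) ≤ √c := by
  refine Real.le_sqrt_of_sq_le ((sq_ex_le hw hw1 _).trans ?_)
  simpa only [sq_abs] using h

lemma ex_spin_mul_sq (hκ : ∀ s e, κ (!s) e = -κ s e) (t : ℕ) (S : Finset (Fin n)) (i : Fin n) :
    ex (law n α p q) (fun ω => spin (lab ω i) * bmsg γ θ κ ω t S i ^ 2) = 0 := by
  have h := ex_flip (α := α) (p := p) (q := q)
    (fun ω : Conf n => spin (lab ω i) * bmsg γ θ κ ω t S i ^ 2)
  have e : ∀ ω : Conf n, spin (lab (flip ω) i) = - spin (lab ω i) := fun ω => spin_not _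
  simp only [bmsg_flip hκ, e] at h
  have h2 := ex_const_mul (law n α p q) (-1 : ℝ)
    (fun ω => spin (lab ω i) * bmsg γ θ κ ω t S i ^ 2)
  have e2 : (fun ω : Conf n => -spin (lab ω i) * (-bmsg γ θ κ ω t S i) ^ 2) =
      fun ω => -1 * (spin (lab ω i) * bmsg γ θ κ ω t S i ^ 2) := by funext ω; ring
  rw [e2, h2] at h
  linarith

/-- The average of a function of the messages sent to a vertex concentrates. -/
lemma ex_abs_average_le (hv : ValidParams α p q) (hκ : ∀ s e, |κ s e| ≤ 1) {φ : Bool → ℝ → ℝ}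
    (hφ : ∀ s x, |x| ≤ 1 → |φ s x| ≤ 1) (t : ℕ) {S : Finset (Fin n)} {m e : ℝ} (hm : |m| ≤ 1)
    (he : ∀ l ∉ S, |ex (law n α p q) (fun ω => φ (lab ω l) (bmsg γ θ κ ω t S l)) - m| ≤ e)
    (hcov : 0 ≤ covBd n (p + q) t) :
    ex (law n α p q) (fun ω => |(1 / n : ℝ) * ∑ l ∈ Sᶜ, (φ (lab ω l) (bmsg γ θ κ ω t S l) - m)|) ≤
      √(4 / n + (covBd n (p + q) t + e ^ 2)) :=
  ex_abs_le_sqrt (law_nonneg hv) law_sum (ex_sq_average_le hv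
    (fun _ _ => hφ _ _ (abs_bmsg_le hκ _ _ _ _)) hm hcov
    (fun l hl => he l (Finset.mem_compl.1 hl))
    fun _ hl _ hl' hne => abs_cov_le hv hκ hφ t hne (Finset.mem_compl.1 hl) (Finset.mem_compl.1 hl'))

lemma abs_drift_sub_le {L lam m : ℝ} {N K : ℝ} (hn : 0 < n) (hL : 0 ≤ L) (hm : |m| ≤ 1)
    (hN : N ≤ n) (hK : (n : ℝ) - N ≤ K) : |L * (m * N / n) - lam * m| ≤ |L - lam| + L * K / n := by
  have hn' : (0 : ℝ) < n := by exact_mod_cast hn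
  have e : L * (m * N / n) - lam * m = m * ((L - lam) - L * (n - N) / n) := by
    field_simp; ring
  rw [e, abs_mul]
  have h1 : |(L - lam) - L * (n - N) / n| ≤ |L - lam| + L * K / n := by
    refine (abs_sub _ _).trans (add_le_add le_rfl ?_)
    rw [abs_of_nonneg (div_nonneg (mul_nonneg hL (by linarith)) hn'.le)]
    gcongr
  nlinarith [abs_nonneg m, abs_nonneg ((L - lam) - L * (n - N) / n)]

lemma edge_prob_eq (s s' : Bool) :
    (if s = s' then p else q) = (p + q) / 2 + (p - q) / 2 * (spin s * spin s') := by
  cases s <;> cases s' <;> simp [spin] <;> ring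

/-- The error terms of the drift and variance of the sum of the messages. -/
noncomputable def avgErr (n : ℕ) (p q : ℝ) (t : ℕ) (e : ℝ) : ℝ :=
  √(4 / n + (covBd n (p + q) t + e ^ 2))

/-- By `edge_prob_eq` the drift splits into a multiple of the average of the messages, centred by
the flip symmetry, and n(p - q)θ/2 times the average of σT, which is close to m. The last error
accounts for the limit of this prefactor and for the at most K excluded vertices. -/
lemma ex_abs_drift_le (hv : ValidParams α p q) (hκ : ∀ s e, |κ s e| ≤ 1)
    (hflip : ∀ s e, κ (!s) e = -κ s e) (hθ : θ * (p + q) = p - q) (hn : 0 < n) (t : ℕ)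
    {S : Finset (Fin n)} {i : Fin n} {m e lam K : ℝ} (hm : |m| ≤ 1)
    (he : ∀ l ∉ insert i S,
      |ex (law n α p q) (fun ω => spin (lab ω l) * bmsg γ θ κ ω t (insert i S) l) - m| ≤ e)
    (hcov : 0 ≤ covBd n (p + q) t) (hK : ((insert i S).card : ℝ) ≤ K) :
    ex (law n α p q) (fun ω => |∑ l ∈ (insert i S)ᶜ, (if lab ω i = lab ω l then p else q) *
        (spin (lab ω i) * (θ * bmsg γ θ κ ω t (insert i S) l)) - lam * m|) ≤
      (1 + n * (p + q)) * avgErr n p q t 0 + n * (p - q) * θ / 2 * avgErr n p q t e +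
        (|n * (p - q) * θ / 2 - lam| + n * (p - q) * θ / 2 * K / n) := by
  have hnn := law_nonneg (n := n) hv
  have hn' : (0 : ℝ) < n := by exact_mod_cast hn
  have hr : 0 ≤ p + q := add_nonneg hv.p0 hv.q0
  have hL : 0 ≤ n * (p - q) * θ / 2 := by
    rw [← hθ]
    have : (n : ℝ) * (θ * (p + q)) * θ / 2 = n * (p + q) * θ ^ 2 / 2 := by ring
    rw [this]; positivity
  set N := (insert i S)ᶜ with hNdef
  set T : Fin n → Conf n → ℝ := fun l ω => bmsg γ θ κ ω t (insert i S) l with hT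
  have h0 := ex_abs_average_le (γ := γ) (θ := θ) hv hκ (φ := fun _ x => x) (fun _ _ h => h) t
    (S := insert i S) (m := 0) (e := 0) (by simp) (fun l _ => by
      rw [ex_bmsg hflip]; simp) hcov
  have h1 := ex_abs_average_le (γ := γ) (θ := θ) hv hκ (φ := fun s x => spin s * x)
    (fun s x h => by rw [abs_mul, abs_spin, one_mul]; exact h) t (S := insert i S) hm he hcov
  have hNn : (N.card : ℝ) ≤ n := by exact_mod_cast (Finset.card_le_univ N).trans (by simp)
  have hNK : (n : ℝ) - N.card ≤ K := by
    have := Finset.card_add_card_compl (insert i S)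
    rw [Fintype.card_fin] at this
    have h2 : ((insert i S).card : ℝ) + (N.card : ℝ) = n := by exact_mod_cast this
    linarith
  have hpt : ∀ ω, |∑ l ∈ N, (if lab ω i = lab ω l then p else q) *
        (spin (lab ω i) * (θ * T l ω)) - lam * m| ≤
      (1 + n * (p + q)) * |(1 / n : ℝ) * ∑ l ∈ N, (T l ω - 0)| +
      n * (p - q) * θ / 2 * |(1 / n : ℝ) * ∑ l ∈ N, (spin (lab ω l) * T l ω - m)| +
      (|n * (p - q) * θ / 2 - lam| + n * (p - q) * θ / 2 * K / n) := by
    intro ω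
    have e1 : ∑ l ∈ N, (if lab ω i = lab ω l then p else q) * (spin (lab ω i) * (θ * T l ω)) - lam * m =
        n * (p - q) / 2 * spin (lab ω i) * ((1 / n : ℝ) * ∑ l ∈ N, (T l ω - 0)) +
        n * (p - q) * θ / 2 * ((1 / n : ℝ) * ∑ l ∈ N, (spin (lab ω l) * T l ω - m)) +
        (n * (p - q) * θ / 2 * (m * N.card / n) - lam * m) := by
      have e2 : ∑ l ∈ N, (if lab ω i = lab ω l then p else q) * (spin (lab ω i) * (θ * T l ω)) =
          (p - q) / 2 * spin (lab ω i) * ∑ l ∈ N, T l ω +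
          (p - q) * θ / 2 * ∑ l ∈ N, spin (lab ω l) * T l ω := by
        rw [Finset.mul_sum, Finset.mul_sum, ← Finset.sum_add_distrib]
        refine Finset.sum_congr rfl fun l _ => ?_
        rw [edge_prob_eq]
        have h2 := spin_mul_self (lab ω i)
        linear_combination (T l ω * spin (lab ω i) / 2) * hθ +
          ((p - q) / 2 * θ * spin (lab ω l) * T l ω) * h2
      rw [e2]
      simp only [Finset.sum_sub_distrib, Finset.sum_const, nsmul_eq_mul, sub_zero]
      field_simp
      ring
    rw [e1]
    refine (abs_add_le _ _).trans (add_le_add ((abs_add_le _ _).trans (add_le_add ?_ ?_)) ?_)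
    · rw [abs_mul]
      refine mul_le_mul_of_nonneg_right ?_ (abs_nonneg _)
      -- The coefficient n(p - q)/2 need not be bounded; a power of the degree is affordable because
      -- the average it multiplies is of order n^{-1/2} up to such powers.
      rw [abs_mul, abs_spin, mul_one, abs_div, abs_mul, Nat.abs_cast, abs_two]
      have : |p - q| ≤ p + q := abs_le.2 ⟨by linarith [hv.p0], by linarith [hv.q0]⟩
      have := mul_le_mul_of_nonneg_left this hn'.le
      have := abs_nonneg (p - q)
      nlinarith
    · rw [abs_mul, abs_of_nonneg hL]
    · exact abs_drift_sub_le hn hL hm hNn hNK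
  refine (ex_mono hnn hpt).trans ?_
  rw [ex_add, ex_add, ex_const law_sum, ex_const_mul, ex_const_mul]
  refine add_le_add (add_le_add ?_ ?_) le_rfl
  · exact mul_le_mul_of_nonneg_left h0 (by positivity)
  · exact mul_le_mul_of_nonneg_left h1 hL

/-- The roles of the two parts of the edge probability are exchanged: the constant part carries the
average of T², and the part with spins an average of σT², centred by the flip symmetry. -/
lemma ex_abs_variance_le (hv : ValidParams α p q) (hκ : ∀ s e, |κ s e| ≤ 1)
    (hflip : ∀ s e, κ (!s) e = -κ s e) (hθ : θ * (p + q) = p - q) (hn : 0 < n) (t : ℕ)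
    {S : Finset (Fin n)} {i : Fin n} {m e lam K : ℝ} (hm : |m| ≤ 1)
    (he : ∀ l ∉ insert i S,
      |ex (law n α p q) (fun ω => bmsg γ θ κ ω t (insert i S) l ^ 2) - m| ≤ e)
    (hcov : 0 ≤ covBd n (p + q) t) (hK : ((insert i S).card : ℝ) ≤ K) :
    ex (law n α p q) (fun ω => |∑ l ∈ (insert i S)ᶜ, (if lab ω i = lab ω l then p else q) *
        (θ * bmsg γ θ κ ω t (insert i S) l) ^ 2 - lam * m|) ≤
      n * (p - q) * θ / 2 * |θ| * avgErr n p q t 0 + n * (p - q) * θ / 2 * avgErr n p q t e +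
        (|n * (p - q) * θ / 2 - lam| + n * (p - q) * θ / 2 * K / n) := by
  have hnn := law_nonneg (n := n) hv
  have hn' : (0 : ℝ) < n := by exact_mod_cast hn
  have hr : 0 ≤ p + q := add_nonneg hv.p0 hv.q0
  have hL : 0 ≤ n * (p - q) * θ / 2 := by
    rw [← hθ]
    have : (n : ℝ) * (θ * (p + q)) * θ / 2 = n * (p + q) * θ ^ 2 / 2 := by ring
    rw [this]; positivity
  set N := (insert i S)ᶜ with hNdef
  set T : Fin n → Conf n → ℝ := fun l ω => bmsg γ θ κ ω t (insert i S) l with hT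
  have hsq : ∀ x : ℝ, |x| ≤ 1 → |x ^ 2| ≤ 1 := fun x h => by
    rw [abs_pow]; exact pow_le_one₀ (abs_nonneg _) h
  have h0 := ex_abs_average_le (γ := γ) (θ := θ) hv hκ (φ := fun s x => spin s * x ^ 2)
    (fun s x h => by rw [abs_mul, abs_spin, one_mul]; exact hsq x h) t
    (S := insert i S) (m := 0) (e := 0) (by simp) (fun l _ => by
      rw [ex_spin_mul_sq hflip]; simp) hcov
  have h1 := ex_abs_average_le (γ := γ) (θ := θ) hv hκ (φ := fun _ x => x ^ 2)
    (fun s x h => hsq x h) t (S := insert i S) hm he hcov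
  have hNn : (N.card : ℝ) ≤ n := by exact_mod_cast (Finset.card_le_univ N).trans (by simp)
  have hNK : (n : ℝ) - N.card ≤ K := by
    have := Finset.card_add_card_compl (insert i S)
    rw [Fintype.card_fin] at this
    have h2 : ((insert i S).card : ℝ) + (N.card : ℝ) = n := by exact_mod_cast this
    linarith
  have hpt : ∀ ω, |∑ l ∈ N, (if lab ω i = lab ω l then p else q) *
        (θ * T l ω) ^ 2 - lam * m| ≤
      n * (p - q) * θ / 2 * |θ| * |(1 / n : ℝ) * ∑ l ∈ N, (spin (lab ω l) * T l ω ^ 2 - 0)| +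
      n * (p - q) * θ / 2 * |(1 / n : ℝ) * ∑ l ∈ N, (T l ω ^ 2 - m)| +
      (|n * (p - q) * θ / 2 - lam| + n * (p - q) * θ / 2 * K / n) := by
    intro ω
    have e1 : ∑ l ∈ N, (if lab ω i = lab ω l then p else q) * (θ * T l ω) ^ 2 - lam * m =
        n * (p - q) * θ / 2 * (θ * spin (lab ω i)) *
          ((1 / n : ℝ) * ∑ l ∈ N, (spin (lab ω l) * T l ω ^ 2 - 0)) +
        n * (p - q) * θ / 2 * ((1 / n : ℝ) * ∑ l ∈ N, (T l ω ^ 2 - m)) +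
        (n * (p - q) * θ / 2 * (m * N.card / n) - lam * m) := by
      have e2 : ∑ l ∈ N, (if lab ω i = lab ω l then p else q) * (θ * T l ω) ^ 2 =
          (p - q) * θ / 2 * (θ * spin (lab ω i)) * ∑ l ∈ N, spin (lab ω l) * T l ω ^ 2 +
          (p - q) * θ / 2 * ∑ l ∈ N, T l ω ^ 2 := by
        rw [Finset.mul_sum, Finset.mul_sum, ← Finset.sum_add_distrib]
        refine Finset.sum_congr rfl fun l _ => ?_
        rw [edge_prob_eq]
        linear_combination (T l ω ^ 2 * θ / 2) * hθ
      rw [e2]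
      simp only [Finset.sum_sub_distrib, Finset.sum_const, nsmul_eq_mul, sub_zero]
      field_simp
      ring
    rw [e1]
    refine (abs_add_le _ _).trans (add_le_add ((abs_add_le _ _).trans (add_le_add ?_ ?_)) ?_)
    · rw [abs_mul, abs_mul, abs_mul θ, abs_spin, mul_one, abs_of_nonneg hL]
    · rw [abs_mul, abs_of_nonneg hL]
    · exact abs_drift_sub_le hn hL hm hNn hNK
  refine (ex_mono hnn hpt).trans ?_
  rw [ex_add, ex_add, ex_const law_sum, ex_const_mul, ex_const_mul]
  refine add_le_add (add_le_add ?_ ?_) le_rfl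
  · exact mul_le_mul_of_nonneg_left h0 (by positivity)
  · exact mul_le_mul_of_nonneg_left h1 hL

end Moments

/-! ### Orders of magnitude of the error terms in the asymptotic regime. -/

section Orders

/-- Nonnegative quantities of order `1 / n` up to a power of the degree. -/
def SmallOrder (f : ℕ → ℝ → ℝ) : Prop :=
  ∃ (C : ℝ) (k : ℕ), 0 ≤ C ∧ ∀ n r, 0 < n → 0 ≤ r → 0 ≤ f n r ∧ f n r ≤ C * (1 + n * r) ^ k / n

lemma SmallOrder.add {f g : ℕ → ℝ → ℝ} (hf : SmallOrder f) (hg : SmallOrder g) :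
    SmallOrder fun n r => f n r + g n r := by
  obtain ⟨C, k, hC, h⟩ := hf
  obtain ⟨C', k', hC', h'⟩ := hg
  refine ⟨C + C', k + k', by positivity, fun n r hn hr => ?_⟩
  obtain ⟨h1, h2⟩ := h n r hn hr
  obtain ⟨h3, h4⟩ := h' n r hn hr
  refine ⟨add_nonneg h1 h3, (add_le_add h2 h4).trans ?_⟩
  have hn' : (0 : ℝ) < n := by exact_mod_cast hn
  have hD : (1 : ℝ) ≤ 1 + n * r := by nlinarith
  rw [← add_div, add_mul]
  gcongr <;> omega

lemma SmallOrder.mul_left {f : ℕ → ℝ → ℝ} (hf : SmallOrder f) {g : ℕ → ℝ → ℝ} (B : ℝ) (j : ℕ)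
    (hB : 0 ≤ B) (hg : ∀ n r, 0 < n → 0 ≤ r → 0 ≤ g n r ∧ g n r ≤ B * (1 + n * r) ^ j) :
    SmallOrder fun n r => g n r * f n r := by
  obtain ⟨C, k, hC, h⟩ := hf
  refine ⟨B * C, j + k, by positivity, fun n r hn hr => ?_⟩
  obtain ⟨h1, h2⟩ := h n r hn hr
  obtain ⟨h3, h4⟩ := hg n r hn hr
  have hn' : (0 : ℝ) < n := by exact_mod_cast hn
  refine ⟨mul_nonneg h3 h1, (mul_le_mul h4 h2 h1 (by positivity)).trans (le_of_eq ?_)⟩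
  rw [pow_add]; ring

lemma SmallOrder.degree_mul {f : ℕ → ℝ → ℝ} (hf : SmallOrder f) :
    SmallOrder fun n r => n * r * f n r :=
  hf.mul_left 1 1 zero_le_one fun n r _ hr => ⟨by positivity, by linarith⟩

lemma SmallOrder.const_mul {f : ℕ → ℝ → ℝ} (hf : SmallOrder f) {c : ℝ} (hc : 0 ≤ c) :
    SmallOrder fun n r => c * f n r :=
  hf.mul_left c 0 hc fun n r _ hr => ⟨hc, by simp⟩

lemma smallOrder_edge : SmallOrder fun _ r => r := by
  refine ⟨1, 1, zero_le_one, fun n r hn hr => ⟨hr, ?_⟩⟩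
  have hn' : (0 : ℝ) < n := by exact_mod_cast hn
  rw [le_div_iff₀ hn']
  linarith

lemma smallOrder_zero : SmallOrder fun _ _ => 0 :=
  ⟨0, 0, le_rfl, fun n r _ _ => ⟨le_rfl, by simp⟩⟩

lemma smallOrder_inv (c : ℝ) (hc : 0 ≤ c) : SmallOrder fun n _ => c / n :=
  ⟨c, 0, hc, fun n r _ _ => ⟨by positivity, by simp⟩⟩

lemma smallOrder_reachBd (t : ℕ) : SmallOrder fun n r => reachBd n r t := by
  induction t with
  | zero => exact smallOrder_zero
  | succ t ih => exact smallOrder_edge.add ih.degree_mul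

lemma smallOrder_meetBd (t' t : ℕ) : SmallOrder fun n r => meetBd n r t' t := by
  induction t with
  | zero => exact smallOrder_reachBd t'
  | succ t ih => exact ((smallOrder_reachBd t').add smallOrder_edge).add ih.degree_mul

lemma smallOrder_treeBd (t : ℕ) : SmallOrder fun n r => treeBd n r t := by
  induction t with
  | zero => exact smallOrder_zero
  | succ t ih =>
    refine SmallOrder.add ?_ ih.degree_mul
    simp only [sq, mul_assoc]
    simpa only [mul_assoc] using (smallOrder_meetBd t t).degree_mul.degree_mul

lemma smallOrder_covBd (t : ℕ) : SmallOrder fun n r => covBd n r t := by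
  obtain ⟨C, k, hC, h⟩ := smallOrder_reachBd t
  have h1 : SmallOrder fun n r => (1 + n * reachBd n r t) * (2 * reachBd n r t) := by
    refine ((smallOrder_reachBd t).const_mul zero_le_two).mul_left (1 + C) k (by positivity) ?_
    intro n r hn hr
    obtain ⟨h1, h2⟩ := h n r hn hr
    have hn' : (0 : ℝ) < n := by exact_mod_cast hn
    have hD : (1 : ℝ) ≤ (1 + n * r) ^ k := one_le_pow₀ (by nlinarith)
    rw [le_div_iff₀ hn'] at h2
    exact ⟨by positivity, by linarith⟩
  have h2 := ((smallOrder_meetBd t t).const_mul zero_le_two).add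
    (h1.add ((smallOrder_reachBd t).const_mul zero_le_two))
  convert h2 using 3
  rw [covBd]; ring

/-- The asymptotic regime of the edge probabilities: the degrees are of order `n ^ o(1)` and the
signal to noise ratio converges. -/
structure Regime (p q θ : ℕ → ℝ) (lam : ℝ) : Prop where
  p0 : ∀ n, 0 ≤ p n
  q0 : ∀ n, 0 ≤ q n
  mul : ∀ n, θ n * (p n + q n) = p n - q n
  theta : Tendsto θ atTop (𝓝 0)
  snr : Tendsto (fun n : ℕ => n * (p n - q n) * θ n / 2) atTop (𝓝 lam)
  small : ∀ k : ℕ, Tendsto (fun n : ℕ => (1 + n * (p n + q n)) ^ k / n) atTop (𝓝 0)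

variable {p q θ : ℕ → ℝ} {lam : ℝ}

lemma Regime.tendsto_of_smallOrder (R : Regime p q θ lam) {f : ℕ → ℝ → ℝ} (hf : SmallOrder f)
    (j : ℕ) : Tendsto (fun n => (1 + n * (p n + q n)) ^ j * f n (p n + q n)) atTop (𝓝 0) := by
  obtain ⟨C, k, hC, h⟩ := hf
  have hr : ∀ n, 0 ≤ p n + q n := fun n => add_nonneg (R.p0 n) (R.q0 n)
  have h1 := (R.small (j + k)).const_mul C
  rw [mul_zero] at h1
  refine tendsto_of_tendsto_of_tendsto_of_le_of_le' tendsto_const_nhds h1 ?_ ?_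
  all_goals
    filter_upwards [eventually_gt_atTop 0] with n hn
    obtain ⟨h2, h3⟩ := h n _ hn (hr n)
    have := hr n
  · positivity
  · refine (mul_le_mul_of_nonneg_left h3 (by positivity)).trans (le_of_eq ?_)
    rw [pow_add]; ring

lemma Regime.tendsto_of_smallOrder' (R : Regime p q θ lam) {f : ℕ → ℝ → ℝ} (hf : SmallOrder f) :
    Tendsto (fun n => f n (p n + q n)) atTop (𝓝 0) := by
  simpa using R.tendsto_of_smallOrder hf 0

lemma Regime.tendsto_edge (R : Regime p q θ lam) : Tendsto (fun n => p n + q n) atTop (𝓝 0) :=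
  R.tendsto_of_smallOrder' smallOrder_edge

lemma Regime.lam_nonneg (R : Regime p q θ lam) : 0 ≤ lam := by
  refine ge_of_tendsto' R.snr fun n => ?_
  rw [← R.mul n]
  have := add_nonneg (R.p0 n) (R.q0 n)
  have e : (n : ℝ) * (θ n * (p n + q n)) * θ n / 2 = n * (p n + q n) * θ n ^ 2 / 2 := by ring
  rw [e]; positivity

lemma Regime.eventually_valid (R : Regime p q θ lam) {α : ℝ} (hα : 0 ≤ α) (hα1 : α ≤ 1) :
    ∀ᶠ n in atTop, ValidParams α (p n) (q n) := by
  filter_upwards [R.tendsto_edge.eventually (ge_mem_nhds one_pos)] with n hn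
  have := R.p0 n
  have := R.q0 n
  exact ⟨hα, hα1, R.p0 n, by linarith, R.q0 n, by linarith⟩

end Orders

/-! ### Laws of real random variables on finite product spaces. -/

section FiniteLaw

variable {ι K : Type*} [Fintype ι] [Fintype K] [DecidableEq ι]

/-- The law of a real random variable on a finite product space. -/
noncomputable def lawOf (w : ι → K → ℝ) (Y : (ι → K) → ℝ) : Measure ℝ :=
  ∑ ω, ENNReal.ofReal (pweight w ω) • Measure.dirac (Y ω)

variable {w : ι → K → ℝ}

lemma isProbabilityMeasure_lawOf (hw : ∀ x k, 0 ≤ w x k) (hw1 : ∀ x, ∑ k, w x k = 1)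
    (Y : (ι → K) → ℝ) : IsProbabilityMeasure (lawOf w Y) := by
  constructor
  rw [lawOf, Measure.finsetSum_apply]
  simp only [Measure.smul_apply, measure_univ, smul_eq_mul, mul_one]
  rw [← ENNReal.ofReal_sum_of_nonneg fun ω _ => pweight_nonneg hw ω, sum_pweight hw1,
    ENNReal.ofReal_one]

lemma integral_lawOf {E : Type*} [NormedAddCommGroup E] [NormedSpace ℝ E] [CompleteSpace E]
    (hw : ∀ x k, 0 ≤ w x k) (Y : (ι → K) → ℝ) (f : ℝ → E) :
    ∫ y, f y ∂(lawOf w Y) = ex w (fun ω => f (Y ω)) := by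
  rw [lawOf, integral_finsetSum_measure]
  · refine Finset.sum_congr rfl fun ω _ => ?_
    rw [integral_smul_measure, integral_dirac, ENNReal.toReal_ofReal (pweight_nonneg hw ω)]
  · intro ω _
    exact (integrable_dirac (by simp)).smul_measure ENNReal.ofReal_ne_top

lemma real_lawOf (hw : ∀ x k, 0 ≤ w x k) (Y : (ι → K) → ℝ) {E : Set ℝ} (hE : MeasurableSet E) :
    (lawOf w Y).real E = pr w (fun ω => Y ω ∈ E) := by
  classical
  rw [← integral_indicator_one hE, integral_lawOf hw, pr]
  congr 1

lemma charFun_lawOf (hw : ∀ x k, 0 ≤ w x k) (Y : (ι → K) → ℝ) (u : ℝ) :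
    charFun (lawOf w Y) u = ex w (fun ω => Complex.exp (((u * Y ω : ℝ) : ℂ) * Complex.I)) := by
  rw [charFun_apply_real, integral_lawOf hw]
  simp

end FiniteLaw

/-! ### From convergence along sequences to uniform convergence over families. -/

section Uniform

/-- Convergence of functionals of laws, uniformly over families of laws whose characteristic
functions converge uniformly. -/
lemma eventually_forall_of_charFun {P : ℕ → Set (Measure ℝ)} {P0 : Measure ℝ}
    [IsProbabilityMeasure P0] (hP : ∀ n, ∀ ν ∈ P n, IsProbabilityMeasure ν)
    (hc : ∀ u, ∀ ε > 0, ∀ᶠ n in atTop, ∀ ν ∈ P n, ‖charFun ν u - charFun P0 u‖ ≤ ε)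
    {Φ : Measure ℝ → ℝ}
    (hΦ : ∀ ν : ℕ → Measure ℝ, (∀ n, IsProbabilityMeasure (ν n)) →
      (∀ u, Tendsto (fun n => charFun (ν n) u) atTop (𝓝 (charFun P0 u))) →
      Tendsto (fun n => Φ (ν n)) atTop (𝓝 (Φ P0))) {ε : ℝ} (hε : 0 < ε) :
    ∀ᶠ n in atTop, ∀ ν ∈ P n, |Φ ν - Φ P0| ≤ ε := by
  classical
  -- A violating law is chosen for every n at which one exists, and the limit law otherwise;
  -- convergence along this single sequence rules out violations for large n.
  set ν : ℕ → Measure ℝ := fun n =>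
    if h : ∃ ν ∈ P n, ε < |Φ ν - Φ P0| then h.choose else P0 with hν
  have hspec : ∀ n, ν n ∈ P n ∨ ν n = P0 := by
    intro n
    by_cases h : ∃ ν ∈ P n, ε < |Φ ν - Φ P0|
    · left; simp only [hν, dif_pos h]; exact h.choose_spec.1
    · right; simp only [hν, dif_neg h]
  have h1 : ∀ n, IsProbabilityMeasure (ν n) := fun n => by
    rcases hspec n with h | h
    · exact hP n _ h
    · rw [h]; infer_instance
  have h2 := hΦ ν h1 (fun u => by
    rw [Metric.tendsto_nhds]
    intro δ hδ
    filter_upwards [hc u (δ / 2) (half_pos hδ)] with n hn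
    rw [dist_eq_norm]
    rcases hspec n with h | h
    · exact (hn _ h).trans_lt (half_lt_self hδ)
    · rw [h]; simpa using hδ)
  rw [Metric.tendsto_nhds] at h2
  filter_upwards [h2 ε hε] with n hn μ hμ
  by_contra hlt
  have h : ∃ ν ∈ P n, ε < |Φ ν - Φ P0| := ⟨μ, hμ, not_le.1 hlt⟩
  have h3 : ν n = h.choose := by simp only [hν, dif_pos h]
  rw [h3, Real.dist_eq] at hn
  exact absurd h.choose_spec.2 (not_lt.2 hn.le)

/-- Convergence of quantities attached to a vertex and a set avoiding it, uniformly over the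
sets of bounded size. -/
def UnifTendsto (X : ∀ n, Finset (Fin n) → Fin n → ℝ) (c : ℝ) : Prop :=
  ∀ K : ℕ, ∀ ε > 0, ∀ᶠ n in atTop, ∀ (S : Finset (Fin n)) (i : Fin n), i ∉ S → S.card ≤ K →
    |X n S i - c| ≤ ε

end Uniform

/-! ### Independence of the noise at a vertex from the messages it receives. -/

section Vertex

variable {n : ℕ} {α p q γ θ : ℝ} {κ : Bool → Bool → ℝ}

lemma ex_vertex (i : Fin n) (F : Bool → ℝ → ℝ) {Y : Conf n → ℝ}
    (hY : ∀ ω k, Y (Function.update ω (.inl i) ((ω (.inl i)).1, k)) = Y ω) :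
    ex (law n α p q) (fun ω => F (ok ω i) (Y ω)) =
      ∑ k : Bool × Bool, 1 / 2 * bern (1 - α) k.2 *
        ex (law n α p q) (fun ω => F k.2 (Y (Function.update ω (.inl i) (k.1, true)))) := by
  classical
  have e : ∀ ω : Conf n, F (ok ω i) (Y ω) = ∑ k : Bool × Bool,
      (if ω (.inl i) = k then (1 : ℝ) else 0) *
        F k.2 (Y (Function.update ω (.inl i) (k.1, true))) := by
    intro ω
    rw [Finset.sum_eq_single (ω (.inl i)) (fun k _ hk => by rw [if_neg hk.symm, zero_mul])
      (fun h => absurd (Finset.mem_univ _) h), if_pos rfl, one_mul, hY]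
    rfl
  simp_rw [e]
  rw [ex_sum]
  refine Finset.sum_congr rfl fun k _ => ?_
  have h1 : DependsOn (fun ω : Conf n => if ω (.inl i) = k then (1 : ℝ) else 0) {.inl i} := by
    intro ω ω' h
    simp only [h _ (Set.mem_singleton _)]
  have h2 : DependsOn (fun ω : Conf n => F k.2 (Y (Function.update ω (.inl i) (k.1, true))))
      {.inl i}ᶜ := by
    intro ω ω' h
    have : Function.update ω (.inl i) (k.1, true) = Function.update ω' (.inl i) (k.1, true) := by
      funext x
      by_cases hx : x = .inl i
      · subst hx; simp
      · rw [Function.update_of_ne hx, Function.update_of_ne hx]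
        exact h x hx
    simp only [this]
  rw [ex_mul_of_disjoint law_sum h1 h2 disjoint_compl_right]
  congr 1
  rw [ex_coordinate law_sum (.inl i) (fun k' => if k' = k then (1 : ℝ) else 0)]
  simp [law]

/-- The correctness of the noisy label is independent of what does not depend on it. -/
lemma ex_ok (i : Fin n) (F : Bool → ℝ → ℝ) {Y : Conf n → ℝ}
    (hY : ∀ ω k, Y (Function.update ω (.inl i) ((ω (.inl i)).1, k)) = Y ω) :
    ex (law n α p q) (fun ω => F (ok ω i) (Y ω)) =
      (1 - α) * ex (law n α p q) (fun ω => F true (Y ω)) +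
        α * ex (law n α p q) (fun ω => F false (Y ω)) := by
  rw [ex_vertex i F hY, ex_vertex i (fun _ => F true) hY, ex_vertex i (fun _ => F false) hY]
  simp only [Fintype.sum_prod_type, Fintype.sum_bool, bern, if_true, Bool.false_eq_true, if_false]
  ring

lemma pr_ok (i : Fin n) (F : Bool → ℝ → Prop) {Y : Conf n → ℝ}
    (hY : ∀ ω k, Y (Function.update ω (.inl i) ((ω (.inl i)).1, k)) = Y ω) :
    pr (law n α p q) (fun ω => F (ok ω i) (Y ω)) =
      (1 - α) * pr (law n α p q) (fun ω => F true (Y ω)) +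
        α * pr (law n α p q) (fun ω => F false (Y ω)) := by
  classical
  have := ex_ok (α := α) (p := p) (q := q) i (fun o y => if F o y then (1 : ℝ) else 0) hY
  simpa only [pr] using this

/-- The site of i enters the received sum only through its label, which decides the edges at i; the
incoming messages avoid i. Hence the correctness bit of i is independent of the signed sum. -/
lemma signed_bcav_update (t : ℕ) (S : Finset (Fin n)) (i : Fin n) (ω : Conf n) (k : Bool) :
    spin (lab (Function.update ω (.inl i) ((ω (.inl i)).1, k)) i) *
      bcav γ θ κ (Function.update ω (.inl i) ((ω (.inl i)).1, k)) t S i =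
    spin (lab ω i) * bcav γ θ κ ω t S i := by
  set ω' := Function.update ω (.inl i) ((ω (.inl i)).1, k) with hω'
  have hlab : ∀ x, lab ω' x = lab ω x := by
    intro x
    by_cases hx : x = i
    · subst hx; simp [lab, hω']
    · have hx' : (Sum.inl x : Site n) ≠ .inl i := fun h => hx (Sum.inl_injective h)
      simp only [lab, hω', Function.update_of_ne hx']
  have hpair : ∀ x y, ω' (pairSite x y) = ω (pairSite x y) := fun x y => by
    rw [hω', Function.update_of_ne (by simp [pairSite])]
  have hadj : adj ω' = adj ω := by
    funext x y
    simp only [adj, edgeBit, hlab, hpair]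
  rw [hlab, bcav_eq, bcav_eq, hadj]
  congr 1
  refine Finset.sum_congr rfl fun l hl => ?_
  rw [bmsg_congr (mem_nb.1 hl).2 t (ω' := ω)]
  intro x hx
  have : x ≠ .inl i := by
    rintro rfl
    exact hx (Finset.mem_insert_self _ _)
  rw [hω', Function.update_of_ne this]

lemma spin_noisy (ω : Conf n) (i : Fin n) : spin (noisy ω i) = spin (lab ω i) * spin (ok ω i) := by
  unfold noisy
  cases ok ω i <;> cases lab ω i <;> simp [spin]

lemma spin_mul_tanh (s : Bool) (x : ℝ) : spin s * Real.tanh x = Real.tanh (spin s * x) := by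
  cases s <;> simp [spin, Real.tanh_neg]

lemma signed_field (ω : Conf n) (t : ℕ) (S : Finset (Fin n)) (i : Fin n) :
    spin (lab ω i) * (γ * spin (noisy ω i) + bcav γ θ κ ω t S i) =
      spin (lab ω i) * bcav γ θ κ ω t S i + γ * spin (ok ω i) := by
  rw [spin_noisy]
  linear_combination (γ * spin (ok ω i)) * spin_mul_self (lab ω i)

lemma spin_true : spin true = 1 := rfl

lemma spin_false : spin false = -1 := rfl

end Vertex

/-! ### State evolution. -/

section Evolution

variable {p q θ : ℕ → ℝ} {lam α γ : ℝ} {κ : Bool → Bool → ℝ}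

lemma Regime.tendsto_avgErr (R : Regime p q θ lam) (t : ℕ) {e : ℝ} (he : 0 ≤ e) :
    Tendsto (fun n => avgErr n (p n) (q n) t e) atTop (𝓝 e) := by
  have h := R.tendsto_of_smallOrder' ((smallOrder_inv 4 (by norm_num)).add (smallOrder_covBd t))
  have h2 := (h.add_const (e ^ 2)).sqrt
  rw [zero_add, Real.sqrt_sq he] at h2
  refine h2.congr fun n => ?_
  rw [avgErr, add_assoc]

lemma Regime.tendsto_mul_avgErr (R : Regime p q θ lam) (t : ℕ) :
    Tendsto (fun n : ℕ => (1 + n * (p n + q n)) * avgErr n (p n) (q n) t 0) atTop (𝓝 0) := by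
  have h := (R.tendsto_of_smallOrder
    ((smallOrder_inv 4 (by norm_num)).add (smallOrder_covBd t)) 2).sqrt
  rw [Real.sqrt_zero] at h
  refine h.congr fun n => ?_
  have := add_nonneg (R.p0 n) (R.q0 n)
  rw [avgErr, Real.sqrt_mul (by positivity), Real.sqrt_sq (by positivity)]
  simp

/-- The characteristic functions of the signed sums of messages converge. -/
lemma Regime.charFun_close (R : Regime p q θ lam) (hα : 0 ≤ α) (hα1 : α ≤ 1)
    (hκ : ∀ s e, |κ s e| ≤ 1) (hflip : ∀ s e, κ (!s) e = -κ s e) (t : ℕ) {m : ℝ} (hm0 : 0 ≤ m)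
    (hm1 : m ≤ 1)
    (h1 : UnifTendsto (fun n S i => ex (law n α (p n) (q n))
      (fun ω => spin (lab ω i) * bmsg γ (θ n) κ ω t S i)) m)
    (h2 : UnifTendsto (fun n S i => ex (law n α (p n) (q n))
      (fun ω => bmsg γ (θ n) κ ω t S i ^ 2)) m) (u : ℝ) (K : ℕ) {ε : ℝ} (hε : 0 < ε) :
    ∀ᶠ n in atTop, ∀ (S : Finset (Fin n)) (i : Fin n), i ∉ S → S.card ≤ K →
      ‖ex (law n α (p n) (q n)) (fun ω => Complex.exp
        (((u * (spin (lab ω i) * bcav γ (θ n) κ ω t S i) : ℝ) : ℂ) * Complex.I)) -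
      Complex.exp (u * (lam * m : ℝ) * Complex.I - (lam * m : ℝ) * u ^ 2 / 2)‖ ≤ ε := by
  have hlam := R.lam_nonneg
  have hmabs : |m| ≤ 1 := abs_le.2 ⟨by linarith, hm1⟩
  set c : ℝ := |u| + u ^ 2 / 2 with hc
  have hc0 : 0 ≤ c := by positivity
  -- A tolerance e on the moments contributes c λ e to the limit of the total error, so this choice
  -- keeps that limit below ε.
  set e : ℝ := ε / (2 * (1 + c * lam)) with hedef
  have hden : 0 < 2 * (1 + c * lam) := by positivity
  have he : 0 < e := div_pos hε hden
  have hce : c * (lam * e) < ε := by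
    rw [hedef]
    have : c * (lam * (ε / (2 * (1 + c * lam)))) = ε * (c * lam / (2 * (1 + c * lam))) := by ring
    rw [this]
    refine mul_lt_of_lt_one_right hε ?_
    rw [div_lt_one hden]
    have : 0 ≤ c * lam := by positivity
    linarith
  obtain ⟨C, k, hC, hcov⟩ := smallOrder_covBd t
  set A : ℝ := 8 * |u| ^ 3 + 2 * |u| + 2 * u ^ 2 with hA
  have hthabs : Tendsto (fun n => |θ n|) atTop (𝓝 0) := by simpa using R.theta.abs
  have hlim : Tendsto (fun n : ℕ => 4 * n * (p n + q n) ^ 2 + n * (p n + q n) * (A * |θ n| ^ 3) +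
      |u| * ((1 + n * (p n + q n)) * avgErr n (p n) (q n) t 0 +
        n * (p n - q n) * θ n / 2 * avgErr n (p n) (q n) t e +
        (|n * (p n - q n) * θ n / 2 - lam| + n * (p n - q n) * θ n / 2 * (K + 1 : ℕ) / n)) +
      u ^ 2 / 2 * (n * (p n - q n) * θ n / 2 * |θ n| * avgErr n (p n) (q n) t 0 +
        n * (p n - q n) * θ n / 2 * avgErr n (p n) (q n) t e +
        (|n * (p n - q n) * θ n / 2 - lam| + n * (p n - q n) * θ n / 2 * (K + 1 : ℕ) / n))) atTop
      (𝓝 (0 + 0 + |u| * (0 + lam * e + (0 + 0)) +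
        u ^ 2 / 2 * (lam * 0 * 0 + lam * e + (0 + 0)))) := by
    have l1 : Tendsto (fun n : ℕ => 4 * (n : ℝ) * (p n + q n) ^ 2) atTop (𝓝 0) := by
      refine (R.tendsto_of_smallOrder' (smallOrder_edge.degree_mul.const_mul
        (by norm_num : (0 : ℝ) ≤ 4))).congr fun n => by ring
    have l2 : Tendsto (fun n : ℕ => (n : ℝ) * (p n + q n) * (A * |θ n| ^ 3)) atTop (𝓝 0) := by
      have := (R.snr.mul hthabs).const_mul (2 * A)
      rw [mul_zero, mul_zero] at this
      refine this.congr fun n => ?_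
      rw [← R.mul n, pow_succ, sq_abs]; ring
    have l3 : Tendsto (fun n => |n * (p n - q n) * θ n / 2 - lam|) atTop (𝓝 0) := by
      simpa using (R.snr.sub_const lam).abs
    have l4 : Tendsto (fun n : ℕ => n * (p n - q n) * θ n / 2 * (K + 1 : ℕ) / n) atTop (𝓝 0) := by
      have := R.snr.mul (tendsto_const_div_atTop_nhds_zero_nat ((K + 1 : ℕ) : ℝ))
      rw [mul_zero] at this
      exact this.congr fun n => by ring
    have l5 := R.snr.mul (R.tendsto_avgErr t he.le)
    exact ((l1.add l2).add (((R.tendsto_mul_avgErr t).add l5 |>.add (l3.add l4)).const_mul _)).add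
      ((((R.snr.mul hthabs).mul (R.tendsto_avgErr t le_rfl)).add l5 |>.add
        (l3.add l4)).const_mul _)
  have hval : 0 + 0 + |u| * (0 + lam * e + (0 + 0)) +
        u ^ 2 / 2 * (lam * 0 * 0 + lam * e + (0 + 0)) < ε := by
    refine lt_of_eq_of_lt ?_ hce
    rw [hc]; ring
  -- The messages sent to i avoid i in addition to S, so the moment bounds are needed for sets of
  -- size K + 1. This is why convergence is required uniformly over avoided sets.
  filter_upwards [hlim.eventually (gt_mem_nhds hval), h1 (K + 1) e he, h2 (K + 1) e he,
    R.eventually_valid hα hα1, R.tendsto_edge.eventually (ge_mem_nhds (by norm_num : (0 : ℝ) < 1 / 2)),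
    hthabs.eventually (ge_mem_nhds (by norm_num : (0 : ℝ) < 1 / 2)),
    (hthabs.const_mul (2 * |u|)).eventually (ge_mem_nhds (by norm_num : 2 * |u| * 0 < (1 : ℝ))),
    eventually_gt_atTop 0] with n g1 g2 g3 hv g5 g6 g7 hn S i hi hS
  have hcard : (insert i S).card ≤ K + 1 := (Finset.card_insert_le _ _).trans (by omega)
  have hcard' : ((insert i S).card : ℝ) ≤ (K + 1 : ℕ) := by exact_mod_cast hcard
  have hcov0 := (hcov n _ hn (add_nonneg (R.p0 n) (R.q0 n))).1
  have d1 := ex_abs_drift_le (γ := γ) (lam := lam) hv hκ hflip (R.mul n) hn t hmabs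
    (fun l hl => g2 (insert i S) l hl hcard) hcov0 hcard'
  have d2 := ex_abs_variance_le (γ := γ) (lam := lam) hv hκ hflip (R.mul n) hn t hmabs
    (fun l hl => g3 (insert i S) l hl hcard) hcov0 hcard'
  have d3 := norm_charFun_sub_le (γ := γ) hv hκ g5 g6 g7 (S := S) (i := i) t
    (v := lam * m) (by positivity)
  refine d3.trans (le_trans ?_ g1.le)
  exact add_le_add (add_le_add le_rfl (mul_le_mul_of_nonneg_left d1 (abs_nonneg _)))
    (mul_le_mul_of_nonneg_left d2 (by positivity))

/-- Convergence of functionals of the laws of the signed sums of messages. -/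
lemma Regime.functional_close (R : Regime p q θ lam) (hα : 0 ≤ α) (hα1 : α ≤ 1)
    (hκ : ∀ s e, |κ s e| ≤ 1) (hflip : ∀ s e, κ (!s) e = -κ s e) (t : ℕ) {m : ℝ} (hm0 : 0 ≤ m)
    (hm1 : m ≤ 1)
    (h1 : UnifTendsto (fun n S i => ex (law n α (p n) (q n))
      (fun ω => spin (lab ω i) * bmsg γ (θ n) κ ω t S i)) m)
    (h2 : UnifTendsto (fun n S i => ex (law n α (p n) (q n))
      (fun ω => bmsg γ (θ n) κ ω t S i ^ 2)) m) {Φ : Measure ℝ → ℝ}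
    (hΦ : ∀ ν : ℕ → Measure ℝ, (∀ n, IsProbabilityMeasure (ν n)) →
      (∀ u, Tendsto (fun n => charFun (ν n) u) atTop (𝓝 (charFun (driftGauss (lam * m)) u))) →
      Tendsto (fun n => Φ (ν n)) atTop (𝓝 (Φ (driftGauss (lam * m))))) :
    UnifTendsto (fun n S i => Φ (lawOf (law n α (p n) (q n))
      (fun ω => spin (lab ω i) * bcav γ (θ n) κ ω t S i))) (Φ (driftGauss (lam * m))) := by
  intro K ε hε
  have hv0 : 0 ≤ lam * m := mul_nonneg R.lam_nonneg hm0
  set P : ℕ → Set (Measure ℝ) := fun n => {ν | ValidParams α (p n) (q n) ∧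
    ∃ (S : Finset (Fin n)) (i : Fin n), i ∉ S ∧ S.card ≤ K ∧ ν = lawOf (law n α (p n) (q n))
      (fun ω => spin (lab ω i) * bcav γ (θ n) κ ω t S i)} with hPdef
  have hev := eventually_forall_of_charFun (P := P) (P0 := driftGauss (lam * m)) (Φ := Φ) ?_ ?_ hΦ hε
  · filter_upwards [hev, R.eventually_valid hα hα1] with n hn hv S i hi hS
    exact hn _ ⟨hv, S, i, hi, hS, rfl⟩
  · rintro n ν ⟨hv, S, i, -, -, rfl⟩
    exact isProbabilityMeasure_lawOf (law_nonneg hv) law_sum _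
  · intro u δ hδ
    filter_upwards [R.charFun_close hα hα1 hκ hflip t hm0 hm1 h1 h2 u K hδ] with n hn ν hν
    obtain ⟨hv, S, i, hi, hS, rfl⟩ := hν
    rw [charFun_lawOf (law_nonneg hv), charFun_driftGauss hv0]
    exact hn S i hi hS

/-- The limits of the second moments of the messages. -/
noncomputable def overlap (α lam c : ℝ) : ℕ → ℝ
  | 0 => c
  | t + 1 => h α (lam * overlap α lam c t)

lemma overlap_mem (hα : 0 ≤ α) (hα2 : α < 1 / 2) (hlam : 0 ≤ lam) {c : ℝ} (hc0 : 0 ≤ c)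
    (hc1 : c ≤ 1) (t : ℕ) : 0 ≤ overlap α lam c t ∧ overlap α lam c t ≤ 1 := by
  induction t with
  | zero => exact ⟨hc0, hc1⟩
  | succ t ih =>
    have := mul_nonneg hlam ih.1
    exact ⟨h_nonneg hα hα2 this, h_le_one hα hα2 this⟩

/-- Initial messages compatible with the posterior means of the labels. -/
structure GoodInit (α : ℝ) (κ : Bool → Bool → ℝ) (c : ℝ) : Prop where
  bound : ∀ s e, |κ s e| ≤ 1
  flip : ∀ s e, κ (!s) e = -κ s e
  nonneg : 0 ≤ c
  le_one : c ≤ 1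
  mean : (1 - α) * κ true true + α * κ true false = c
  sq : (1 - α) * κ true true ^ 2 + α * κ true false ^ 2 = c

/-- The signed field is the signed sum of messages, asymptotically N(λm, λm), plus an independent ±γ
with probabilities 1 - α and α, which are the mixture weights because tanh γ = 1 - 2α. -/
lemma unifTendsto_mix (R : Regime p q θ lam) (hα : 0 < α) (hα2 : α < 1 / 2) {c : ℝ}
    (hκ : GoodInit α κ c) (t : ℕ) {m : ℝ} (hm0 : 0 ≤ m) (hm1 : m ≤ 1)
    (h1 : UnifTendsto (fun n S i => ex (law n α (p n) (q n))
      (fun ω => spin (lab ω i) * bmsg (rgam α) (θ n) κ ω t S i)) m)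
    (h2 : UnifTendsto (fun n S i => ex (law n α (p n) (q n))
      (fun ω => bmsg (rgam α) (θ n) κ ω t S i ^ 2)) m) {φ : ℝ → ℝ} (hφ : Continuous φ)
    (hφ1 : ∀ x, |φ x| ≤ 1) :
    UnifTendsto (fun n S i => ex (law n α (p n) (q n)) (fun ω => φ (spin (lab ω i) *
      (rgam α * spin (noisy ω i) + bcav (rgam α) (θ n) κ ω t S i)))) (mix φ (rgam α) (lam * m)) := by
  set Φ : Measure ℝ → ℝ := fun ν =>
    (1 - α) * ∫ y, φ (y + rgam α) ∂ν + α * ∫ y, φ (y - rgam α) ∂ν with hΦ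
  have hmix : mix φ (rgam α) (lam * m) = Φ (driftGauss (lam * m)) := by
    simp only [mix, hΦ, tanh_rgam hα hα2]
    ring
  have hcl := R.functional_close hα.le (by linarith) hκ.bound hκ.flip t hm0 hm1 h1 h2 (Φ := Φ) ?_
  · rw [hmix]
    intro K ε hε
    filter_upwards [hcl K ε hε, R.eventually_valid hα.le (by linarith)] with n hn hv S i hi hS
    have := hn S i hi hS
    refine le_trans (le_of_eq ?_) this
    congr 2
    simp only [hΦ]
    rw [integral_lawOf (law_nonneg hv), integral_lawOf (law_nonneg hv)]
    simp_rw [signed_field]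
    rw [ex_ok (α := α) i (fun o y => φ (y + rgam α * spin o))
      (Y := fun ω => spin (lab ω i) * bcav (rgam α) (θ n) κ ω t S i)
      (fun ω k => signed_bcav_update t S i ω k)]
    simp only [spin_true, spin_false, mul_one, mul_neg, sub_eq_add_neg]
  · intro ν hν hc
    refine ((tendsto_integral_of_charFun hc (by fun_prop) 1 fun x => hφ1 _).const_mul _).add
      ((tendsto_integral_of_charFun hc (by fun_prop) 1 fun x => hφ1 _).const_mul _)

/-- State evolution: the convergence of the first two moments of the messages. -/
lemma unifTendsto_moments (R : Regime p q θ lam) (hα : 0 < α) (hα2 : α < 1 / 2) {c : ℝ}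
    (hκ : GoodInit α κ c) (t : ℕ) :
    UnifTendsto (fun n S i => ex (law n α (p n) (q n))
      (fun ω => spin (lab ω i) * bmsg (rgam α) (θ n) κ ω t S i)) (overlap α lam c t) ∧
    UnifTendsto (fun n S i => ex (law n α (p n) (q n))
      (fun ω => bmsg (rgam α) (θ n) κ ω t S i ^ 2)) (overlap α lam c t) := by
  induction t with
  | zero =>
    have hf : κ false true = -κ true true := hκ.flip true true
    have hf' : κ false false = -κ true false := hκ.flip true false
    have hm := hκ.mean
    have hs := hκ.sq
    constructor
    · intro K ε hε
      filter_upwards with n S i _ _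
      have : ex (law n α (p n) (q n)) (fun ω => spin (lab ω i) * bmsg (rgam α) (θ n) κ ω 0 S i) = c := by
        refine (ex_coordinate law_sum (.inl i)
          (fun k : Bool × Bool => spin k.1 * κ k.1 k.2)).trans ?_
        simp only [Fintype.sum_prod_type, Fintype.sum_bool, law, bern, spin_true, spin_false, hf, hf',
          smul_eq_mul, if_true, Bool.false_eq_true, if_false]
        linear_combination hm
      rw [this, overlap, sub_self, abs_zero]; exact hε.le
    · intro K ε hε
      filter_upwards with n S i _ _
      have : ex (law n α (p n) (q n)) (fun ω => bmsg (rgam α) (θ n) κ ω 0 S i ^ 2) = c := by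
        refine (ex_coordinate law_sum (.inl i) (fun k : Bool × Bool => κ k.1 k.2 ^ 2)).trans ?_
        simp only [Fintype.sum_prod_type, Fintype.sum_bool, law, bern, hf, hf',
          smul_eq_mul, if_true, Bool.false_eq_true, if_false]
        linear_combination hs
      rw [this, overlap, sub_self, abs_zero]; exact hε.le
  | succ t ih =>
    obtain ⟨m0, m1⟩ := overlap_mem hα.le hα2 R.lam_nonneg hκ.nonneg hκ.le_one t
    have hv0 := mul_nonneg R.lam_nonneg m0
    rw [overlap, h_eq_mix hα hα2 hv0]
    constructor
    · have := unifTendsto_mix R hα hα2 hκ t m0 m1 ih.1 ih.2 continuous_tanh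
        (fun x => (abs_tanh_lt_one x).le)
      simpa only [bmsg_succ, spin_mul_tanh] using this
    · have := unifTendsto_mix R hα hα2 hκ t m0 m1 ih.1 ih.2 (φ := fun y => Real.tanh y ^ 2)
        (continuous_tanh.pow 2) (fun x => by
          rw [abs_pow]; exact pow_le_one₀ (abs_nonneg _) (abs_tanh_lt_one x).le)
      -- The Nishimori identity makes the limits of the two moments agree again, which closes the
      -- induction.
      rw [mix_tanh_eq_sq _ hv0]
      simpa only [bmsg_succ, ← spin_mul_tanh, mul_pow, sq (spin _), spin_mul_self, one_mul] using this

/-- The asymptotic probability that the sign of the local field is correct. -/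
lemma unifTendsto_sign (R : Regime p q θ lam) (hα : 0 < α) (hα2 : α < 1 / 2) {c : ℝ}
    (hκ : GoodInit α κ c) (t : ℕ) :
    UnifTendsto (fun n S i => pr (law n α (p n) (q n)) (fun ω => 0 ≤ spin (lab ω i) *
      (rgam α * spin (noisy ω i) + bcav (rgam α) (θ n) κ ω t S i)))
      (gaussAccuracy α (lam * overlap α lam c t)) ∧
    UnifTendsto (fun n S i => pr (law n α (p n) (q n)) (fun ω => 0 < spin (lab ω i) *
      (rgam α * spin (noisy ω i) + bcav (rgam α) (θ n) κ ω t S i)))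
      (gaussAccuracy α (lam * overlap α lam c t)) := by
  obtain ⟨m0, m1⟩ := overlap_mem hα.le hα2 R.lam_nonneg hκ.nonneg hκ.le_one t
  have hv0 := mul_nonneg R.lam_nonneg m0
  obtain ⟨i1, i2⟩ := unifTendsto_moments R hα hα2 hκ t
  have hg := (rgam_pos hα hα2).ne'
  have hms : ∀ s : ℝ, MeasurableSet {y : ℝ | 0 ≤ y + s} := fun s =>
    measurableSet_le measurable_const (measurable_id.add_const s)
  have hms' : ∀ s : ℝ, MeasurableSet {y : ℝ | 0 < y + s} := fun s =>
    measurableSet_lt measurable_const (measurable_id.add_const s)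
  rw [gaussAccuracy_eq hα hα2 hv0]
  constructor
  · have hcl := R.functional_close hα.le (by linarith) hκ.bound hκ.flip t m0 m1 i1 i2
      (Φ := signAccuracy α) ?_
    · intro K ε hε
      filter_upwards [hcl K ε hε, R.eventually_valid hα.le (by linarith)] with n hn hv S i hi hS
      refine le_trans (le_of_eq ?_) (hn S i hi hS)
      congr 2
      rw [signAccuracy, real_lawOf (law_nonneg hv) _ (hms _), real_lawOf (law_nonneg hv) _ (hms _)]
      simp_rw [signed_field]
      rw [pr_ok (α := α) i (fun o y => 0 ≤ y + rgam α * spin o)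
        (Y := fun ω => spin (lab ω i) * bcav (rgam α) (θ n) κ ω t S i)
        (fun ω k => signed_bcav_update t S i ω k)]
      simp only [spin_true, spin_false, mul_one, mul_neg]
      rfl
    · intro ν hν hc
      exact ((tendsto_real_halfline hv0 hg hc).1.const_mul _).add
        ((tendsto_real_halfline hv0 (neg_ne_zero.2 hg) hc).1.const_mul _)
  -- The strict version is a different functional; it has the same value at the limit because ±γ ≠ 0
  -- excludes an atom at the threshold.
  · set Φ : Measure ℝ → ℝ := fun P =>
      (1 - α) * P.real {y | 0 < y + rgam α} + α * P.real {y | 0 < y + -rgam α} with hΦ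
    have heq : signAccuracy α (driftGauss (lam * overlap α lam c t)) =
        Φ (driftGauss (lam * overlap α lam c t)) := by
      simp only [signAccuracy, hΦ]
      rw [driftGauss_Ici_eq_Ioi hv0 hg, driftGauss_Ici_eq_Ioi hv0 (neg_ne_zero.2 hg)]
    have hcl := R.functional_close hα.le (by linarith) hκ.bound hκ.flip t m0 m1 i1 i2
      (Φ := Φ) ?_
    · rw [heq]
      intro K ε hε
      filter_upwards [hcl K ε hε, R.eventually_valid hα.le (by linarith)] with n hn hv S i hi hS
      refine le_trans (le_of_eq ?_) (hn S i hi hS)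
      congr 2
      simp only [hΦ]
      rw [real_lawOf (law_nonneg hv) _ (hms' _), real_lawOf (law_nonneg hv) _ (hms' _)]
      simp_rw [signed_field]
      rw [pr_ok (α := α) i (fun o y => 0 < y + rgam α * spin o)
        (Y := fun ω => spin (lab ω i) * bcav (rgam α) (θ n) κ ω t S i)
        (fun ω k => signed_bcav_update t S i ω k)]
      simp only [spin_true, spin_false, mul_one, mul_neg]
      rfl
    · intro ν hν hc
      rw [← heq]
      exact ((tendsto_real_halfline hv0 hg hc).2.const_mul _).add
        ((tendsto_real_halfline hv0 (neg_ne_zero.2 hg) hc).2.const_mul _)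

end Evolution

/-! ### Identification of the law on sites with the weights of the model. -/

section Link

variable {n : ℕ}

/-- The graph of the block model. -/
def graph (ω : Conf n) : SimpleGraph (Fin n) where
  Adj := adj ω
  symm := ⟨fun _ _ h => adj_symm h⟩
  loopless := ⟨fun _ h => h.1 rfl⟩

/-- Once σ is prescribed, the event is an intersection of conditions on single sites, so its
probability is a product over sites. Pair sites that are not increasing are unconstrained and
contribute 1. -/
lemma pr_point (a b α : ℝ) (σ : Fin n → Bool) (G : SimpleGraph (Fin n)) (τ : Fin n → Bool) :
    pr (law n α (a / n) (b / n)) (fun ω => lab ω = σ ∧ graph ω = G ∧ noisy ω = τ) =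
      weight a b α σ G τ := by
  classical
  obtain ⟨P, hPl, hPr⟩ : ∃ P : Site n → Bool × Bool → Prop,
      (∀ x k, P (.inl x) k ↔ k.1 = σ x ∧ (k.2 = true ↔ τ x = σ x)) ∧
      (∀ i j k, P (.inr (i, j)) k ↔
        (i < j → ((if σ i = σ j then k.1 else k.2) = true ↔ G.Adj i j))) :=
    ⟨fun x k => match x with
      | .inl x => k.1 = σ x ∧ (k.2 = true ↔ τ x = σ x)
      | .inr e => e.1 < e.2 → ((if σ e.1 = σ e.2 then k.1 else k.2) = true ↔ G.Adj e.1 e.2),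
      fun _ _ => Iff.rfl, fun _ _ _ => Iff.rfl⟩
  have hiff : ∀ ω : Conf n, (lab ω = σ ∧ graph ω = G ∧ noisy ω = τ) ↔ ∀ x, P x (ω x) := by
    intro ω
    have hedge : ∀ i j, i < j → lab ω = σ → (adj ω i j ↔
        (if σ i = σ j then (ω (.inr (i, j))).1 else (ω (.inr (i, j))).2) = true) := by
      intro i j hij hσ
      simp only [adj, edgeBit, hσ, pairSite, min_eq_left hij.le, max_eq_right hij.le, ne_eq, hij.ne,
        not_false_iff, true_and]
    have hnoisy : ∀ i, lab ω i = σ i → ((noisy ω i = τ i) ↔ (ok ω i = true ↔ τ i = σ i)) := by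
      intro i hi
      rw [noisy, hi]
      cases ok ω i <;> cases σ i <;> cases τ i <;> simp
    rw [Sum.forall, Prod.forall]
    simp only [hPl, hPr]
    constructor
    · rintro ⟨h1, h2, h3⟩
      refine ⟨fun i => ⟨congrFun h1 i, (hnoisy i (congrFun h1 i)).1 (congrFun h3 i)⟩, ?_⟩
      intro i j hij
      rw [← h2]
      exact (hedge i j hij h1).symm
    · rintro ⟨h1, h2⟩
      have hσ : lab ω = σ := funext fun i => (h1 i).1
      refine ⟨hσ, ?_, funext fun i => (hnoisy i (h1 i).1).2 (h1 i).2⟩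
      have key : ∀ i j, i < j → (adj ω i j ↔ G.Adj i j) := fun i j hij =>
        (hedge i j hij hσ).trans (h2 i j hij)
      ext i j
      change adj ω i j ↔ G.Adj i j
      rcases lt_trichotomy i j with h | h | h
      · exact key i j h
      · subst h
        exact iff_of_false (fun h => h.1 rfl) (G.loopless.irrefl i)
      · rw [G.adj_comm]
        exact ⟨fun h' => (key j i h).1 (adj_symm h'), fun h' => adj_symm ((key j i h).2 h')⟩
  have e1 : ∀ ω : Conf n, (if lab ω = σ ∧ graph ω = G ∧ noisy ω = τ then (1 : ℝ) else 0) =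
      ∏ x, (if P x (ω x) then (1 : ℝ) else 0) := by
    intro ω
    rw [Fintype.prod_boole]
    simp only [hiff]
  have e2 : pr (law n α (a / n) (b / n)) (fun ω => lab ω = σ ∧ graph ω = G ∧ noisy ω = τ) =
      ex (law n α (a / n) (b / n)) (fun ω => ∏ x, (if P x (ω x) then (1 : ℝ) else 0)) := by
    rw [pr]
    congr 1
    funext ω
    rw [← e1]
    congr
  rw [e2, ex_prod_of_disjoint law_sum (A := fun x => {x})]
  · have e3 : ∀ x, ex (law n α (a / n) (b / n)) (fun ω => if P x (ω x) then (1 : ℝ) else 0) =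
        ∑ k, law n α (a / n) (b / n) x k • (if P x k then (1 : ℝ) else 0) := fun x =>
      ex_coordinate law_sum x (fun k => if P x k then (1 : ℝ) else 0)
    simp_rw [e3]
    rw [Fintype.prod_sum_type, Fintype.prod_prod_type]
    have e4 : ∀ i, ∑ k, law n α (a / n) (b / n) (.inl i) k • (if P (.inl i) k then (1 : ℝ) else 0) =
        1 / 2 * if τ i = σ i then 1 - α else α := by
      intro i
      simp only [Fintype.sum_prod_type, Fintype.sum_bool, law, bern, hPl]
      cases σ i <;> cases τ i <;> simp
    have e5 : ∀ i j, ∑ k, law n α (a / n) (b / n) (.inr (i, j)) k •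
          (if P (.inr (i, j)) k then (1 : ℝ) else 0) =
        if i < j then (if G.Adj i j then (if σ i = σ j then a / n else b / n)
          else 1 - (if σ i = σ j then a / n else b / n)) else 1 := by
      intro i j
      simp only [Fintype.sum_prod_type, Fintype.sum_bool, law, bern, hPr]
      by_cases hij : i < j <;> by_cases hs : σ i = σ j <;> by_cases hG : G.Adj i j <;>
        simp [hij, hs, hG] <;> ring
    rw [Finset.prod_congr rfl fun i _ => e4 i,
      Finset.prod_congr rfl fun i _ => Finset.prod_congr rfl fun j _ => e5 i j]
    rw [weight, Finset.prod_mul_distrib, Finset.prod_const, Finset.card_univ, Fintype.card_fin]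
    have e6 : ∀ i, ∏ j, (if i < j then (if G.Adj i j then (if σ i = σ j then a / n else b / n)
          else 1 - (if σ i = σ j then a / n else b / n)) else (1 : ℝ)) =
        ∏ j ∈ Finset.Ioi i, (if G.Adj i j then (if σ i = σ j then a / n else b / n)
          else 1 - (if σ i = σ j then a / n else b / n)) := by
      intro i
      rw [← Finset.prod_filter]
      refine Finset.prod_congr ?_ fun _ _ => rfl
      ext j; simp
    simp_rw [e6]
    rw [mul_right_comm]
  · intro x _ ω ω' h
    simp only [h x (Set.mem_singleton x)]
  · intro x _ y _ hxy
    exact Set.disjoint_singleton.2 hxy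

lemma prob_eq_pr (a b α : ℝ) (E : (Fin n → Bool) → SimpleGraph (Fin n) → (Fin n → Bool) → Prop) :
    prob n a b α E = pr (law n α (a / n) (b / n)) (fun ω => E (lab ω) (graph ω) (noisy ω)) := by
  classical
  have e1 : ∀ ω : Conf n, (if E (lab ω) (graph ω) (noisy ω) then (1 : ℝ) else 0) =
      ∑ σ : Fin n → Bool, ∑ G : SimpleGraph (Fin n), ∑ τ : Fin n → Bool,
        if E σ G τ then (if lab ω = σ ∧ graph ω = G ∧ noisy ω = τ then (1 : ℝ) else 0) else 0 := by
    intro ω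
    rw [Finset.sum_eq_single (lab ω), Finset.sum_eq_single (graph ω), Finset.sum_eq_single (noisy ω)]
    · simp
    · intro τ _ h; simp [Ne.symm h]
    · simp
    · intro G _ h; simp [Ne.symm h]
    · simp
    · intro σ _ h; simp [Ne.symm h]
    · simp
  have e2 : pr (law n α (a / n) (b / n)) (fun ω => E (lab ω) (graph ω) (noisy ω)) =
      ex (law n α (a / n) (b / n)) (fun ω => if E (lab ω) (graph ω) (noisy ω) then (1 : ℝ) else 0) := by
    rw [pr]
  rw [e2]
  simp only [e1, ex_sum, prob]
  refine Finset.sum_congr rfl fun σ _ => ?_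
  refine Finset.sum_congr (by congr!) fun G _ => Finset.sum_congr rfl fun τ _ => ?_
  split_ifs with h
  · rw [← pr_point, pr]; congr!
  · simp [ex]

/-- The accuracy of an estimator in terms of the law on the sites. -/
lemma accuracy_eq (a b α : ℝ) (s : Estimator n) :
    accuracy a b α s = (1 / n) * ∑ i : Fin n, pr (law n α (a / n) (b / n))
      (fun ω => lab ω i = s (graph ω) (noisy ω) i) := by
  simp only [accuracy, prob_eq_pr]

lemma abs_average_sub_le {f : Fin n → ℝ} {c e : ℝ} (hn : 0 < n) (h : ∀ i, |f i - c| ≤ e) :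
    |(1 / n : ℝ) * ∑ i, f i - c| ≤ e := by
  have hn' : (0 : ℝ) < n := by exact_mod_cast hn
  have e1 : (1 / n : ℝ) * ∑ i, f i - c = (1 / n : ℝ) * ∑ i, (f i - c) := by
    simp only [Finset.sum_sub_distrib, Finset.sum_const, Finset.card_univ, Fintype.card_fin,
      nsmul_eq_mul]
    field_simp
  rw [e1, abs_mul, abs_of_pos (by positivity : (0 : ℝ) < 1 / n), one_div, inv_mul_le_iff₀ hn']
  refine (Finset.abs_sum_le_sum_abs _ _).trans ((Finset.sum_le_sum fun i _ => h i).trans ?_)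
  simp

end Link

/-! ### Belief propagation on trees and the limit of its accuracy. -/

section BeliefPropagation

variable {n : ℕ}

/-- The initial messages of belief propagation in terms of the label and the correctness of the
noisy label. -/
noncomputable def Init.kernel (α : ℝ) : Init → Bool → Bool → ℝ
  | .zero => fun _ _ => 0
  | .noisy => fun s e => Real.tanh (rgam α * spin (if e then s else !s))

/-- The second moment of the initial messages. -/
noncomputable def Init.overlap (α : ℝ) : Init → ℝ
  | .zero => 0
  | .noisy => (1 - 2 * α) ^ 2

/-- For noisy initial messages T = ±(1 - 2α), so T² = (1 - 2α)², and E[σT] = (1 - α)(1 - 2α) - α(1 -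
2α) has the same value. -/
lemma Init.goodInit {α : ℝ} (hα : 0 < α) (hα2 : α < 1 / 2) (I : Init) :
    GoodInit α (I.kernel α) (I.overlap α) := by
  cases I with
  | zero => constructor <;> simp [Init.kernel, Init.overlap]
  | noisy =>
    have ht := tanh_rgam hα hα2
    constructor
    · exact fun s e => (abs_tanh_lt_one _).le
    · intro s e
      simp only [Init.kernel]
      rw [← Real.tanh_neg]
      congr 1
      cases s <;> cases e <;> simp [spin]
    · simp only [Init.overlap]; positivity
    · simp only [Init.overlap]; nlinarith
    · simp only [Init.kernel, Init.overlap, if_true, spin_true, Bool.not_true, spin_false,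
        Bool.false_eq_true, if_false, mul_one, mul_neg, Real.tanh_neg, ht]
      ring
    · simp only [Init.kernel, Init.overlap, if_true, spin_true, Bool.not_true, spin_false,
        Bool.false_eq_true, if_false, mul_one, mul_neg, Real.tanh_neg, ht]
      ring

lemma field_eq {α : ℝ} (hα : 0 < α) (s : Bool) : field α s = ((rgam α * spin s : ℝ) : EReal) := by
  cases s
  · simp [field, gam_eq hα, spin]
  · simp [field, gam_eq hα, spin]

lemma etanh_message_zero {α : ℝ} (hα : 0 < α) (I : Init) (s e : Bool) :
    etanh (I.message α (if e then s else !s)) = I.kernel α s e := by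
  cases I with
  | zero => simp [Init.message, Init.kernel, etanh]
  | noisy => rw [Init.message, field_eq hα, etanh_coe, Init.kernel]

/-- On a tree, belief propagation is given by the self-avoiding recursion. -/
lemma belief_eq {α : ℝ} (hα : 0 < α) (I : Init) (a b : ℝ) (ω : Conf n) (t : ℕ) (i : Fin n)
    (ht : treeLike (adj ω) (t + 1) ∅ i) :
    belief I a b α (graph ω) (noisy ω) (t + 1) i =
      ((rgam α * spin (noisy ω i) +
        bcav (rgam α) (Real.tanh (1 / 2 * Real.log (a / b))) (I.kernel α) ω t ∅ i : ℝ) : EReal) := by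
  classical
  set θ := Real.tanh (1 / 2 * Real.log (a / b)) with hθ
  rw [belief, field_eq hα, EReal.coe_add]
  congr 2
  have hset : (Finset.univ.filter fun l => (graph ω).Adj l i) = nb (adj ω) ∅ i := by
    ext l
    simp only [Finset.mem_filter, Finset.mem_univ, true_and, mem_nb, insert_empty_eq,
      Finset.mem_singleton]
    exact ⟨fun h => ⟨adj_symm h, h.1⟩, fun h => adj_symm h.1⟩
  have hsum : ∀ S : Finset (Fin n), S = nb (adj ω) ∅ i →
      ∑ l ∈ S, F a b (message I a b α (graph ω) (noisy ω) (t + 1 - 1) l i) =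
      ∑ l ∈ nb (adj ω) ∅ i, Real.artanh (θ * bmsg (rgam α) θ (I.kernel α) ω t (insert i ∅) l) := by
    rintro S rfl
    refine Finset.sum_congr rfl fun l hl => ?_
    rw [F, Nat.add_sub_cancel]
    congr 2
    refine nonbacktracking_eq_msg (A := adj ω) (fun x y h => adj_symm h) (fun x h => h.1 rfl)
      (m := fun t i j => etanh (message I a b α (graph ω) (noisy ω) t i j))
      (fun i j => ?_) (fun t i j => ?_) t (mem_nb.1 hl).2 (ht.2 l hl) (Finset.mem_insert_self _ _)
      ?_ ?_
    · rw [message, noisy, etanh_message_zero hα]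
    · rw [message, field_eq hα, ← EReal.coe_add, etanh_coe]
      rfl
    · intro x hx hxl y hy hxy
      have hyi : y = i := by simpa using hy
      subst hyi
      have hxnb : x ∈ nb (adj ω) ∅ y := mem_nb.2 ⟨adj_symm hxy, by simpa using hxy.1⟩
      exact Finset.disjoint_left.1 (ht.1 l hl x hxnb (Ne.symm hxl)) hx (self_mem_reach _ _ _)
    · intro y hy _
      simpa using hy
  rw [bcav_eq]
  refine hsum _ ?_
  rw [← hset]

/-- A tie yields +, so correctness lies between the strict and the weak inequality for the signed
field; both have the same limiting probability. -/
lemma bp_correct_iff {α : ℝ} (hα : 0 < α) (I : Init) (a b : ℝ) (ω : Conf n) (t : ℕ) (i : Fin n)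
    (ht : treeLike (adj ω) (t + 1) ∅ i) :
    (0 < spin (lab ω i) * (rgam α * spin (noisy ω i) +
        bcav (rgam α) (Real.tanh (1 / 2 * Real.log (a / b))) (I.kernel α) ω t ∅ i) →
      lab ω i = bp I a b α (t + 1) (graph ω) (noisy ω) i) ∧
    (lab ω i = bp I a b α (t + 1) (graph ω) (noisy ω) i →
      0 ≤ spin (lab ω i) * (rgam α * spin (noisy ω i) +
        bcav (rgam α) (Real.tanh (1 / 2 * Real.log (a / b))) (I.kernel α) ω t ∅ i)) := by
  simp only [bp, belief_eq hα I a b ω t i ht, EReal.coe_nonneg]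
  set x := rgam α * spin (noisy ω i) +
        bcav (rgam α) (Real.tanh (1 / 2 * Real.log (a / b))) (I.kernel α) ω t ∅ i
  cases lab ω i
  · simp only [spin_false, neg_mul, one_mul, Left.neg_pos_iff, Left.nonneg_neg_iff]
    constructor
    · intro h
      exact (decide_eq_false (not_le.2 h)).symm
    · intro h
      exact (not_le.1 (of_decide_eq_false h.symm)).le
  · simp only [spin_true, one_mul]
    constructor
    · intro h
      exact (decide_eq_true h.le).symm
    · intro h
      exact of_decide_eq_true h.symm

variable {a b : ℕ → ℝ} {lam α : ℝ}

/-- The accuracy of belief propagation converges to the value given by state evolution. -/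
lemma tendsto_accuracy_bp (R : Regime (fun n => a n / n) (fun n => b n / n)
    (fun n => Real.tanh (1 / 2 * Real.log (a n / b n))) lam) (hα : 0 < α) (hα2 : α < 1 / 2)
    (I : Init) (t : ℕ) :
    Tendsto (fun n => accuracy (a n) (b n) α (bp (n := n) I (a n) (b n) α (t + 1))) atTop
      (𝓝 (gaussAccuracy α (lam * overlap α lam (I.overlap α) t))) := by
  obtain ⟨h1, h2⟩ := unifTendsto_sign R hα hα2 (I.goodInit hα hα2) t
  have h3 := R.tendsto_of_smallOrder' (smallOrder_treeBd (t + 1))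
  rw [Metric.tendsto_nhds]
  intro ε hε
  filter_upwards [h1 0 (ε / 3) (by positivity), h2 0 (ε / 3) (by positivity),
    h3.eventually (gt_mem_nhds (by positivity : (0 : ℝ) < ε / 3)),
    R.eventually_valid hα.le (by linarith), eventually_gt_atTop 0] with n g1 g2 g3 hv hn
  have hnn := law_nonneg (n := n) hv
  rw [Real.dist_eq, accuracy_eq]
  -- One third for the sign probabilities, one third for the failure of the tree property, and the
  -- last third makes the inequality strict.
  refine (abs_average_sub_le hn (e := 2 * (ε / 3)) fun i => ?_).trans_lt (by linarith)
  have k1 := abs_le.1 (g1 ∅ i (Finset.notMem_empty i) (by simp))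
  have k2 := abs_le.1 (g2 ∅ i (Finset.notMem_empty i) (by simp))
  have k3 := (pr_not_treeLike_le hv (t + 1) (S := ∅) (i := i)).trans g3.le
  set θ := Real.tanh (1 / 2 * Real.log (a n / b n))
  have k4 : pr (law n α (a n / n) (b n / n))
        (fun ω => lab ω i = bp I (a n) (b n) α (t + 1) (graph ω) (noisy ω) i) ≤
      pr (law n α (a n / n) (b n / n)) (fun ω => 0 ≤ spin (lab ω i) *
        (rgam α * spin (noisy ω i) + bcav (rgam α) θ (I.kernel α) ω t ∅ i)) +
      pr (law n α (a n / n) (b n / n)) (fun ω => ¬ treeLike (supAdj ω) (t + 1) ∅ i) := by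
    refine (pr_mono hnn fun ω h => ?_).trans (pr_or_le hnn _ _)
    by_cases ht : treeLike (supAdj ω) (t + 1) ∅ i
    · exact Or.inl ((bp_correct_iff hα I _ _ ω t i (treeLike_anti supAdj_of_adj _ _ _ ht)).2 h)
    · exact Or.inr ht
  have k5 : pr (law n α (a n / n) (b n / n)) (fun ω => 0 < spin (lab ω i) *
        (rgam α * spin (noisy ω i) + bcav (rgam α) θ (I.kernel α) ω t ∅ i)) ≤
      pr (law n α (a n / n) (b n / n))
        (fun ω => lab ω i = bp I (a n) (b n) α (t + 1) (graph ω) (noisy ω) i) +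
      pr (law n α (a n / n) (b n / n)) (fun ω => ¬ treeLike (supAdj ω) (t + 1) ∅ i) := by
    refine (pr_mono hnn fun ω h => ?_).trans (pr_or_le hnn _ _)
    by_cases ht : treeLike (supAdj ω) (t + 1) ∅ i
    · exact Or.inl ((bp_correct_iff hα I _ _ ω t i (treeLike_anti supAdj_of_adj _ _ _ ht)).1 h)
    · exact Or.inr ht
  rw [abs_le]
  constructor <;> linarith

end BeliefPropagation

/-! ### Optimality of the sign of the posterior mean under approximate weights. -/

section PosteriorBound

variable {V : Type*} [Fintype V] [DecidableEq V]

/-- Resampling the labels in B leaves the uniform law invariant. -/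
lemma sum_marg (B : Finset V) (F : (V → Bool) → ℝ) : ∑ σ, marg B F σ = ∑ σ, F σ := by
  have hc : ∀ τ : V → Bool, pweight unif τ = (1 / 2 : ℝ) ^ Fintype.card V := fun τ => by
    simp [pweight, unif]
  have h1 : (∑ τ : V → Bool, pweight (unif (V := V)) τ) = 1 := sum_pweight sum_unif
  have h2 := sum_swap B (fun (σ _ : V → Bool) => (1 / 2 : ℝ) ^ Fintype.card V * F σ)
  simp only [marg, ex, hc, smul_eq_mul] at h1 h2 ⊢
  rw [h2]
  refine Finset.sum_congr rfl fun σ _ => ?_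
  rw [← Finset.sum_mul, h1, one_mul]

lemma piecewise_piecewise_left {V : Type*} [DecidableEq V] (B : Finset V) (τ ρ σ : V → Bool) :
    B.piecewise τ (B.piecewise ρ σ) = B.piecewise τ σ := by
  funext x
  by_cases hx : x ∈ B <;> simp [hx]

/-- Any decision on the label of `i` is at most as accurate as the sign of the posterior mean
given the labels off `B`, up to the error of the approximation `w ≈ k * W` of the weights. -/
lemma sum_correct_le (B : Finset V) (i : V) {w k W M : (V → Bool) → ℝ} {nice : (V → Bool) → Prop}
    {E : ℝ} (hE : 0 ≤ E) (hw : ∀ σ, 0 ≤ w σ) (hk : ∀ σ, 0 ≤ k σ)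
    (hkB : ∀ σ ρ, k (B.piecewise ρ σ) = k σ) (hnB : ∀ σ ρ, nice (B.piecewise ρ σ) ↔ nice σ)
    (hup : ∀ σ, nice σ → w σ ≤ E * (k σ * W σ)) (hlow : ∀ σ, nice σ → k σ * W σ ≤ E * w σ)
    (hM : ∀ σ, ∃ c : ℝ, 0 < c ∧ ∀ s : Bool,
      marg B (fun ρ => (if ρ i = s then 1 else 0) * W ρ) σ = c * (1 + spin s * M σ)) (s : Bool) :
    open Classical in
    ∑ σ, (if σ i = s ∧ nice σ then w σ else 0) ≤
      E * E * ∑ σ, (if 0 ≤ spin (σ i) * M σ then w σ else 0) := by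
  classical
  -- The marginals do not see the labels in B, and their sum and difference over s determine c and
  -- M; hence M is a function of the labels off B alone.
  have hMB : ∀ σ ρ, M (B.piecewise ρ σ) = M σ := by
    intro σ ρ
    obtain ⟨c, hc, h⟩ := hM σ
    obtain ⟨c', hc', h'⟩ := hM (B.piecewise ρ σ)
    have he : ∀ s, c' * (1 + spin s * M (B.piecewise ρ σ)) = c * (1 + spin s * M σ) := by
      intro s
      rw [← h, ← h']
      simp only [marg, piecewise_piecewise_left]
    have h1 := he true
    have h2 := he false
    simp only [spin_true, spin_false] at h1 h2
    have h3 : c' = c := by linarith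
    subst h3
    have h4 : c' * M (B.piecewise ρ σ) = c' * M σ := by linarith
    exact mul_left_cancel₀ hc.ne' h4
  set g : (V → Bool) → ℝ := fun σ => if nice σ then k σ else 0
  have hg0 : ∀ σ, 0 ≤ g σ := fun σ => by simp only [g]; split_ifs; exacts [hk σ, le_rfl]
  have hgB : ∀ σ ρ, g (B.piecewise ρ σ) = g σ := fun σ ρ => by simp only [g, hnB, hkB]
  have hmargl : ∀ s' σ, marg B (fun ρ => g ρ * ((if ρ i = s' then 1 else 0) * W ρ)) σ =
      g σ * marg B (fun ρ => (if ρ i = s' then 1 else 0) * W ρ) σ := by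
    intro s' σ
    simp only [marg, hgB, ex_const_mul]
  have hmargr : ∀ σ, marg B (fun ρ => g ρ * (if 0 ≤ spin (ρ i) * M ρ then W ρ else 0)) σ =
      g σ * ∑ s' : Bool, (if 0 ≤ spin s' * M σ then
        marg B (fun ρ => (if ρ i = s' then 1 else 0) * W ρ) σ else 0) := by
    intro σ
    have e : ∀ ρ : V → Bool, (if 0 ≤ spin (ρ i) * M ρ then W ρ else 0) =
        ∑ s' : Bool, (if 0 ≤ spin s' * M ρ then (1 : ℝ) else 0) *
          ((if ρ i = s' then 1 else 0) * W ρ) := by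
      intro ρ
      rw [Fintype.sum_bool]
      cases ρ i <;> simp
    rw [show (fun ρ => g ρ * (if 0 ≤ spin (ρ i) * M ρ then W ρ else 0)) = fun ρ => g ρ *
      ∑ s' : Bool, (if 0 ≤ spin s' * M ρ then (1 : ℝ) else 0) *
          ((if ρ i = s' then 1 else 0) * W ρ) from funext fun ρ => by rw [e]]
    simp only [marg, hgB, hMB, ex_const_mul, ex_sum]
    congr 1
    refine Finset.sum_congr rfl fun s' _ => ?_
    split_ifs <;> simp
  calc ∑ σ, (if σ i = s ∧ nice σ then w σ else 0)
      ≤ ∑ σ, E * (g σ * ((if σ i = s then 1 else 0) * W σ)) := by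
        refine Finset.sum_le_sum fun σ _ => ?_
        by_cases h1 : σ i = s <;> by_cases h2 : nice σ <;> simp only [g, h1, h2, if_true, if_false,
          and_true, and_false, one_mul, zero_mul, mul_zero, le_refl]
        exact hup σ h2
    _ = E * ∑ σ, g σ * marg B (fun ρ => (if ρ i = s then 1 else 0) * W ρ) σ := by
        rw [← Finset.mul_sum, ← sum_marg B]
        simp only [hmargl]
    _ ≤ E * ∑ σ, g σ * ∑ s' : Bool, (if 0 ≤ spin s' * M σ then
        marg B (fun ρ => (if ρ i = s' then 1 else 0) * W ρ) σ else 0) := by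
        refine mul_le_mul_of_nonneg_left (Finset.sum_le_sum fun σ _ =>
          mul_le_mul_of_nonneg_left ?_ (hg0 σ)) hE
        obtain ⟨c, hc, h⟩ := hM σ
        simp only [h, Fintype.sum_bool, spin_true, spin_false, one_mul, neg_mul]
        -- The sign of M selects the larger of c(1 + M) and c(1 - M), hence dominates any fixed
        -- choice s. For M = 0 both labels count as correct on the right.
        rcases lt_trichotomy (M σ) 0 with hlt | heq | hgt
        · rw [if_neg (not_le.2 hlt), if_pos (by linarith)]
          cases s <;> simp only [spin_true, spin_false] <;> nlinarith
        · rw [heq]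
          norm_num
          linarith
        · rw [if_pos hgt.le, if_neg (by linarith)]
          cases s <;> simp only [spin_true, spin_false] <;> nlinarith
    _ = E * ∑ σ, g σ * (if 0 ≤ spin (σ i) * M σ then W σ else 0) := by
        rw [← sum_marg B (fun σ => g σ * (if 0 ≤ spin (σ i) * M σ then W σ else 0))]
        simp only [hmargr]
    _ ≤ E * ∑ σ, E * (if 0 ≤ spin (σ i) * M σ then w σ else 0) := by
        refine mul_le_mul_of_nonneg_left (Finset.sum_le_sum fun σ _ => ?_) hE
        by_cases h1 : 0 ≤ spin (σ i) * M σ <;> by_cases h2 : nice σ <;>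
          simp only [g, h1, h2, if_true, if_false, zero_mul, mul_zero, le_refl]
        · exact hlow σ h2
        · exact mul_nonneg hE (hw σ)
    _ = _ := by rw [← Finset.mul_sum, mul_assoc]

end PosteriorBound

/-! ### Sums of spin products over pairs of vertices. -/

section PairSums

lemma prod_sym2_filter_not_isDiag {ι M : Type*} [LinearOrder ι] [CommMonoid M] (s : Finset ι)
    (p : Sym2 ι → M) :
    ∏ i ∈ s.sym2 with ¬ i.IsDiag, p i = ∏ i ∈ s.offDiag with i.1 < i.2, p s(i.1, i.2) :=
  Finset.sum_sym2_filter_not_isDiag (M := Additive M) s fun e => Additive.ofMul (p e)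

variable {n : ℕ}

/-- The pairs of distinct vertices. -/
noncomputable def pairs (C : Finset (Fin n)) : Finset (Sym2 (Fin n)) :=
  open Classical in C.sym2.filter fun e => ¬ e.IsDiag

lemma mem_pairs {C : Finset (Fin n)} {x y : Fin n} :
    s(x, y) ∈ pairs C ↔ (x ∈ C ∧ y ∈ C) ∧ x ≠ y := by
  simp [pairs]

lemma prod_pairs_univ (p : Sym2 (Fin n) → ℝ) :
    ∏ i : Fin n, ∏ j ∈ Finset.Ioi i, p s(i, j) = ∏ e ∈ pairs Finset.univ, p e := by
  classical
  have h := prod_sym2_filter_not_isDiag (Finset.univ : Finset (Fin n)) p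
  have e : pairs (Finset.univ : Finset (Fin n)) =
      (Finset.univ : Finset (Fin n)).sym2.filter fun e => ¬ e.IsDiag := by
    unfold pairs; congr!
  rw [e, h, Finset.prod_sigma']
  refine Finset.prod_nbij' (fun x => (x.1, x.2)) (fun x => ⟨x.1, x.2⟩) ?_ ?_ ?_ ?_ ?_
  · rintro ⟨i, j⟩ h; simp at h; simp [h, h.ne]
  · rintro ⟨i, j⟩ h; simp at h; simp [h.2]
  · simp
  · simp
  · simp

lemma sum_pairSpin (ρ : Fin n → Bool) (C : Finset (Fin n)) :
    ∑ e ∈ pairs C, pairSpin ρ e = ((∑ x ∈ C, spin (ρ x)) ^ 2 - C.card) / 2 := by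
  classical
  have e : pairs C = C.sym2.filter fun e => ¬ e.IsDiag := by
    unfold pairs; congr!
  rw [e, Finset.sum_sym2_filter_not_isDiag]
  simp only [pairSpin_mk]
  have h1 : (∑ x ∈ C, spin (ρ x)) ^ 2 = ∑ x ∈ C.offDiag, spin (ρ x.1) * spin (ρ x.2) + C.card := by
    rw [sq, Finset.sum_mul_sum, ← Finset.sum_product', ← Finset.diag_union_offDiag,
      Finset.sum_union (Finset.disjoint_diag_offDiag C), add_comm]
    congr 1
    rw [Finset.sum_diag]
    simp [spin_mul_self]
  have h2 : ∑ x ∈ C.offDiag, spin (ρ x.1) * spin (ρ x.2) =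
      ∑ x ∈ C.offDiag with x.1 < x.2, spin (ρ x.1) * spin (ρ x.2) +
      ∑ x ∈ C.offDiag with ¬ x.1 < x.2, spin (ρ x.1) * spin (ρ x.2) :=
    (Finset.sum_filter_add_sum_filter_not _ _ _).symm
  have h3 : ∑ x ∈ C.offDiag with ¬ x.1 < x.2, spin (ρ x.1) * spin (ρ x.2) =
      ∑ x ∈ C.offDiag with x.1 < x.2, spin (ρ x.1) * spin (ρ x.2) := by
    refine Finset.sum_nbij' Prod.swap Prod.swap ?_ ?_ ?_ ?_ ?_
    · rintro ⟨x, y⟩ h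
      simp only [Finset.mem_filter, Finset.mem_offDiag, Prod.swap_prod_mk] at h ⊢
      exact ⟨⟨h.1.2.1, h.1.1, Ne.symm h.1.2.2⟩, lt_of_le_of_ne (not_lt.1 h.2) (Ne.symm h.1.2.2)⟩
    · rintro ⟨x, y⟩ h
      simp only [Finset.mem_filter, Finset.mem_offDiag, Prod.swap_prod_mk] at h ⊢
      exact ⟨⟨h.1.2.1, h.1.1, Ne.symm h.1.2.2⟩, not_lt.2 h.2.le⟩
    · simp
    · simp
    · intro x _; simp [mul_comm]
  linarith

/-- The pairs of distinct vertices that meet `B`. -/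
noncomputable def pairsTouching (B : Finset (Fin n)) : Finset (Sym2 (Fin n)) :=
  pairs Finset.univ \ pairs Bᶜ

lemma mem_pairsTouching {B : Finset (Fin n)} {x y : Fin n} :
    s(x, y) ∈ pairsTouching B ↔ x ≠ y ∧ (x ∈ B ∨ y ∈ B) := by
  rw [pairsTouching, Finset.mem_sdiff, mem_pairs, mem_pairs]
  simp only [Finset.mem_univ, Finset.mem_compl, true_and]
  tauto

lemma pairs_mono {C C' : Finset (Fin n)} (h : C ⊆ C') : pairs C ⊆ pairs C' := by
  intro e
  induction e using Sym2.inductionOn with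
  | hf x y =>
    rw [mem_pairs, mem_pairs]
    exact fun hx => ⟨⟨h hx.1.1, h hx.1.2⟩, hx.2⟩

/-- With T and U the sums of spins in and off B, the sum over pairs meeting B is TU + (T² - |B|)/2.
A small imbalance U thus makes it far smaller than the number of such pairs. -/
lemma abs_sum_pairsTouching_le (ρ : Fin n → Bool) {B : Finset (Fin n)} {X Y : ℝ} (hX : 1 ≤ X)
    (hB : (B.card : ℝ) ≤ X) (hY : |∑ x ∈ Bᶜ, spin (ρ x)| ≤ Y) :
    |∑ e ∈ pairsTouching B, pairSpin ρ e| ≤ X ^ 2 + X * Y := by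
  have h1 : ∑ e ∈ pairsTouching B, pairSpin ρ e =
      ∑ e ∈ pairs Finset.univ, pairSpin ρ e - ∑ e ∈ pairs Bᶜ, pairSpin ρ e :=
    Finset.sum_sdiff_eq_sub (pairs_mono (Finset.subset_univ _))
  rw [h1, sum_pairSpin, sum_pairSpin, ← Finset.sum_add_sum_compl B]
  set T := ∑ x ∈ B, spin (ρ x)
  set U := ∑ x ∈ Bᶜ, spin (ρ x)
  have hT : |T| ≤ X := by
    refine (Finset.abs_sum_le_sum_abs _ _).trans ?_
    simpa [abs_spin] using hB
  have hc : ((Finset.univ : Finset (Fin n)).card : ℝ) = B.card + (Bᶜ).card := by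
    rw [Finset.card_univ, ← Finset.card_add_card_compl B]; push_cast; rfl
  rw [hc]
  have hTU : |T * U| ≤ X * Y := by
    rw [abs_mul]; exact mul_le_mul hT hY (abs_nonneg _) (by linarith)
  have hTT : T ^ 2 ≤ X ^ 2 := by
    rw [← sq_abs]; exact pow_le_pow_left₀ (abs_nonneg _) hT 2
  have hB0 : (0 : ℝ) ≤ B.card := Nat.cast_nonneg _
  have h2 := abs_le.1 hTU
  rw [abs_le]
  constructor <;> nlinarith [sq_nonneg T]

lemma card_edgesTouching_le {G : SimpleGraph (Fin n)} {B R : Finset (Fin n)}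
    (h : ∀ x ∈ B, ∀ y, G.Adj x y → x ∈ R ∧ y ∈ R) :
    (edgesTouching G ∅ B).card ≤ R.card ^ 2 := by
  classical
  have hsub : edgesTouching G ∅ B ⊆ (R ×ˢ R).image fun x => s(x.1, x.2) := by
    intro e
    induction e using Sym2.inductionOn with
    | hf x y =>
      rw [mem_edgesTouching]
      rintro ⟨hxy, -, hx | hy⟩
      · obtain ⟨h1, h2⟩ := h x hx y hxy
        exact Finset.mem_image.2 ⟨(x, y), Finset.mem_product.2 ⟨h1, h2⟩, rfl⟩
      · obtain ⟨h1, h2⟩ := h y hy x hxy.symm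
        exact Finset.mem_image.2 ⟨(x, y), Finset.mem_product.2 ⟨h2, h1⟩, rfl⟩
  refine (Finset.card_le_card hsub).trans (Finset.card_image_le.trans ?_)
  rw [Finset.card_product, sq]

end PairSums

/-! ### The posterior of a label: tree weight and negligible nonedge interaction. -/

section Weight

variable {n : ℕ}

/-- Ising form of a function of agreement, used for edges, for nonedges and for the noisy labels. -/
lemma ite_eq_sqrt_mul_exp {x y : ℝ} (hx : 0 < x) (hy : 0 < y) (s s' : Bool) :
    (if s = s' then x else y) =
      √(x * y) * Real.exp (1 / 2 * Real.log (x / y) * (spin s * spin s')) := by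
  have e : √(x * y) = Real.exp (1 / 2 * (Real.log x + Real.log y)) := by
    rw [← Real.log_mul hx.ne' hy.ne', mul_comm (1 / 2 : ℝ), Real.exp_mul, Real.exp_log (by positivity),
      Real.sqrt_eq_rpow]
  rw [e, ← Real.exp_add, Real.log_div hx.ne' hy.ne']
  cases s <;> cases s' <;> simp only [spin_true, spin_false, reduceCtorEq, if_true, if_false]
  · conv_lhs => rw [← Real.exp_log hx]
    congr 1; ring
  · conv_lhs => rw [← Real.exp_log hy]
    congr 1; ring
  · conv_lhs => rw [← Real.exp_log hy]
    congr 1; ring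
  · conv_lhs => rw [← Real.exp_log hx]
    congr 1; ring

/-- The logarithmic strength of the interaction along the pairs that are not joined. -/
noncomputable def nonedgeField (p q : ℝ) : ℝ := 1 / 2 * Real.log ((1 - p) / (1 - q))

lemma abs_nonedgeField_le {p q : ℝ} (hp : 0 ≤ p) (hp1 : p ≤ 1 / 2) (hq : 0 ≤ q) (hq1 : q ≤ 1 / 2) :
    |nonedgeField p q| ≤ p + q := by
  have key : ∀ x : ℝ, 0 ≤ x → x ≤ 1 / 2 → Real.log (1 - x) ≤ 0 ∧ -(2 * x) ≤ Real.log (1 - x) := by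
    intro x hx hx1
    refine ⟨Real.log_nonpos (by linarith) (by linarith), ?_⟩
    have h := Real.one_sub_inv_le_log_of_pos (x := 1 - x) (by linarith)
    refine le_trans ?_ h
    have h2 : (1 - x)⁻¹ ≤ 1 + 2 * x := by
      rw [inv_le_iff_one_le_mul₀ (by linarith)]
      nlinarith
    linarith
  obtain ⟨h1, h2⟩ := key p hp hp1
  obtain ⟨h3, h4⟩ := key q hq hq1
  rw [nonedgeField, Real.log_div (by linarith) (by linarith), abs_le]
  constructor <;> linarith

/-- The factorization of the weight into a factor that does not depend on the labels in `B`, the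
interaction along the edges that meet `B`, and the interaction along the nonedges that meet `B`. -/
lemma exists_weight_eq {a b α : ℝ} (hn : 0 < n) (ha : 0 < a) (hb : 0 < b) (hα : 0 < α)
    (hα1 : α < 1) (ha1 : a / n < 1) (hb1 : b / n < 1) (G : SimpleGraph (Fin n)) (τ : Fin n → Bool)
    (B : Finset (Fin n)) :
    ∃ k : (Fin n → Bool) → ℝ, (∀ σ, 0 ≤ k σ) ∧ (∀ σ ρ, k (B.piecewise ρ σ) = k σ) ∧
      ∀ σ, weight a b α σ G τ = k σ * ((∏ x ∈ B, Real.exp (rgam α * spin (τ x) * spin (σ x))) *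
        ∏ e ∈ edgesTouching G ∅ B, Real.exp (1 / 2 * Real.log (a / b) * pairSpin σ e)) *
        Real.exp (nonedgeField (a / n) (b / n) *
          (∑ e ∈ pairsTouching B, pairSpin σ e - ∑ e ∈ edgesTouching G ∅ B, pairSpin σ e)) := by
  classical
  have hn' : (0 : ℝ) < n := by exact_mod_cast hn
  set β := 1 / 2 * Real.log (a / b)
  set δ := nonedgeField (a / n) (b / n) with hδ
  set c1 := √(a / n * (b / n))
  set c2 := √((1 - a / n) * (1 - b / n))
  set c3 := √((1 - α) * α)
  set Ef : (Fin n → Bool) → Sym2 (Fin n) → ℝ := fun σ e =>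
    if e ∈ G.edgeSet then c1 * Real.exp (β * pairSpin σ e) else c2 * Real.exp (δ * pairSpin σ e)
  set cf : Sym2 (Fin n) → ℝ := fun e => if e ∈ G.edgeSet then c1 else c2
  have hEf : ∀ σ e, Ef σ e = cf e * (if e ∈ G.edgeSet then Real.exp (β * pairSpin σ e) else 1) *
      (if ¬ e ∈ G.edgeSet then Real.exp (δ * pairSpin σ e) else 1) := by
    intro σ e
    by_cases h : e ∈ G.edgeSet <;> simp [Ef, cf, h]
  have hcf : ∀ e, 0 ≤ cf e := fun e => by
    simp only [cf]; split_ifs <;> exact Real.sqrt_nonneg _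
  have hpair : ∀ (σ : Fin n → Bool) i j, (if G.Adj i j then (if σ i = σ j then a / n else b / n)
      else 1 - (if σ i = σ j then a / n else b / n)) = Ef σ s(i, j) := by
    intro σ i j
    have hab : a / n / (b / n) = a / b := by field_simp
    by_cases h : G.Adj i j
    · simp only [Ef, SimpleGraph.mem_edgeSet, h, if_true, pairSpin_mk]
      rw [ite_eq_sqrt_mul_exp (by positivity) (by positivity), hab]
    · simp only [Ef, SimpleGraph.mem_edgeSet, h, if_false, pairSpin_mk]
      rw [hδ, nonedgeField, ← ite_eq_sqrt_mul_exp (by linarith) (by linarith)]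
      split_ifs <;> rfl
  have hweight : ∀ σ, weight a b α σ G τ = (1 / 2) ^ n * (∏ e ∈ pairs Finset.univ, Ef σ e) *
      ∏ x : Fin n, (c3 * Real.exp (rgam α * spin (τ x) * spin (σ x))) := by
    intro σ
    rw [weight, ← prod_pairs_univ]
    congr 1
    · congr 1
      refine Finset.prod_congr rfl fun i _ => Finset.prod_congr rfl fun j _ => ?_
      rw [← hpair]
    · refine Finset.prod_congr rfl fun x _ => ?_
      rw [mul_assoc (rgam α), rgam, ← ite_eq_sqrt_mul_exp (by linarith) hα]
  have hET : edgesTouching G ∅ B = (pairsTouching B).filter fun e => e ∈ G.edgeSet := by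
    ext e
    induction e using Sym2.inductionOn with
    | hf x y =>
      rw [mem_edgesTouching, Finset.mem_filter, mem_pairsTouching, SimpleGraph.mem_edgeSet]
      constructor
      · rintro ⟨h1, -, h2⟩; exact ⟨⟨h1.ne, h2⟩, h1⟩
      · rintro ⟨⟨-, h2⟩, h1⟩; exact ⟨h1, ⟨by simp, by simp⟩, h2⟩
  refine ⟨fun σ => (1 / 2) ^ n * (∏ e ∈ pairs Bᶜ, Ef σ e) * (∏ e ∈ pairsTouching B, cf e) *
    (∏ _x : Fin n, c3) * ∏ x ∈ Bᶜ, Real.exp (rgam α * spin (τ x) * spin (σ x)), ?_, ?_, ?_⟩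
  · intro σ
    have h1 : 0 ≤ ∏ e ∈ pairs Bᶜ, Ef σ e := Finset.prod_nonneg fun e _ => by
      simp only [Ef]; split_ifs <;> positivity
    have h2 : 0 ≤ ∏ e ∈ pairsTouching B, cf e := Finset.prod_nonneg fun e _ => hcf e
    positivity
  · intro σ ρ
    have hoff : ∀ x ∈ Bᶜ, B.piecewise ρ σ x = σ x := fun x hx => by
      rw [Finset.piecewise_eq_of_notMem _ _ _ (Finset.mem_compl.1 hx)]
    have h1 : ∏ e ∈ pairs Bᶜ, Ef (B.piecewise ρ σ) e = ∏ e ∈ pairs Bᶜ, Ef σ e := by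
      refine Finset.prod_congr rfl fun e he => ?_
      induction e using Sym2.inductionOn with
      | hf x y =>
        obtain ⟨⟨hx, hy⟩, -⟩ := mem_pairs.1 he
        simp only [Ef, pairSpin_mk, hoff x hx, hoff y hy]
    have h2 : ∏ x ∈ Bᶜ, Real.exp (rgam α * spin (τ x) * spin (B.piecewise ρ σ x)) =
        ∏ x ∈ Bᶜ, Real.exp (rgam α * spin (τ x) * spin (σ x)) :=
      Finset.prod_congr rfl fun x hx => by rw [hoff x hx]
    simp only [h1, h2]
  · intro σ
    have h1 : ∏ e ∈ pairs Finset.univ, Ef σ e =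
        (∏ e ∈ pairsTouching B, Ef σ e) * ∏ e ∈ pairs Bᶜ, Ef σ e :=
      (Finset.prod_sdiff (pairs_mono (Finset.subset_univ _))).symm
    have h2 : ∏ e ∈ pairsTouching B, Ef σ e = (∏ e ∈ pairsTouching B, cf e) *
        (∏ e ∈ edgesTouching G ∅ B, Real.exp (β * pairSpin σ e)) *
        Real.exp (δ * (∑ e ∈ pairsTouching B, pairSpin σ e -
          ∑ e ∈ edgesTouching G ∅ B, pairSpin σ e)) := by
      simp only [hEf, Finset.prod_mul_distrib]
      rw [← Finset.prod_filter, ← Finset.prod_filter, hET, ← Real.exp_sum, ← Real.exp_sum,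
        ← Finset.mul_sum, ← Finset.mul_sum]
      congr 3
      rw [← Finset.sum_filter_add_sum_filter_not (pairsTouching B) (fun e => e ∈ G.edgeSet)]
      ring
    rw [hweight, h1, h2, Finset.prod_mul_distrib, ← Finset.prod_mul_prod_compl B
      (fun x => Real.exp (rgam α * spin (τ x) * spin (σ x)))]
    ring

lemma weight_nonneg {a b α : ℝ} (ha : 0 ≤ a) (hb : 0 ≤ b) (hα : 0 ≤ α) (hα1 : α ≤ 1)
    (ha1 : a / n ≤ 1) (hb1 : b / n ≤ 1) (σ : Fin n → Bool) (G : SimpleGraph (Fin n))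
    (τ : Fin n → Bool) : 0 ≤ weight a b α σ G τ := by
  have h1 : 0 ≤ a / n := by positivity
  have h2 : 0 ≤ b / n := by positivity
  unfold weight
  refine mul_nonneg (mul_nonneg (by positivity) ?_) ?_
  · refine Finset.prod_nonneg fun i _ => Finset.prod_nonneg fun j _ => ?_
    split_ifs <;> linarith
  · refine Finset.prod_nonneg fun i _ => ?_
    split_ifs <;> linarith

/-- The event that the neighbourhood of `i` is a small tree and that the labels off its interior
are nearly balanced. -/
def Typical (t : ℕ) (i : Fin n) (X Y : ℝ) (σ : Fin n → Bool) (G : SimpleGraph (Fin n)) : Prop :=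
  treeLike G.Adj t ∅ i ∧ ((reach G.Adj t ∅ i).card : ℝ) ≤ X ∧
    |∑ x ∈ (inner G.Adj t ∅ i)ᶜ, spin (σ x)| ≤ Y

/-- The posterior mean of the label of `i` given the labels at distance `t`, up to a positive
factor. -/
noncomputable def oracle (a b α : ℝ) (t : ℕ) (i : Fin n) (σ : Fin n → Bool)
    (G : SimpleGraph (Fin n)) (τ : Fin n → Bool) : ℝ :=
  msg G.Adj (Real.tanh (1 / 2 * Real.log (a / b))) (fun x => rgam α * spin (τ x))
    (fun x => spin (σ x)) t ∅ i

/-- No estimator of the label of `i` is essentially better than the sign of the posterior mean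
given the labels at distance `t`. -/
lemma prob_correct_le {a b α : ℝ} (hn : 0 < n) (ha : 0 < a) (hb : 0 < b) (hα : 0 < α)
    (hα1 : α < 1) (ha1 : a / n ≤ 1 / 2) (hb1 : b / n ≤ 1 / 2) (s : Estimator n) (t : ℕ) (i : Fin n)
    {X Y : ℝ} (hX : 1 ≤ X) (hY : 0 ≤ Y) :
    prob n a b α (fun σ G τ => σ i = s G τ i ∧ Typical t i X Y σ G) ≤
      Real.exp ((a / n + b / n) * (2 * X ^ 2 + X * Y)) ^ 2 *
        prob n a b α (fun σ G τ => 0 ≤ spin (σ i) * oracle a b α t i σ G τ) := by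
  classical
  -- With the graph and the noisy labels fixed, the estimator is a constant and the comparison is
  -- one of sums over σ.
  have hswap : ∀ E : (Fin n → Bool) → SimpleGraph (Fin n) → (Fin n → Bool) → Prop,
      prob n a b α E = ∑ G : SimpleGraph (Fin n), ∑ τ : Fin n → Bool, ∑ σ : Fin n → Bool,
        if E σ G τ then weight a b α σ G τ else 0 := by
    intro E
    rw [prob, Finset.sum_comm]
    refine Finset.sum_congr (by congr!) fun G _ => ?_
    rw [Finset.sum_comm]
  rw [hswap, hswap, Finset.mul_sum]
  refine Finset.sum_le_sum fun G _ => ?_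
  rw [Finset.mul_sum]
  refine Finset.sum_le_sum fun τ _ => ?_
  have hw := weight_nonneg (n := n) ha.le hb.le hα.le hα1.le (by linarith) (by linarith)
  -- These two conditions involve only the graph; the balance condition remains inside the sum,
  -- where it depends only on labels off B.
  by_cases ht : treeLike G.Adj t ∅ i ∧ ((reach G.Adj t ∅ i).card : ℝ) ≤ X
  swap
  · have h0 : ∀ σ : Fin n → Bool, ¬ (σ i = s G τ i ∧ Typical t i X Y σ G) :=
      fun σ h => ht ⟨h.2.1, h.2.2.1⟩
    simp only [h0, if_false, Finset.sum_const_zero]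
    refine mul_nonneg (by positivity) (Finset.sum_nonneg fun σ _ => ?_)
    split_ifs
    exacts [hw _ _ _, le_rfl]
  set B := inner G.Adj t ∅ i with hB
  -- Bound for the nonedge factor and for its inverse. It is used once to replace the weight by the
  -- tree weight and once to return, whence the square.
  set E := Real.exp ((a / n + b / n) * (2 * X ^ 2 + X * Y)) with hE
  obtain ⟨k, hk0, hkB, hk⟩ := exists_weight_eq hn ha hb hα hα1 (by linarith) (by linarith) G τ B
  set W : (Fin n → Bool) → ℝ := fun σ => treeWeight G.Adj (1 / 2 * Real.log (a / b))
    (fun x => rgam α * spin (τ x)) σ t ∅ i with hW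
  set D : (Fin n → Bool) → ℝ := fun σ => nonedgeField (a / n) (b / n) *
    (∑ e ∈ pairsTouching B, pairSpin σ e - ∑ e ∈ edgesTouching G ∅ B, pairSpin σ e) with hD
  have hwD : ∀ σ, weight a b α σ G τ = k σ * W σ * Real.exp (D σ) := by
    intro σ
    rw [hk σ, hW]
    simp only
    rw [treeWeight_eq σ t (Finset.notMem_empty i) ht.1]
  have hkW : ∀ σ, 0 ≤ k σ * W σ := by
    intro σ
    have h := hw σ G τ
    rw [hwD] at h
    exact nonneg_of_mul_nonneg_left h (Real.exp_pos _)
  have hRB : ((edgesTouching G ∅ B).card : ℝ) ≤ X ^ 2 := by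
    have h1 := card_edgesTouching_le (G := G) (B := B) (R := reach G.Adj t ∅ i) fun x hx y hxy =>
      ⟨inner_subset_reach t _ _ hx, mem_reach_of_adj_inner t hx hxy (Finset.notMem_empty y)⟩
    have h2 : ((edgesTouching G ∅ B).card : ℝ) ≤ ((reach G.Adj t ∅ i).card : ℝ) ^ 2 := by
      exact_mod_cast h1
    exact h2.trans (pow_le_pow_left₀ (Nat.cast_nonneg _) ht.2 2)
  have hBX : (B.card : ℝ) ≤ X := le_trans (by
    exact_mod_cast Finset.card_le_card (inner_subset_reach t ∅ i)) ht.2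
  have habs : ∀ σ, |∑ x ∈ Bᶜ, spin (σ x)| ≤ Y →
      |D σ| ≤ (a / n + b / n) * (2 * X ^ 2 + X * Y) := by
    intro σ hσ
    have h1 := abs_sum_pairsTouching_le σ hX hBX hσ
    have h2 : |∑ e ∈ edgesTouching G ∅ B, pairSpin σ e| ≤ X ^ 2 := by
      refine (Finset.abs_sum_le_sum_abs _ _).trans (le_trans ?_ hRB)
      refine (Finset.sum_le_card_nsmul _ _ 1 fun e _ => ?_).trans (by simp)
      induction e using Sym2.inductionOn with
      | hf x y => rw [pairSpin_mk, abs_mul, abs_spin, abs_spin, one_mul]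
    have h3 : |∑ e ∈ pairsTouching B, pairSpin σ e - ∑ e ∈ edgesTouching G ∅ B, pairSpin σ e| ≤
        2 * X ^ 2 + X * Y := (abs_sub _ _).trans (by linarith)
    simp only [hD]
    rw [abs_mul]
    exact mul_le_mul (abs_nonedgeField_le (by positivity) ha1 (by positivity) hb1) h3 (abs_nonneg _)
      (by positivity)
  have hB' : ∀ σ ρ : Fin n → Bool, ∑ x ∈ Bᶜ, spin (B.piecewise ρ σ x) = ∑ x ∈ Bᶜ, spin (σ x) :=
    fun σ ρ => Finset.sum_congr rfl fun x hx => by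
      rw [Finset.piecewise_eq_of_notMem _ _ _ (Finset.mem_compl.1 hx)]
  have hmain := sum_correct_le B i (w := fun σ => weight a b α σ G τ) (k := k) (W := W)
    (M := fun σ => oracle a b α t i σ G τ)
    (nice := fun σ => |∑ x ∈ Bᶜ, spin (σ x)| ≤ Y) (E := E) (Real.exp_pos _).le
    (fun σ => hw σ G τ) hk0 hkB (fun σ ρ => by rw [hB']) ?_ ?_ ?_ (s G τ i)
  · rw [sq]
    refine le_trans (le_of_eq (Finset.sum_congr rfl fun σ _ => ?_)) (hmain.trans (le_of_eq ?_))
    · have : (σ i = s G τ i ∧ Typical t i X Y σ G) ↔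
          (σ i = s G τ i ∧ |∑ x ∈ Bᶜ, spin (σ x)| ≤ Y) :=
        ⟨fun h => ⟨h.1, h.2.2.2⟩, fun h => ⟨h.1, ht.1, ht.2, h.2⟩⟩
      simp only [this]
    · congr!
  · intro σ hσ
    simp only [hwD]
    rw [mul_comm E]
    refine mul_le_mul_of_nonneg_left ?_ (hkW σ)
    exact Real.exp_le_exp.2 ((le_abs_self _).trans (habs σ hσ))
  · intro σ hσ
    simp only [hwD]
    have h1 : 1 ≤ E * Real.exp (D σ) := by
      rw [hE, ← Real.exp_add]
      refine Real.one_le_exp ?_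
      have := (abs_le.1 (habs σ hσ)).1
      linarith
    nlinarith [hkW σ]
  · intro σ
    exact exists_marg_treeWeight rfl σ t (Finset.notMem_empty i) ht.1

end Weight

/-! ### Typical neighbourhoods and the upper bound for every estimator. -/

section UpperBound

variable {n : ℕ} {α p q : ℝ}

lemma ex_spin_lab (i : Fin n) : ex (law n α p q) (fun ω => spin (lab ω i)) = 0 := by
  refine (ex_coordinate law_sum (.inl i) (fun k : Bool × Bool => spin k.1)).trans ?_
  simp only [Fintype.sum_prod_type, Fintype.sum_bool, law, bern, spin_true, spin_false,
    smul_eq_mul, if_true, Bool.false_eq_true, if_false]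
  ring

lemma dependsOn_lab (i : Fin n) : DependsOn (fun ω : Conf n => spin (lab ω i)) {.inl i} := by
  intro ω ω' h
  simp only [lab_congr (h _ (Set.mem_singleton _))]

/-- The labels are nearly balanced with high probability. -/
lemma pr_unbalanced_le (hv : ValidParams α p q) (hn : 0 < n) {y : ℝ} (hy : 0 < y) :
    pr (law n α p q) (fun ω => y < |∑ i, spin (lab ω i)|) ≤ 4 * n / y ^ 2 := by
  have hnn := law_nonneg (n := n) hv
  have hn' : (0 : ℝ) < n := by exact_mod_cast hn
  have h1 := ex_sq_average_le hv (g := fun (i : Fin n) ω => spin (lab ω i)) (L := Finset.univ) (m := 0)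
    (e := 0) (c := 0) (fun i ω => (abs_spin _).le) (by simp) le_rfl
    (fun i _ => by rw [ex_spin_lab]; simp) (fun i _ j _ hij => by
      rw [ex_mul_of_disjoint law_sum (dependsOn_lab i) (dependsOn_lab j)
        (Set.disjoint_singleton.2 fun h => hij (Sum.inl_injective h))]
      simp)
  have h2 : pr (law n α p q) (fun ω => y < |∑ i, spin (lab ω i)|) ≤
      pr (law n α p q) (fun ω => (y / n) ^ 2 < ((1 / n : ℝ) * ∑ i, (spin (lab ω i) - 0)) ^ 2) := by
    refine pr_mono hnn fun ω h => ?_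
    rw [sq_lt_sq, abs_mul, abs_of_pos (by positivity : 0 < y / n),
      abs_of_pos (by positivity : (0 : ℝ) < 1 / n), div_eq_inv_mul, one_div]
    simpa using mul_lt_mul_of_pos_left h (inv_pos.2 hn')
  refine h2.trans ((markov hnn (fun ω => sq_nonneg _) (by positivity)).trans ?_)
  refine (div_le_div_of_nonneg_right h1 (by positivity)).trans (le_of_eq ?_)
  field_simp
  ring

lemma pr_large_reach_le (hv : ValidParams α p q) (t : ℕ) (S : Finset (Fin n)) (i : Fin n) {x : ℝ}
    (hx : 0 < x) : pr (law n α p q) (fun ω => x < ((reach (supAdj ω) t S i).card : ℝ)) ≤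
      (1 + n * reachBd n (p + q) t) / x :=
  (markov (law_nonneg hv) (fun _ => Nat.cast_nonneg _) hx).trans
    (div_le_div_of_nonneg_right (ex_card_reach_le hv t S i) hx.le)

/-- The imbalance off the interior differs from the total imbalance by at most the size of the
interior, hence the threshold y + x. -/
lemma pr_not_typical_le (hv : ValidParams α p q) (hn : 0 < n) (t : ℕ) (i : Fin n) {x y : ℝ}
    (hx : 0 < x) (hy : 0 < y) :
    pr (law n α p q) (fun ω => ¬ Typical t i x (y + x) (lab ω) (graph ω)) ≤
      treeBd n (p + q) t + (1 + n * reachBd n (p + q) t) / x + 4 * n / y ^ 2 := by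
  have hnn := law_nonneg (n := n) hv
  refine le_trans (pr_mono hnn (F := fun ω => (¬ treeLike (supAdj ω) t ∅ i ∨
    x < ((reach (supAdj ω) t ∅ i).card : ℝ)) ∨ y < |∑ i, spin (lab ω i)|) fun ω h => ?_)
    ((pr_or_le hnn _ _).trans (add_le_add ((pr_or_le hnn _ _).trans
      (add_le_add (pr_not_treeLike_le hv t) (pr_large_reach_le hv t ∅ i hx)))
      (pr_unbalanced_le hv hn hy)))
  by_contra hcon
  simp only [not_or, not_not, not_lt] at hcon
  obtain ⟨⟨h1, h2⟩, h3⟩ := hcon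
  refine h ⟨treeLike_anti supAdj_of_adj t _ _ h1, ?_, ?_⟩
  · refine le_trans ?_ h2
    exact_mod_cast Finset.card_le_card (reach_mono supAdj_of_adj t ∅ i)
  · set B := inner (graph ω).Adj t ∅ i with hB
    have hBx : (B.card : ℝ) ≤ x := by
      refine le_trans ?_ h2
      exact_mod_cast Finset.card_le_card
        ((inner_subset_reach t ∅ i).trans (reach_mono supAdj_of_adj t ∅ i))
    have h4 : |∑ x ∈ B, spin (lab ω x)| ≤ x := by
      refine (Finset.abs_sum_le_sum_abs _ _).trans ?_
      simpa [abs_spin] using hBx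
    have h5 : ∑ x ∈ Bᶜ, spin (lab ω x) = ∑ x, spin (lab ω x) - ∑ x ∈ B, spin (lab ω x) := by
      rw [← Finset.sum_add_sum_compl B]; ring
    rw [h5]
    exact (abs_sub _ _).trans (add_le_add h3 h4)

lemma goodInit_oracle (α : ℝ) : GoodInit α (fun s _ => spin s) 1 := by
  constructor
  · exact fun s _ => (abs_spin s).le
  · exact fun s _ => spin_not s
  · exact zero_le_one
  · exact le_rfl
  · simp [spin_true]
  · simp [spin_true]

lemma tanh_nonneg_iff (x : ℝ) : 0 ≤ Real.tanh x ↔ 0 ≤ x := by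
  rw [Real.tanh_eq_sinh_div_cosh, le_div_iff₀ (Real.cosh_pos x), zero_mul, Real.sinh_nonneg_iff]

lemma oracle_nonneg_iff (a b α : ℝ) (t : ℕ) (i : Fin n) (ω : Conf n) :
    0 ≤ spin (lab ω i) * oracle a b α (t + 1) i (lab ω) (graph ω) (noisy ω) ↔
      0 ≤ spin (lab ω i) * (rgam α * spin (noisy ω i) +
        bcav (rgam α) (Real.tanh (1 / 2 * Real.log (a / b))) (fun s _ => spin s) ω t ∅ i) := by
  refine Iff.trans ?_ (tanh_nonneg_iff _)
  rw [← spin_mul_tanh]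
  rfl

/-- The eighth root of the defining property of the regime with exponent 8k. -/
lemma Regime.tendsto_pow_div_root {p q θ : ℕ → ℝ} {lam : ℝ} (R : Regime p q θ lam) (k : ℕ) :
    Tendsto (fun n : ℕ => (1 + n * (p n + q n)) ^ k / (n : ℝ) ^ (1 / 8 : ℝ)) atTop (𝓝 0) := by
  have h := (R.small (8 * k)).rpow_const (p := 1 / 8) (Or.inr (by norm_num))
  rw [Real.zero_rpow (by norm_num)] at h
  refine h.congr fun n => ?_
  have h0 : 0 ≤ 1 + n * (p n + q n) := by
    have := add_nonneg (R.p0 n) (R.q0 n); positivity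
  rw [Real.div_rpow (by positivity) (Nat.cast_nonneg n)]
  congr 1
  rw [pow_mul', ← Real.rpow_natCast (_ ^ k) 8, ← Real.rpow_mul (by positivity)]
  norm_num

/-- Revealing the labels at distance t + 1 starts the state evolution from m = 1; up to vanishing
errors the accuracy of the resulting decision bounds that of every estimator. -/
lemma Regime.eventually_le_of_oracle {a b : ℕ → ℝ} {lam α : ℝ}
    (R : Regime (fun n => a n / n) (fun n => b n / n)
    (fun n => Real.tanh (1 / 2 * Real.log (a n / b n))) lam) (ha : ∀ n, 0 < a n) (hb : ∀ n, 0 < b n)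
    (hα : 0 < α) (hα2 : α < 1 / 2) (t : ℕ) {ε : ℝ} (hε : 0 < ε) :
    ∀ᶠ n in atTop, optAccuracy n (a n) (b n) α ≤
      gaussAccuracy α (lam * overlap α lam 1 t) + ε := by
  set g := gaussAccuracy α (lam * overlap α lam 1 t) with hg
  set r : ℕ → ℝ := fun n => a n / n + b n / n with hr
  have hr0 : ∀ n, 0 ≤ r n := fun n => add_nonneg (R.p0 n) (R.q0 n)
  -- The size bound is x = n^{1/8} and the imbalance bound x⁵ + x. Since n^{5/8} exceeds √n, the
  -- imbalance event has probability at most 4/x², while the nonedge exponent, of order (a + b) x⁶/n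
  -- = (a + b)/x², still vanishes.
  set x : ℕ → ℝ := fun n => (n : ℝ) ^ (1 / 8 : ℝ) with hx
  have hx8 : ∀ n, x n ^ 8 = n := fun n => by
    simp only [hx]
    rw [← Real.rpow_natCast, ← Real.rpow_mul (Nat.cast_nonneg n)]
    norm_num
  have hx1 : ∀ n, 0 < n → 1 ≤ x n := fun n hn =>
    Real.one_le_rpow (by exact_mod_cast hn) (by norm_num)
  have hroot := fun k => R.tendsto_pow_div_root k
  have hinv : Tendsto (fun n => 4 / x n ^ 2) atTop (𝓝 0) := by
    have h1 := hroot 0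
    simp only [pow_zero] at h1
    have h2 := (h1.mul h1).const_mul 4
    rw [mul_zero, mul_zero] at h2
    exact h2.congr fun n => by simp only [hx]; ring
  have hη : Tendsto (fun n => r n * (2 * x n ^ 2 + x n * (x n ^ 5 + x n))) atTop (𝓝 0) := by
    have h1 := (hroot 1).const_mul 4
    rw [mul_zero] at h1
    refine tendsto_of_tendsto_of_tendsto_of_le_of_le' tendsto_const_nhds h1 ?_ ?_
    · filter_upwards [eventually_gt_atTop 0] with n hn
      have := hx1 n hn
      have := hr0 n
      positivity
    · filter_upwards [eventually_gt_atTop 0] with n hn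
      have h2 := hx1 n hn
      have h3 := hr0 n
      have hx0 : 0 < x n := by linarith
      have e1 : (4 : ℝ) * ((1 + n * r n) ^ 1 / x n) = 4 * (1 + x n ^ 8 * r n) / x n := by
        rw [hx8]; ring
      change _ ≤ 4 * ((1 + n * r n) ^ 1 / x n)
      rw [e1, le_div_iff₀ hx0]
      have p1 : x n ^ 3 ≤ x n ^ 8 := pow_le_pow_right₀ h2 (by norm_num)
      have p2 : x n ^ 7 ≤ x n ^ 8 := pow_le_pow_right₀ h2 (by norm_num)
      nlinarith
  have hreach : Tendsto (fun n : ℕ => (1 + n * reachBd n (r n) (t + 1)) / x n) atTop (𝓝 0) := by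
    obtain ⟨C, k, hC, h⟩ := smallOrder_reachBd (t + 1)
    have h1 := (hroot k).const_mul (1 + C)
    rw [mul_zero] at h1
    refine tendsto_of_tendsto_of_tendsto_of_le_of_le' tendsto_const_nhds h1 ?_ ?_
    all_goals
      filter_upwards [eventually_gt_atTop 0] with n hn
      have h2 := hx1 n hn
      obtain ⟨h3, h4⟩ := h n (r n) hn (hr0 n)
      have hn' : (0 : ℝ) < n := by exact_mod_cast hn
      have hx0 : 0 < x n := by linarith
    · positivity
    · rw [← mul_div_assoc]
      refine div_le_div_of_nonneg_right ?_ hx0.le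
      have hD : (1 : ℝ) ≤ (1 + n * r n) ^ k := one_le_pow₀ (by nlinarith [hr0 n])
      rw [le_div_iff₀ hn'] at h4
      change _ ≤ (1 + C) * (1 + n * r n) ^ k
      linarith
  have htree := R.tendsto_of_smallOrder' (smallOrder_treeBd (t + 1))
  have hlim : Tendsto (fun n : ℕ => Real.exp (r n * (2 * x n ^ 2 + x n * (x n ^ 5 + x n))) ^ 2 *
      (g + ε / 2) + (treeBd n (r n) (t + 1) + (1 + n * reachBd n (r n) (t + 1)) / x n + 4 / x n ^ 2))
      atTop (𝓝 (Real.exp 0 ^ 2 * (g + ε / 2) + (0 + 0 + 0))) :=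
    ((((Real.continuous_exp.tendsto 0).comp hη).pow 2).mul_const _).add
      ((htree.add hreach).add hinv)
  have hlt : Real.exp 0 ^ 2 * (g + ε / 2) + (0 + 0 + 0) < g + ε := by
    rw [Real.exp_zero]; linarith
  obtain ⟨hsign, -⟩ := unifTendsto_sign R hα hα2 (goodInit_oracle α) t
  have hr1 := R.tendsto_edge.eventually (ge_mem_nhds (by norm_num : (0 : ℝ) < 1 / 2))
  filter_upwards [hlim.eventually (gt_mem_nhds hlt), hsign 0 (ε / 2) (by positivity),
    R.eventually_valid hα.le (by linarith), eventually_gt_atTop 0, hr1] with n h1 h2 hv hn h3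
  have hnn := law_nonneg (n := n) hv
  have hx1n := hx1 n hn
  have hx0 : 0 < x n := by linarith
  have hn' : (0 : ℝ) < n := by exact_mod_cast hn
  refine ciSup_le fun s => ?_
  rw [accuracy_eq]
  have hi : ∀ i : Fin n, pr (law n α (a n / n) (b n / n))
      (fun ω => lab ω i = s (graph ω) (noisy ω) i) ≤ g + ε := by
    intro i
    refine le_trans ?_ h1.le
    have k1 : pr (law n α (a n / n) (b n / n)) (fun ω => lab ω i = s (graph ω) (noisy ω) i) ≤
        pr (law n α (a n / n) (b n / n)) (fun ω => lab ω i = s (graph ω) (noisy ω) i ∧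
          Typical (t + 1) i (x n) (x n ^ 5 + x n) (lab ω) (graph ω)) +
        pr (law n α (a n / n) (b n / n))
          (fun ω => ¬ Typical (t + 1) i (x n) (x n ^ 5 + x n) (lab ω) (graph ω)) := by
      refine (pr_mono hnn fun ω h => ?_).trans (pr_or_le hnn _ _)
      by_cases ht : Typical (t + 1) i (x n) (x n ^ 5 + x n) (lab ω) (graph ω)
      · exact Or.inl ⟨h, ht⟩
      · exact Or.inr ht
    refine k1.trans (add_le_add ?_ ?_)
    · have hp := R.p0 n
      have hq := R.q0 n
      have k2 := prob_correct_le hn (ha n) (hb n) hα (by linarith) (by linarith) (by linarith) s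
        (t + 1) i hx1n (by positivity : 0 ≤ x n ^ 5 + x n)
      rw [prob_eq_pr, prob_eq_pr] at k2
      refine k2.trans (mul_le_mul_of_nonneg_left ?_ (by positivity))
      simp only [oracle_nonneg_iff]
      have := (abs_le.1 (h2 ∅ i (Finset.notMem_empty i) (by simp))).2
      linarith
    · refine (pr_not_typical_le hv hn (t + 1) i hx0 (by positivity : 0 < x n ^ 5)).trans
        (add_le_add le_rfl (le_of_eq ?_))
      rw [← hx8 n]
      field_simp
  calc (1 / n : ℝ) * ∑ i : Fin n, pr (law n α (a n / n) (b n / n))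
          (fun ω => lab ω i = s (graph ω) (noisy ω) i)
      ≤ (1 / n : ℝ) * ∑ _i : Fin n, (g + ε) :=
        mul_le_mul_of_nonneg_left (Finset.sum_le_sum fun i _ => hi i) (by positivity)
    _ = g + ε := by
        simp only [Finset.sum_const, Finset.card_univ, Fintype.card_fin, nsmul_eq_mul]
        field_simp

end UpperBound

/-! ### The hypotheses on a and b imply the asymptotic regime. -/

section Regime

lemma tanh_half_log {a b : ℝ} (ha : 0 < a) (hb : 0 < b) :
    Real.tanh (1 / 2 * Real.log (a / b)) = (a - b) / (a + b) := by
  have hab : 0 < a + b := by positivity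
  have hm : (a - b) / (a + b) ∈ Set.Ioo (-1 : ℝ) 1 := by
    constructor
    · rw [lt_div_iff₀ hab]; linarith
    · rw [div_lt_iff₀ hab]; linarith
  rw [← Real.tanh_artanh hm, Real.artanh_eq_half_log ⟨hm.1.le, hm.2.le⟩]
  have h1 : 1 + (a - b) / (a + b) = 2 * a / (a + b) := by field_simp; ring
  have h2 : 1 - (a - b) / (a + b) = 2 * b / (a + b) := by field_simp; ring
  rw [h1, h2, div_div_div_cancel_right₀ hab.ne', mul_div_mul_left _ _ two_ne_zero]

/-- The edge probabilities `a / n` and `b / n` of the model are in the regime of state evolution. -/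
lemma regime_of_model {a b : ℕ → ℝ} {μ : ℝ} (ha : ∀ n, 0 < a n) (hb : ∀ n, 0 < b n)
    (hab : (fun n => a n / b n) =Θ[atTop] (fun _ => (1 : ℝ)))
    (hε : ∃ ε : ℕ → ℝ, Tendsto ε atTop (𝓝 0) ∧ ∀ᶠ n : ℕ in atTop, a n = (n : ℝ) ^ ε n)
    (hatop : Tendsto a atTop atTop)
    (hμ : Tendsto (fun n => (a n - b n) / √(b n)) atTop (𝓝 μ)) :
    Regime (fun n => a n / n) (fun n => b n / n)
      (fun n => Real.tanh (1 / 2 * Real.log (a n / b n))) (μ ^ 2 / 4) := by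
  obtain ⟨c, hc0, hc⟩ := hab.1.exists_pos
  obtain ⟨c', hc0', hc'⟩ := hab.2.exists_pos
  have hbtop : Tendsto b atTop atTop := by
    refine tendsto_atTop_mono' _ ?_ (hatop.atTop_div_const hc0)
    filter_upwards [hc.bound] with n hn
    rw [Real.norm_of_nonneg (div_pos (ha n) (hb n)).le, norm_one, mul_one, div_le_iff₀ (hb n)] at hn
    rw [div_le_iff₀ hc0]
    linarith
  have hθ : ∀ n, Real.tanh (1 / 2 * Real.log (a n / b n)) = (a n - b n) / (a n + b n) :=
    fun n => tanh_half_log (ha n) (hb n)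
  have htheta : Tendsto (fun n => Real.tanh (1 / 2 * Real.log (a n / b n))) atTop (𝓝 0) := by
    have h1 : Tendsto (fun n => √(b n) / (a n + b n)) atTop (𝓝 0) := by
      refine squeeze_zero (fun n => ?_) (fun n => ?_)
        (tendsto_inv_atTop_zero.comp (Real.tendsto_sqrt_atTop.comp hbtop))
      · have := ha n; have := hb n; positivity
      · have h2 := Real.sqrt_pos.2 (hb n)
        have h3 := Real.mul_self_sqrt (hb n).le
        simp only [Function.comp]
        rw [div_le_iff₀ (add_pos (ha n) (hb n)), inv_mul_eq_div, le_div_iff₀ h2]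
        linarith [ha n]
    have h2 := hμ.mul h1
    rw [mul_zero] at h2
    refine h2.congr fun n => ?_
    rw [hθ]
    have := (Real.sqrt_pos.2 (hb n)).ne'
    field_simp
  have hn0 : ∀ᶠ n : ℕ in atTop, (0 : ℝ) < n := by
    filter_upwards [eventually_gt_atTop 0] with n hn
    exact_mod_cast hn
  refine ⟨fun n => div_nonneg (ha n).le (Nat.cast_nonneg n),
    fun n => div_nonneg (hb n).le (Nat.cast_nonneg n), fun n => ?_, htheta, ?_, fun k => ?_⟩
  · rw [hθ]
    have : a n + b n ≠ 0 := (add_pos (ha n) (hb n)).ne'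
    rw [← add_div, ← sub_div]
    field_simp
  -- Since 1 - θ = 2b/(a + b), the ratio (a - b)²/(2(a + b)) equals ((a - b)²/b)(1 - θ)/4.
  · have h1 := ((hμ.pow 2).mul ((tendsto_const_nhds (x := (1 : ℝ))).sub htheta)).div_const 4
    rw [sub_zero, mul_one] at h1
    refine h1.congr' ?_
    filter_upwards [hn0] with n hn
    rw [hθ, div_pow, Real.sq_sqrt (hb n).le]
    have h2 : a n + b n ≠ 0 := (add_pos (ha n) (hb n)).ne'
    have h3 := (hb n).ne'
    field_simp
    ring
  · obtain ⟨ε, hε0, hε⟩ := hε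
    -- Eventually a^k = n^{kε} ≤ n^{1/2} and 1 + a + b ≤ (2 + c')a, so the quotient by n is at most
    -- (2 + c')^k n^{-1/2}.
    have hk : Tendsto (fun n => k * ε n) atTop (𝓝 0) := by simpa using hε0.const_mul (k : ℝ)
    have hdecay : Tendsto (fun n : ℕ => (2 + c') ^ k * (n : ℝ) ^ (-(1 / 2) : ℝ)) atTop (𝓝 0) := by
      simpa using ((tendsto_rpow_neg_atTop (by norm_num : (0 : ℝ) < 1 / 2)).comp
        tendsto_natCast_atTop_atTop).const_mul ((2 + c') ^ k)
    refine tendsto_of_tendsto_of_tendsto_of_le_of_le' tendsto_const_nhds hdecay ?_ ?_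
    · filter_upwards [hn0] with n hn
      have := ha n
      have := hb n
      positivity
    · filter_upwards [hn0, hε, hc'.bound, hatop.eventually_ge_atTop 1,
        hk.eventually (ge_mem_nhds (by norm_num : (0 : ℝ) < 1 / 2)), eventually_ge_atTop 1]
        with n hn h1 h2 h3 h4 h5
      rw [norm_one, Real.norm_of_nonneg (div_pos (ha n) (hb n)).le, ← mul_div_assoc,
        le_div_iff₀ (hb n), one_mul] at h2
      have e1 : 1 + (n : ℝ) * (a n / n + b n / n) = 1 + (a n + b n) := by field_simp
      have hn1 : (1 : ℝ) ≤ n := by exact_mod_cast h5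
      have h6 : (1 + (a n + b n)) ^ k ≤ (2 + c') ^ k * a n ^ k := by
        rw [← mul_pow]
        have := ha n
        have := hb n
        exact pow_le_pow_left₀ (by positivity) (by nlinarith) k
      have h7 : a n ^ k ≤ (n : ℝ) ^ (1 / 2 : ℝ) := by
        rw [h1, ← Real.rpow_natCast, ← Real.rpow_mul hn.le, mul_comm]
        exact Real.rpow_le_rpow_of_exponent_le hn1 h4
      have h8 : (n : ℝ) ^ (-(1 / 2) : ℝ) * n = (n : ℝ) ^ (1 / 2 : ℝ) := by
        rw [← Real.rpow_add_one hn.ne']; norm_num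
      rw [e1, div_le_iff₀ hn, mul_assoc, h8]
      exact h6.trans (mul_le_mul_of_nonneg_left h7 (by positivity))

end Regime

/-! ### Bounds for the accuracy, the noiseless case, and the orbit of the overlap. -/

section Accuracy

variable {n : ℕ} {a b α : ℝ}

lemma accuracy_nonneg (hv : ValidParams α (a / n) (b / n)) (s : Estimator n) :
    0 ≤ accuracy a b α s := by
  rw [accuracy_eq]
  exact mul_nonneg (by positivity) (Finset.sum_nonneg fun i _ => pr_nonneg (law_nonneg hv) _)

lemma accuracy_le_one (hv : ValidParams α (a / n) (b / n)) (s : Estimator n) :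
    accuracy a b α s ≤ 1 := by
  rw [accuracy_eq]
  refine (mul_le_mul_of_nonneg_left (Finset.sum_le_sum fun i _ =>
    pr_le_one (law_nonneg hv) law_sum _) (by positivity)).trans ?_
  rcases Nat.eq_zero_or_pos n with rfl | hn
  · simp
  · have hn' : (0 : ℝ) < n := by exact_mod_cast hn
    simp only [Finset.sum_const, Finset.card_univ, Fintype.card_fin, nsmul_eq_mul, mul_one]
    rw [one_div, inv_mul_cancel₀ hn'.ne']

lemma accuracy_le_optAccuracy (hv : ValidParams α (a / n) (b / n)) (s : Estimator n) :
    accuracy a b α s ≤ optAccuracy n a b α :=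
  le_ciSup (f := fun s : Estimator n => accuracy a b α s)
    ⟨1, by rintro _ ⟨s, rfl⟩; exact accuracy_le_one hv s⟩ s

lemma optAccuracy_le_one (hv : ValidParams α (a / n) (b / n)) : optAccuracy n a b α ≤ 1 :=
  ciSup_le fun s => accuracy_le_one hv s

lemma optAccuracy_nonneg (hv : ValidParams α (a / n) (b / n)) : 0 ≤ optAccuracy n a b α :=
  (accuracy_nonneg hv fun _ _ _ => true).trans (accuracy_le_optAccuracy hv _)

/-- Without noise, belief propagation returns the noisy labels. -/
lemma bp_noiseless (I : Init) (a b : ℝ) (t : ℕ) (G : SimpleGraph (Fin n)) (τ : Fin n → Bool)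
    (i : Fin n) : bp I a b 0 t G τ i = τ i := by
  have hg : gam 0 = ⊤ := by simp [gam]
  simp only [bp, belief, field, hg]
  cases τ i
  · simp [EReal.bot_add]
  · simp

lemma accuracy_bp_noiseless (hn : 0 < n) (hv : ValidParams 0 (a / n) (b / n)) (I : Init) (t : ℕ) :
    accuracy a b 0 (bp (n := n) I a b 0 t) = 1 := by
  have hn' : (0 : ℝ) < n := by exact_mod_cast hn
  refine le_antisymm (accuracy_le_one hv _) ?_
  rw [accuracy_eq]
  have h : ∀ i : Fin n, 1 ≤ pr (law n 0 (a / n) (b / n))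
      (fun ω => lab ω i = bp I a b 0 t (graph ω) (noisy ω) i) := by
    intro i
    have h1 : pr (law n 0 (a / n) (b / n)) (fun ω => ok ω i = true) = 1 := by
      rw [pr]
      refine (congrArg _ (funext fun ω => ?_)).trans ((ex_coordinate law_sum (.inl i)
        (fun k : Bool × Bool => if k.2 = true then (1 : ℝ) else 0)).trans ?_)
      · split_ifs <;> first | rfl | contradiction
      simp only [Fintype.sum_prod_type, Fintype.sum_bool, law, bern, smul_eq_mul, if_true,
        Bool.false_eq_true, if_false]
      norm_num
    rw [← h1]
    refine pr_mono (law_nonneg hv) fun ω hω => ?_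
    rw [bp_noiseless, noisy, if_pos hω]
  calc (1 : ℝ) = (1 / n : ℝ) * ∑ _i : Fin n, (1 : ℝ) := by
        simp only [Finset.sum_const, Finset.card_univ, Fintype.card_fin, nsmul_eq_mul, mul_one]
        field_simp
    _ ≤ _ := mul_le_mul_of_nonneg_left (Finset.sum_le_sum fun i _ => h i) (by positivity)

lemma overlap_eq_evolve (α μ c : ℝ) (t : ℕ) :
    μ ^ 2 / 4 * overlap α (μ ^ 2 / 4) c t = evolve α μ (μ ^ 2 / 4 * c) t := by
  induction t with
  | zero => rfl
  | succ t ih => rw [overlap, ih, evolve]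

/-- Zero messages start the orbit at 0. Noisy messages start it at (μ²/4)(1 - 2α)² = (μ²/4) h(0),
one step further along the same orbit. -/
lemma tendsto_overlap {α : ℝ} (hα : 0 ≤ α) (hα2 : α < 1 / 2) {μ v : ℝ}
    (hv : Tendsto (evolve α μ 0) atTop (𝓝 v)) (I : Init) :
    Tendsto (fun t => μ ^ 2 / 4 * overlap α (μ ^ 2 / 4) (I.overlap α) t) atTop (𝓝 v) := by
  simp_rw [overlap_eq_evolve]
  cases I with
  | zero => simpa [Init.overlap] using hv
  | noisy =>
    rw [Init.overlap, ← h_zero_right hα hα2]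
    simp_rw [← evolve_succ']
    exact (tendsto_add_atTop_iff_nat 1).2 hv

end Accuracy

/-! ### Combination of the bounds into the theorem. -/

lemma eq_of_mem_fixedPoints {α μ v w : ℝ} (hα : 0 ≤ α) (hα2 : α < 1 / 2)
    (hv : IsLeast (fixedPoints α μ) v) (hw : IsGreatest (fixedPoints α μ) w)
    (h : |μ| < 2 ∨ 8 < |μ| ∨ α ≤ 1 / 100) : v = w := by
  have hvw := hv.2 hw.1
  rcases h with h | h | h
  · exact fixedPoints_unique_of_small hα hα2 hv.1 hw.1 hvw h
  · exact fixedPoints_unique_of_large hα hα2 hv.1 hw.1 hvw h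
  · exact fixedPoints_unique_of_accurate hα h hv.1 hw.1 hvw

end SBM

theorem theorem2 :
    ∃ C αstar : ℝ, 0 < αstar ∧ αstar < 1 / 2 ∧
      ∀ (α μ : ℝ) (a b : ℕ → ℝ), 0 ≤ α → α < 1 / 2 →
        (∀ n, 0 < a n) → (∀ n, 0 < b n) →
        (fun n => a n / b n) =Θ[atTop] (fun _ => (1 : ℝ)) →
        (∃ ε : ℕ → ℝ, Tendsto ε atTop (𝓝 0) ∧ ∀ᶠ n : ℕ in atTop, a n = (n : ℝ) ^ ε n) →
        Tendsto a atTop atTop →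
        Tendsto (fun n => (a n - b n) / √(b n)) atTop (𝓝 μ) →
        ∃ vlo vhi : ℝ,
          IsLeast (SBM.fixedPoints α μ) vlo ∧ IsGreatest (SBM.fixedPoints α μ) vhi ∧
          limsup (fun n => SBM.optAccuracy n (a n) (b n) α) atTop ≤ SBM.gaussAccuracy α vhi ∧
          (|μ| < 2 ∨ C < |μ| ∨ α ≤ αstar → vlo = vhi) ∧
          ∀ I : SBM.Init, ∃ p : ℕ → ℝ,
            (∀ t, 1 ≤ t → Tendsto
              (fun n => SBM.accuracy (a n) (b n) α (SBM.bp (n := n) I (a n) (b n) α t))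
              atTop (𝓝 (p t))) ∧
            Tendsto p atTop (𝓝 (SBM.gaussAccuracy α vlo)) ∧
            (|μ| < 2 ∨ C < |μ| ∨ α ≤ αstar →
              Tendsto p atTop
                (𝓝 (limsup (fun n => SBM.optAccuracy n (a n) (b n) α) atTop))) := by
  open SBM in
  refine ⟨8, 1 / 100, by norm_num, by norm_num, ?_⟩
  intro α μ a b hα hα2 ha hb hab hε hatop hμ
  have R := regime_of_model ha hb hab hε hatop hμ
  have hval := R.eventually_valid hα (by linarith)
  obtain ⟨vlo, hlo, hlot⟩ := exists_isLeast_fixedPoints hα hα2 μ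
  obtain ⟨vhi, hhi, hhit⟩ := exists_isGreatest_fixedPoints hα hα2 μ
  have hbdd : IsBoundedUnder (· ≤ ·) atTop (fun n => optAccuracy n (a n) (b n) α) :=
    isBoundedUnder_of_eventually_le (a := 1) (hval.mono fun n hv => optAccuracy_le_one hv)
  have hcob : IsCoboundedUnder (· ≤ ·) atTop (fun n => optAccuracy n (a n) (b n) α) :=
    (isBoundedUnder_of_eventually_ge (a := 0)
      (hval.mono fun n hv => optAccuracy_nonneg hv)).isCoboundedUnder_le
  have hupper : limsup (fun n => optAccuracy n (a n) (b n) α) atTop ≤ gaussAccuracy α vhi := by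
    rcases hα.eq_or_lt with rfl | hα0
    · rw [gaussAccuracy_zero_left hhi.1.1]
      exact limsup_le_of_le hcob (hval.mono fun n hv => optAccuracy_le_one hv)
    · have hp : 0 ≤ μ ^ 2 / 4 := by positivity
      -- The bound holds for every depth t after n → ∞; letting t → ∞ afterwards brings in the
      -- greatest fixed point.
      refine ge_of_tendsto' (tendsto_gaussAccuracy hα hα2
        (fun t => evolve_nonneg hα hα2 μ hp t) hhit) fun t => ?_
      refine le_of_forall_pos_le_add fun ε hε => ?_
      have h := R.eventually_le_of_oracle ha hb hα0 hα2 t hε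
      rw [overlap_eq_evolve, mul_one] at h
      exact limsup_le_of_le hcob h
  have hlower : ∀ I : Init, ∃ p : ℕ → ℝ,
      (∀ t, 1 ≤ t → Tendsto (fun n => accuracy (a n) (b n) α (bp (n := n) I (a n) (b n) α t))
        atTop (𝓝 (p t))) ∧ Tendsto p atTop (𝓝 (gaussAccuracy α vlo)) := by
    intro I
    rcases hα.eq_or_lt with rfl | hα0
    · refine ⟨fun _ => 1, fun t _ => ?_, ?_⟩
      · refine tendsto_const_nhds.congr' ?_
        filter_upwards [hval, eventually_gt_atTop 0] with n hv hn
        exact (accuracy_bp_noiseless hn hv I t).symm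
      · rw [gaussAccuracy_zero_left hlo.1.1]
        exact tendsto_const_nhds
    -- The belief at time t combines messages of time t - 1, hence the shift.
    · refine ⟨fun t => gaussAccuracy α (μ ^ 2 / 4 * overlap α (μ ^ 2 / 4) (I.overlap α) (t - 1)),
        fun t ht => ?_, ?_⟩
      · obtain ⟨t, rfl⟩ := Nat.exists_eq_add_of_le' ht
        exact tendsto_accuracy_bp R hα0 hα2 I t
      · refine (tendsto_add_atTop_iff_nat 1).1 ?_
        simp only [Nat.add_sub_cancel]
        have hI := I.goodInit hα0 hα2
        exact tendsto_gaussAccuracy hα hα2 (fun t => mul_nonneg (by positivity)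
          (overlap_mem hα hα2 (by positivity) hI.nonneg hI.le_one t).1)
          (tendsto_overlap hα hα2 hlot I)
  refine ⟨vlo, vhi, hlo, hhi, hupper, eq_of_mem_fixedPoints hα hα2 hlo hhi, fun I => ?_⟩
  obtain ⟨p, hp, hplim⟩ := hlower I
  refine ⟨p, hp, hplim, fun hcase => ?_⟩
  -- For each t belief propagation is an estimator, so its limiting accuracy is at most the upper
  -- limit of the optimum; with equal fixed points the two bounds meet.
  have hge : gaussAccuracy α vlo ≤ limsup (fun n => optAccuracy n (a n) (b n) α) atTop := by
    refine le_of_tendsto hplim ?_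
    filter_upwards [eventually_ge_atTop 1] with t ht
    rw [← (hp t ht).limsup_eq]
    exact limsup_le_limsup (hval.mono fun n hv => accuracy_le_optAccuracy hv _)
      (hp t ht).isCoboundedUnder_le hbdd
  have heq := eq_of_mem_fixedPoints hα hα2 hlo hhi hcase
  rw [← heq] at hupper
  rwa [le_antisymm hupper hge]
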